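/- Let $(M,g_{ab})$ be a spacetime, i.e. a smooth (Hausdorff, second countable) manifold without boundary with a smooth metric of Lorentzian signature $(-,+,\dots,+)$. Let $u:M\to\mathbb R$ be smooth and let $\Sigma=\{u=0\}$ be a null hypersurface, i.e. $du\neq0$ on $\Sigma$ and $g^{ab}\nabla_au\nabla_bu=0$ on $\Sigma$; let $\varphi:\Sigma\to M$ be the embedding, $n^a=g^{ab}\nabla_bu$, and let $q_{ab}=\varphi^*g_{ab}$ be the induced degenerate metric. Suppose that $\pounds_nq_{ab}:=\varphi^*(\pounds_ng_{ab})=f\,q_{ab}$ on $\Sigma$ for a smooth function $f$ on $\Sigma$. For an open set $V\subseteq\Sigma$, say that the conformal pullback method produces a well-defined covariant derivative on $V$ if there is a smooth positive function $\omega$ on $M$ such that, with $\bar g_{ab}=\omega^2g_{ab}$, $\bar n^a=\omega^{-1}n^a$, $\bar q_{ab}=\varphi^*\bar g_{ab}$ and $\bar\nabla$ the Levi-Civita connection of $\bar g$: (i) $\pounds_{\bar n}\bar q_{ab}=0$ on $V$; (ii) for smooth 1-forms $W,W'$ on $M$ with $\varphi^*W=\varphi^*W'$ on $V$ one has $\varphi^*(\bar\nabla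 W)=\varphi^*(\bar\nabla W')$ on $V$; (iii) there is exactly one covariant derivative $D$ on $V$ with $D_a(\varphi^*W_b)=\varphi^*(\bar\nabla_aW_b)$ for all smooth 1-forms $W$ on $M$, and it is smooth. Then every point of $\Sigma$ has an open neighbourhood $V\subseteq\Sigma$ on which the conformal pullback method produces a well-defined covariant derivative. If moreover the null generators of $\Sigma$ (the integral curves of $n^a$ in $\Sigma$) admit a smooth cross-section, i.e. if there is a smooth function $s$ on $M$ such that $n^a\nabla_as>0$ at all points of $\Sigma$ where $s=0$, and every point of $\Sigma$ is joined to a point of $\Sigma$ with $s=0$ by an integral curve of $n^a$ in $\Sigma$, then the conformal pullback method produces a well-defined covariant derivative on all of $\Sigma$. -/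

import Mathlib

open scoped Manifold ContDiff Bundle
open Set

noncomputable section

namespace NullPullback

/-- Abbreviation for the model space of an `n`-dimensional manifold. -/
abbrev Euc (n : ℕ) : Type := EuclideanSpace ℝ (Fin n)

section General

variable {d : ℕ} {M : Type*} [TopologicalSpace M] [ChartedSpace (Euc d) M]
  [IsManifold (𝓡 d) ∞ M]

variable (d M) in
/-- (Not necessarily continuous) vector fields on a `d`-dimensional manifold. -/
abbrev VField : Type _ := ∀ x : M, TangentSpace (𝓡 d) x

variable (d M) in
/-- (Not necessarily continuous) 1-forms. -/
abbrev OneForm : Type _ := ∀ x : M, TangentSpace (𝓡 d) x →L[ℝ] ℝ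

variable (d M) in
/-- (Not necessarily continuous) covariant 2-tensor fields. -/
abbrev TwoTensor : Type _ :=
  ∀ x : M, TangentSpace (𝓡 d) x →L[ℝ] TangentSpace (𝓡 d) x →L[ℝ] ℝ

variable (d M) in
/-- The type of operators `Y ↦ (x ↦ (X ↦ (∇_X Y)(x)))` on vector fields. -/
abbrev CovOp : Type _ :=
  VField d M → ∀ x : M, TangentSpace (𝓡 d) x →L[ℝ] TangentSpace (𝓡 d) x

/-- Smoothness of a vector field. -/
def SmoothVField (X : VField d M) : Prop :=
  ContMDiff (𝓡 d) ((𝓡 d).prod 𝓘(ℝ, Euc d)) ∞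
    (fun x => Bundle.TotalSpace.mk' (Euc d) (E := fun x : M => TangentSpace (𝓡 d) x) x (X x))

/-- Smoothness of a 1-form. -/
def SmoothOneForm (W : OneForm d M) : Prop :=
  ContMDiff (𝓡 d) ((𝓡 d).prod 𝓘(ℝ, Euc d →L[ℝ] ℝ)) ∞
    (fun x => Bundle.TotalSpace.mk' (Euc d →L[ℝ] ℝ)
      (E := fun x : M => TangentSpace (𝓡 d) x →L[ℝ] ℝ) x (W x))

/-- Smoothness of a covariant 2-tensor field. -/
def SmoothTwoTensor (g : TwoTensor d M) : Prop :=
  ContMDiff (𝓡 d) ((𝓡 d).prod 𝓘(ℝ, Euc d →L[ℝ] Euc d →L[ℝ] ℝ)) ∞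
    (fun x => Bundle.TotalSpace.mk' (Euc d →L[ℝ] Euc d →L[ℝ] ℝ)
      (E := fun x : M => TangentSpace (𝓡 d) x →L[ℝ] TangentSpace (𝓡 d) x →L[ℝ] ℝ) x (g x))

/-- The directional derivative `X(h)` at `x` of a function `h`. -/
def dirDeriv (h : M → ℝ) (x : M) (v : TangentSpace (𝓡 d) x) : ℝ :=
  mvfderiv (𝓡 d) h x v

/-- `(£_n g)(X, Y) = n(g(X, Y)) - g([n, X], Y) - g(X, [n, Y])` at `x`. For differentiable `X`, `Y`
it depends only on the values of `X` and `Y` at `x`. -/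
def lieDeriv (g : TwoTensor d M) (n X Y : VField d M) (x : M) : ℝ :=
  dirDeriv (fun y => g y (X y) (Y y)) x (n x)
    - g x (VectorField.mlieBracket (𝓡 d) n X x) (Y x)
    - g x (X x) (VectorField.mlieBracket (𝓡 d) n Y x)

/-- `(∇_X W)(Y) = X(W(Y)) - W(∇_X Y)` at `x`, the covariant derivative of a 1-form. For
differentiable `W`, `Y` it depends on `X` and `Y` only through their values at `x`. -/
def covOneForm (cov : CovOp d M) (W : OneForm d M) (X Y : VField d M) (x : M) : ℝ :=
  dirDeriv (fun y => W y (Y y)) x (X x) - W x (cov Y x (X x))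

/-- `cov` is the Levi-Civita connection of `g`: torsion-free and metric. -/
structure IsLeviCivita
    (cov : CovariantDerivative (𝓡 d) (Euc d) (fun x : M => TangentSpace (𝓡 d) x))
    (g : TwoTensor d M) : Prop where
  torsion_free : ∀ (X Y : VField d M), SmoothVField X → SmoothVField Y → ∀ x,
    cov Y x (X x) - cov X x (Y x) = VectorField.mlieBracket (𝓡 d) X Y x
  metric : ∀ (X Y Z : VField d M), SmoothVField X → SmoothVField Y → SmoothVField Z → ∀ x,
    dirDeriv (fun y => g y (Y y) (Z y)) x (X x)
      = g x (cov Y x (X x)) (Z x) + g x (Y x) (cov Z x (X x))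

/-- The conformally rescaled metric `Ω² g`. -/
def rescale (Ω : M → ℝ) (g : TwoTensor d M) : TwoTensor d M := fun x => (Ω x) ^ 2 • g x

/-- The vector field `n^a = g^{ab} ∇_b u`, that is, `g(n, ·) = du`. -/
def IsGradient (g : TwoTensor d M) (u : M → ℝ) (n : VField d M) : Prop :=
  ∀ (x : M) (v : TangentSpace (𝓡 d) x), g x (n x) v = dirDeriv u x v

end General

section Lorentz

variable {m : ℕ} {M : Type*} [TopologicalSpace M] [ChartedSpace (Euc (m + 1)) M]
  [IsManifold (𝓡 (m + 1)) ∞ M]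

/-- A smooth Lorentzian metric, of signature `(-, +, …, +)`, on an `(m+1)`-dimensional manifold. -/
structure IsLorentzMetric (g : TwoTensor (m + 1) M) : Prop where
  smooth : SmoothTwoTensor g
  symm : ∀ (x : M) (v w : TangentSpace (𝓡 (m + 1)) x), g x v w = g x w v
  signature : ∀ x : M, ∃ e : Module.Basis (Fin (m + 1)) ℝ (TangentSpace (𝓡 (m + 1)) x),
    ∀ i j, g x (e i) (e j) = if i = j then (if i = 0 then -1 else 1) else 0

variable {N : Type*} [TopologicalSpace N] [ChartedSpace (Euc m) N] [IsManifold (𝓡 m) ∞ N]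

/-- The differential of `φ` at `p`. -/
def dmap (φ : N → M) (p : N) : TangentSpace (𝓡 m) p →L[ℝ] TangentSpace (𝓡 (m + 1)) (φ p) :=
  mfderiv (𝓡 m) (𝓡 (m + 1)) φ p

/-- The pullback `φ^* W` of a 1-form. -/
def pullbackForm (φ : N → M) (W : OneForm (m + 1) M) : OneForm m N :=
  fun p => (W (φ p)).comp (dmap φ p)

/-- The pullback `q = φ^* g` of a 2-tensor. -/
def pullbackTensor (φ : N → M) (g : TwoTensor (m + 1) M) (p : N)
    (v w : TangentSpace (𝓡 m) p) : ℝ :=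
  g (φ p) (dmap φ p v) (dmap φ p w)

/-- `φ^*(£_n g) = f φ^* g` on `V`; when `n` is tangent to the image of `φ` this
is `£_n q = f q` for `q = φ^* g`. -/
def PullbackLieEqOn (φ : N → M) (g : TwoTensor (m + 1) M) (n : VField (m + 1) M)
    (f : N → ℝ) (V : Set N) : Prop :=
  ∀ p ∈ V, ∀ (v w : TangentSpace (𝓡 m) p) (X Y : VField (m + 1) M),
    SmoothVField X → SmoothVField Y → X (φ p) = dmap φ p v → Y (φ p) = dmap φ p w →
      lieDeriv g n X Y (φ p) = f p * pullbackTensor φ g p v w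

/-- On `V`, the pullback of `∇ W` depends only on the pullback of `W`. -/
def PullbackWellDefinedOn (φ : N → M) (cov : CovOp (m + 1) M) (V : Set N) : Prop :=
  ∀ W W' : OneForm (m + 1) M, SmoothOneForm W → SmoothOneForm W' →
    (∀ p ∈ V, pullbackForm φ W p = pullbackForm φ W' p) →
    ∀ p ∈ V, ∀ (v w : TangentSpace (𝓡 m) p) (X Y : VField (m + 1) M),
      SmoothVField X → SmoothVField Y → X (φ p) = dmap φ p v → Y (φ p) = dmap φ p w →
        covOneForm cov W X Y (φ p) = covOneForm cov W' X Y (φ p)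

/-- `D_a (φ^* W_b) = φ^* (∇_a W_b)` on `V` for all 1-forms `W`. -/
def IsPullbackOn (φ : N → M) (cov : CovOp (m + 1) M) (D : CovOp m N) (V : Set N) : Prop :=
  ∀ W : OneForm (m + 1) M, SmoothOneForm W → ∀ p ∈ V,
    ∀ (X' Y' : VField m N) (X Y : VField (m + 1) M),
      SmoothVField X' → SmoothVField Y' → SmoothVField X → SmoothVField Y →
      X (φ p) = dmap φ p (X' p) → Y (φ p) = dmap φ p (Y' p) →
        covOneForm D (pullbackForm φ W) X' Y' p = covOneForm cov W X Y (φ p)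

/-- The conformal pullback method works on the open set `V` of the hypersurface: after a suitable
conformal rescaling `ḡ = Ω² g`, `n̄ = Ω⁻¹ n`, with `£_n̄ q̄ = 0` on `V`, the pullback
of the Levi-Civita connection of `ḡ` is well defined on `V`, and defines there a smooth
covariant derivative `D`, which is unique. -/
def ConformalPullbackOn (φ : N → M) (g : TwoTensor (m + 1) M) (n : VField (m + 1) M)
    (V : Set N) : Prop :=
  ∃ Ω : M → ℝ, ContMDiff (𝓡 (m + 1)) 𝓘(ℝ, ℝ) ∞ Ω ∧ (∀ x, 0 < Ω x) ∧
    PullbackLieEqOn φ (rescale Ω g) (fun x => (Ω x)⁻¹ • n x) 0 V ∧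
    ∃ cov : CovariantDerivative (𝓡 (m + 1)) (Euc (m + 1))
        (fun x : M => TangentSpace (𝓡 (m + 1)) x),
      IsLeviCivita cov (rescale Ω g) ∧
      PullbackWellDefinedOn φ cov V ∧
      ∃ D : CovOp m N,
        IsCovariantDerivativeOn (Euc m) D V ∧
        ContMDiffCovariantDerivativeOn (Euc m) ∞ D V ∧
        IsPullbackOn φ cov D V ∧
        ∀ D' : CovOp m N, IsCovariantDerivativeOn (Euc m) D' V → IsPullbackOn φ cov D' V →
          ∀ Y : VField m N, SmoothVField Y → ∀ p ∈ V, D' Y p = D Y p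

/-- The null generators of `{u = 0}` (the integral curves of `n` in it) admit a smooth
cross-section `{u = 0, s = 0}`: it is crossed transversally, in the direction of increasing `s`,
and every point of `{u = 0}` is joined to it by an integral curve of `n` in `{u = 0}`. (Hence no
generator meets it for two different values of the parameter.) -/
def HasCrossSection (u : M → ℝ) (n : VField (m + 1) M) : Prop :=
  ∃ s : M → ℝ, ContMDiff (𝓡 (m + 1)) 𝓘(ℝ, ℝ) ∞ s ∧
    (∀ x, u x = 0 → s x = 0 → 0 < dirDeriv s x (n x)) ∧
    ∀ x, u x = 0 → ∃ (γ : ℝ → M) (a b : ℝ), γ a = x ∧ s (γ b) = 0 ∧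
      (∀ t ∈ uIcc a b, u (γ t) = 0) ∧ IsMIntegralCurveOn (I := 𝓡 (m + 1)) γ n (uIcc a b)

end Lorentz

end NullPullback

end

open NullPullback

/-! The hypothesis £_n q = f q says that the failure of £_n q to vanish is pure trace, and a
conformal factor can absorb it. With Ω = exp h, ḡ = Ω²g and n̄ = Ω⁻¹n, the derivatives of Ω⁻¹ enter
£_n̄ ḡ only through g(n, X) = du(X), which vanishes on vectors tangent to Σ; hence £_n̄ q̄ = Ω (f +
2 n(h)) q (`lieDeriv_rescale`). It remains to solve n(h) = -f/2 on Σ. Since n is null and normal it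
is tangent to Σ, so this is a linear ODE along the generators. Near a point it is solved by
integrating from a transversal (`exists_local_solution`), and with a cross-section by integrating
from the cross-section (`exists_global_solution`), where transversality in one direction makes the
crossing time unique. As Σ is closed in M, the solution extends to M.

Once £_n̄ q̄ = 0, the hypersurface is totally geodesic for the Levi-Civita connection of ḡ
(`totallyGeodesicOn_of_lieDeriv`). The dual form of n̄ is Ω du, so (X, Y) ↦ ḡ(∇_X n̄, Y) is
symmetric on tangent vectors; its symmetrization is half of £_n̄ q̄, so it vanishes. Differentiating
ḡ(Y, n̄) = 0 then gives ḡ(∇_X Y, n̄) = 0, that is, ∇_X Y is tangent. The connection therefore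
restricts to a connection D on Σ, and φ^*(∇W) = D(φ^*W) depends only on φ^*W. Uniqueness follows by
testing against the forms ḡ(T, ·).

The supporting analysis is the smooth dependence of flows on initial data, obtained from the
implicit function theorem in C([-1,1], E) (`exists_smooth_flow`), and the Levi-Civita connection,
constructed by the Koszul formula. -/

open scoped Topology

noncomputable section

namespace NullPullback

set_option linter.unusedSectionVars false

/-! ### The implicit function theorem, with smoothness near the base point -/

section Implicit

variable {A B C : Type*} [NormedAddCommGroup A] [NormedSpace ℝ A] [CompleteSpace A]
  [NormedAddCommGroup B] [NormedSpace ℝ B] [CompleteSpace B]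
  [NormedAddCommGroup C] [NormedSpace ℝ C] [CompleteSpace C]

/-- A version of the implicit function theorem in which the implicit function is smooth at every
point of a neighbourhood. -/
theorem exists_smooth_implicitFunction {G : A × B → C} {z : A × B}
    (hG : ∀ᶠ y in 𝓝 z, ContDiffAt ℝ ∞ G y)
    (hz : (fderiv ℝ G z ∘L .inr ℝ A B).IsInvertible) :
    ∃ ψ : A → B, ψ z.1 = z.2 ∧ (∀ᶠ a in 𝓝 z.1, ContDiffAt ℝ ∞ ψ a ∧ G (a, ψ a) = G z) ∧
      ∀ᶠ y in 𝓝 z, G y = G z → ψ y.1 = y.2 := by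
  have hne : (∞ : ℕ∞ω) ≠ 0 := by simp
  have hGz := hG.self_of_nhds
  set ψ := hGz.implicitFunction hne hz with hψ
  have hψz : ψ z.1 = z.2 := hGz.implicitFunction_apply_self hne hz
  have hψs : ContDiffAt ℝ ∞ ψ z.1 := hGz.contDiffAt_implicitFunction hne hz
  have hψe := hGz.eventually_apply_implicitFunction hne hz
  have hψu := hGz.eventually_apply_eq_iff_implicitFunction hne hz
  have hψc : ∀ᶠ a in 𝓝 z.1, ContinuousAt ψ a :=
    ((hψs.of_le (m := 1) (by norm_cast)).eventually (by simp)).mono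
      fun a ha ↦ ha.continuousAt
  have hinv : ∀ᶠ y in 𝓝 z, (fderiv ℝ G y ∘L .inr ℝ A B).IsInvertible := by
    have hc : ContinuousAt (fun y ↦ fderiv ℝ G y ∘L .inr ℝ A B) z := by
      have : ContinuousAt (fderiv ℝ G) z := hGz.continuousAt_fderiv hne
      exact this.clm_comp continuousAt_const
    have := hc.eventually (ContinuousLinearEquiv.isOpen.mem_nhds (x := fderiv ℝ G z ∘L .inr ℝ A B) hz)
    exact this
  have htend : Filter.Tendsto (fun a ↦ (a, ψ a)) (𝓝 z.1) (𝓝 z) := by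
    have : ContinuousAt (fun a ↦ (a, ψ a)) z.1 := continuousAt_id.prodMk hψs.continuousAt
    simpa [ContinuousAt, hψz] using this
  refine ⟨ψ, hψz, ?_, hψu.mono fun y hy h ↦ hy.1 h⟩
  filter_upwards [hψe, hψe.eventually_nhds, hψc, htend.eventually hG, htend.eventually hinv]
    with a ha ha' hc hGa hia
  refine ⟨?_, ha⟩
  -- The theorem is applied afresh at `(a, ψ a)`. Its implicit function is smooth at `a`, and local
  -- uniqueness identifies it with `ψ` near `a`.
  have h1 := hGa.contDiffAt_implicitFunction hne hia
  refine h1.congr_of_eventuallyEq ?_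
  have h2 := hGa.eventually_apply_eq_iff_implicitFunction hne hia
  have htend' : Filter.Tendsto (fun a ↦ (a, ψ a)) (𝓝 a) (𝓝 (a, ψ a)) :=
    continuousAt_id.prodMk hc
  filter_upwards [htend'.eventually h2, ha'] with b hb hb'
  exact (hb.1 (hb'.trans ha.symm)).symm

end Implicit

/-! ### Smoothness of composition operators on spaces of continuous functions -/

section Omega

set_option synthInstance.maxHeartbeats 200000

universe w

variable {K : Type*} [TopologicalSpace K] [CompactSpace K]
variable {E F : Type w} [NormedAddCommGroup E] [NormedSpace ℝ E]
  [NormedAddCommGroup F] [NormedSpace ℝ F]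

variable {G : Type*} [NormedAddCommGroup G] [NormedSpace ℝ G]

/-- The pointwise application of a continuous bilinear map to two continuous functions. -/
def pointwiseBilin (K : Type*) [TopologicalSpace K] [CompactSpace K] (b : G →L[ℝ] E →L[ℝ] F) :
    C(K, G) →L[ℝ] C(K, E) →L[ℝ] C(K, F) :=
  LinearMap.mkContinuous₂
    (LinearMap.mk₂ ℝ (fun (A : C(K, G)) (ξ : C(K, E)) ↦
        (⟨fun k ↦ b (A k) (ξ k), by fun_prop⟩ : C(K, F)))
      (fun _ _ _ ↦ by ext; simp) (fun _ _ _ ↦ by ext; simp)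
      (fun _ _ _ ↦ by ext; simp) (fun _ _ _ ↦ by ext; simp)) ‖b‖
    (fun A ξ ↦ by
      rw [ContinuousMap.norm_le _ (by positivity)]
      intro k
      refine (b.le_opNorm₂ _ _).trans ?_
      gcongr
      · exact A.norm_coe_le_norm k
      · exact ξ.norm_coe_le_norm k)

@[simp]
lemma pointwiseBilin_apply (b : G →L[ℝ] E →L[ℝ] F) (A : C(K, G)) (ξ : C(K, E)) (k : K) :
    pointwiseBilin K b A ξ k = b (A k) (ξ k) := rfl

/-- The mean value inequality on the segment from `ξ k` to `ξ k + η k` bounds the remainder by the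
oscillation of the derivative. This is small uniformly in `k`, because composition with `v'` is
continuous in the sup norm. -/
lemma hasFDerivAt_postcomp (b : G →L[ℝ] E →L[ℝ] F) {v : C(E, F)} {v' : C(E, G)}
    (hb : ∀ a, ‖b a‖ ≤ ‖a‖) (hv : ∀ x, HasFDerivAt v (b (v' x)) x) (ξ : C(K, E)) :
    HasFDerivAt (fun ζ : C(K, E) ↦ v.comp ζ) (pointwiseBilin K b (v'.comp ξ)) ξ := by
  rw [hasFDerivAt_iff_isLittleO_nhds_zero, Asymptotics.isLittleO_iff]
  intro c hc
  have hcont : Continuous fun ζ : C(K, E) ↦ v'.comp ζ := ContinuousMap.continuous_postcomp v'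
  obtain ⟨δ, hδ, h⟩ := Metric.continuousAt_iff.1 (hcont.continuousAt (x := ξ)) c hc
  filter_upwards [Metric.ball_mem_nhds (0 : C(K, E)) hδ] with η hη
  rw [mem_ball_zero_iff] at hη
  rw [ContinuousMap.norm_le _ (by positivity)]
  intro k
  have key : ‖v (ξ k + η k) - v (ξ k) - b (v' (ξ k)) (ξ k + η k - ξ k)‖
      ≤ c * ‖ξ k + η k - ξ k‖ := by
    refine (convex_segment (ξ k) (ξ k + η k)).norm_image_sub_le_of_norm_hasFDerivWithin_le'
      (f := v) (f' := fun y ↦ b (v' y)) (fun y _ ↦ (hv y).hasFDerivWithinAt) ?_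
      (left_mem_segment ℝ _ _) (right_mem_segment ℝ _ _)
    intro y hy
    rw [segment_eq_image'] at hy
    obtain ⟨t, ht, rfl⟩ := hy
    have h1 : dist (ξ + t • η) ξ < δ := by
      rw [dist_eq_norm, add_sub_cancel_left, norm_smul, Real.norm_eq_abs, abs_of_nonneg ht.1]
      exact (mul_le_of_le_one_left (norm_nonneg _) ht.2).trans_lt hη
    have h2 := (ContinuousMap.dist_apply_le_dist k).trans (h h1).le
    rw [dist_eq_norm] at h2
    rw [← map_sub]
    refine (hb _).trans ?_
    simpa using h2
  have h3 : ‖η k‖ ≤ ‖η‖ := η.norm_coe_le_norm k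
  simp only [add_sub_cancel_left] at key
  refine le_trans (le_of_eq ?_) (key.trans (mul_le_mul_of_nonneg_left h3 hc.le))
  simp

/-- The derivative of composition with `v` is pointwise multiplication by composition with `fderiv ℝ
v`, so the induction passes from `F` to `E →L[ℝ] F`. This is why `F` is quantified inside the
induction and shares a universe with `E`. -/
theorem contDiff_postcomp_nat (n : ℕ) : ∀ {F : Type w} [NormedAddCommGroup F] [NormedSpace ℝ F]
    (v : C(E, F)), ContDiff ℝ ∞ v → ContDiff ℝ n (fun ζ : C(K, E) ↦ v.comp ζ) := by
  induction n with
  | zero =>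
    intro F _ _ v _
    exact_mod_cast contDiff_zero.2 (ContinuousMap.continuous_postcomp v)
  | succ n ih =>
    intro F _ _ v hv
    have hv' : ContDiff ℝ ∞ (fderiv ℝ v) := hv.fderiv_right (by simp)
    have h1 := ih ⟨fderiv ℝ v, hv'.continuous⟩ hv'
    have h2 := (pointwiseBilin K (ContinuousLinearMap.id ℝ (E →L[ℝ] F))).contDiff.comp h1
    push_cast
    rw [contDiff_succ_iff_hasFDerivAt]
    exact ⟨_, h2, hasFDerivAt_postcomp (ContinuousLinearMap.id ℝ (E →L[ℝ] F))
      (v' := ⟨fderiv ℝ v, hv'.continuous⟩) (fun _ ↦ le_rfl)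
      fun x ↦ (hv.differentiable (by simp) x).hasFDerivAt⟩

/-- Composition with a smooth map is smooth between spaces of continuous functions. -/
theorem contDiff_postcomp (v : C(E, F)) (hv : ContDiff ℝ ∞ v) :
    ContDiff ℝ ∞ (fun ζ : C(K, E) ↦ v.comp ζ) :=
  contDiff_infty.2 fun n ↦ contDiff_postcomp_nat n v hv

end Omega

/-! ### Smooth local flows on a Banach space -/

section Flow

universe w

variable {E : Type w} [NormedAddCommGroup E] [NormedSpace ℝ E] [CompleteSpace E]

/-- The interval `[-1, 1]`. -/
abbrev SymmIcc : Type := Icc (-1 : ℝ) 1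

/-- The projection of `ℝ` onto `[-1, 1]`. -/
def projSymm : C(ℝ, SymmIcc) := ⟨projIcc (-1) 1 (by norm_num), continuous_projIcc⟩

lemma projSymm_coe (τ : SymmIcc) : projSymm (τ : ℝ) = τ := projIcc_val (by norm_num) τ

lemma continuous_comp_projSymm (ξ : C(SymmIcc, E)) : Continuous fun s : ℝ ↦ ξ (projSymm s) := by
  fun_prop

/-- The primitive vanishing at `0` of a continuous function on `[-1, 1]`. -/
def primitive : C(SymmIcc, E) →L[ℝ] C(SymmIcc, E) :=
  LinearMap.mkContinuous
    { toFun := fun ξ ↦ ⟨fun τ ↦ ∫ s in (0 : ℝ)..τ, ξ (projSymm s),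
        (intervalIntegral.continuous_primitive
          (fun a b ↦ (continuous_comp_projSymm ξ).intervalIntegrable a b) 0).comp
          continuous_subtype_val⟩
      map_add' := fun ξ η ↦ by
        ext τ
        exact intervalIntegral.integral_add
          ((continuous_comp_projSymm ξ).intervalIntegrable _ _)
          ((continuous_comp_projSymm η).intervalIntegrable _ _)
      map_smul' := fun c ξ ↦ by
        ext τ
        exact intervalIntegral.integral_smul c _ } 1
    (fun ξ ↦ by
      rw [ContinuousMap.norm_le _ (by positivity)]
      intro τ
      have := intervalIntegral.norm_integral_le_of_norm_le_const (a := 0) (b := (τ : ℝ))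
        (f := fun s ↦ ξ (projSymm s)) (C := ‖ξ‖) fun s _ ↦ ξ.norm_coe_le_norm _
      rw [sub_zero] at this
      refine this.trans ?_
      rw [mul_comm]
      exact mul_le_mul_of_nonneg_right (abs_le.2 τ.2) (norm_nonneg _))

/-- The embedding of constant functions. -/
def constSymm : E →L[ℝ] C(SymmIcc, E) :=
  ContinuousLinearMap.const ℝ SymmIcc

@[simp]
lemma constSymm_apply (x : E) (τ : SymmIcc) : constSymm x τ = x := rfl

/-- The map whose zeros are the solutions `ξ` on `[-1, 1]` of `ξ' = t v(ξ)`, `ξ 0 = x`. -/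
def flowEq (v : C(E, E)) (y : (E × ℝ) × C(SymmIcc, E)) : C(SymmIcc, E) :=
  y.2 - constSymm y.1.1 - y.1.2 • primitive (v.comp y.2)

lemma flowEq_eq_zero_iff {v : C(E, E)} {x : E} {t : ℝ} {ξ : C(SymmIcc, E)} :
    flowEq v ((x, t), ξ) = 0 ↔
      ∀ τ : SymmIcc, ξ τ = x + t • ∫ s in (0 : ℝ)..τ, v (ξ (projSymm s)) := by
  rw [DFunLike.ext_iff]
  refine forall_congr' fun τ ↦ ?_
  have : flowEq v ((x, t), ξ) τ = ξ τ - x - t • ∫ s in (0 : ℝ)..τ, v (ξ (projSymm s)) := rfl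
  rw [this, ContinuousMap.zero_apply, sub_sub, sub_eq_zero]

lemma contDiff_flowEq {v : C(E, E)} (hv : ContDiff ℝ ∞ v) : ContDiff ℝ ∞ (flowEq v) := by
  have h1 : ContDiff ℝ ∞ fun y : (E × ℝ) × C(SymmIcc, E) ↦ v.comp y.2 :=
    (contDiff_postcomp v hv).comp contDiff_snd
  have h2 := (primitive (E := E)).contDiff.comp h1
  have h3 : ContDiff ℝ ∞ fun y : (E × ℝ) × C(SymmIcc, E) ↦ constSymm y.1.1 :=
    (constSymm (E := E)).contDiff.comp (contDiff_fst.comp contDiff_fst)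
  exact (contDiff_snd.sub h3).sub ((contDiff_snd.comp contDiff_fst).smul h2)

/-- A smooth vector field has a smooth local flow. -/
theorem exists_smooth_flow {v : E → E} (hv : ContDiff ℝ ∞ v) (x₀ : E) :
    ∃ α : E × ℝ → E, ∀ᶠ z in 𝓝 (x₀, (0 : ℝ)), ContDiffAt ℝ ∞ α z ∧ α (z.1, 0) = z.1 ∧
      HasDerivAt (fun s ↦ α (z.1, s)) (v (α z)) z.2 := by
  set V : C(E, E) := ⟨v, hv.continuous⟩ with hV
  set y₀ : (E × ℝ) × C(SymmIcc, E) := ((x₀, 0), constSymm x₀) with hy₀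
  have hs := contDiff_flowEq (v := V) hv
  have h0 : flowEq V y₀ = 0 := by rw [hy₀, flowEq_eq_zero_iff]; simp
  -- At `t = 0` the nonlinear integral term is multiplied by zero, so the partial derivative in `ξ`
  -- is the identity.
  have hd : fderiv ℝ (flowEq V) y₀ ∘L .inr ℝ (E × ℝ) C(SymmIcc, E) = .id ℝ _ := by
    have h1 := ((hs.differentiable (by simp) y₀).hasFDerivAt).comp (constSymm x₀)
      (f := fun ξ : C(SymmIcc, E) ↦ ((x₀, (0 : ℝ)), ξ)) (hasFDerivAt_prodMk_right _ _)
    have h2 : HasFDerivAt (flowEq V ∘ fun ξ : C(SymmIcc, E) ↦ ((x₀, (0 : ℝ)), ξ))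
        (.id ℝ _) (constSymm x₀) := by
      have : (flowEq V ∘ fun ξ : C(SymmIcc, E) ↦ ((x₀, (0 : ℝ)), ξ)) =
          fun ξ ↦ ξ - constSymm x₀ := by
        ext1 ξ
        simp [flowEq]
      rw [this]
      exact (hasFDerivAt_id _).sub_const _
    exact h1.unique h2
  obtain ⟨ψ, hψ0, hψ, hψu⟩ := exists_smooth_implicitFunction (G := flowEq V) (z := y₀)
    (Filter.Eventually.of_forall fun y ↦ hs.contDiffAt)
    (by rw [hd]; exact ⟨.refl ℝ _, rfl⟩)
  simp only [h0] at hψ hψu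
  change ψ (x₀, 0) = constSymm x₀ at hψ0
  replace hψ : ∀ᶠ a in 𝓝 (x₀, (0 : ℝ)), ContDiffAt ℝ ∞ ψ a ∧ flowEq V (a, ψ a) = 0 := hψ
  -- a ball around the base point on which everything holds
  obtain ⟨ε, hε, hball⟩ := Metric.eventually_nhds_iff_ball.1 hψu
  have hψc : ContinuousAt ψ (x₀, 0) := hψ.self_of_nhds.1.continuousAt
  have hclose : ∀ᶠ a in 𝓝 (x₀, (0 : ℝ)), dist (ψ a) (constSymm x₀) < ε := by
    have := hψc.eventually (Metric.ball_mem_nhds _ hε)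
    rwa [hψ0] at this
  obtain ⟨ρ, hρ, hρ'⟩ := Metric.eventually_nhds_iff_ball.1
    ((hψ.and hclose).and (Metric.ball_mem_nhds (x₀, (0 : ℝ)) hε))
  have one_mem : (1 : ℝ) ∈ Icc (-1 : ℝ) 1 := by norm_num
  set e1 : SymmIcc := ⟨1, one_mem⟩
  have hmem : ∀ {x : E} {t : ℝ}, dist x x₀ < ρ → |t| < ρ → (x, t) ∈ Metric.ball (x₀, (0 : ℝ)) ρ := by
    intro x t hx ht
    rw [Metric.mem_ball, Prod.dist_eq]
    exact max_lt hx (by simpa using ht)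
  -- rescaling of solutions
  have hscale : ∀ {x : E} {t : ℝ}, dist x x₀ < ρ → |t| < ρ → ∀ τ : SymmIcc,
      ψ (x, t * τ) e1 = ψ (x, t) τ := by
    intro x t hx ht τ
    have hτ : |(τ : ℝ)| ≤ 1 := abs_le.2 τ.2
    have htτ : |t * τ| < ρ := by
      rw [abs_mul]; exact (mul_le_of_le_one_right (abs_nonneg _) hτ).trans_lt ht
    have hmul : ∀ σ : SymmIcc, (τ * σ : ℝ) ∈ Icc (-1 : ℝ) 1 := fun σ ↦ by
      rw [mem_Icc, ← abs_le, abs_mul]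
      exact mul_le_one₀ hτ (abs_nonneg _) (abs_le.2 σ.2)
    obtain ⟨⟨-, hsol⟩, hcl⟩ := (hρ' _ (hmem hx ht)).1
    have hbb := (hρ' _ (hmem hx htτ)).2
    -- Slowing a solution down by the factor `τ` gives a solution for the parameter `t * τ`. It
    -- takes only values of the original curve, hence stays in the `ε`-ball where solutions are
    -- unique.
    set ζ : C(SymmIcc, E) := ⟨fun σ ↦ ψ (x, t) ⟨τ * σ, hmul σ⟩, by fun_prop⟩ with hζ
    have hζsol : flowEq V ((x, t * τ), ζ) = 0 := by
      rw [flowEq_eq_zero_iff] at hsol ⊢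
      intro σ
      rw [hζ]
      simp only [ContinuousMap.coe_mk]
      rw [hsol, mul_smul]
      congr 2
      have h1 := intervalIntegral.smul_integral_comp_mul_left (a := 0) (b := (σ : ℝ))
        (fun s ↦ V (ψ (x, t) (projSymm s))) (τ : ℝ)
      rw [mul_zero] at h1
      rw [← h1]
      congr 1
      refine intervalIntegral.integral_congr fun s hs ↦ ?_
      have hs' : s ∈ Icc (-1 : ℝ) 1 :=
        (convex_Icc (-1 : ℝ) 1).ordConnected.uIcc_subset (by norm_num) σ.2 hs
      have e2 : projSymm s = ⟨s, hs'⟩ := projSymm_coe ⟨s, hs'⟩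
      have e3 : projSymm (τ * s) = ⟨τ * s, hmul ⟨s, hs'⟩⟩ := projSymm_coe ⟨τ * s, hmul ⟨s, hs'⟩⟩
      simp only [e2, e3]
    have hζcl : dist ζ (constSymm x₀) < ε := by
      refine lt_of_le_of_lt ?_ hcl
      rw [ContinuousMap.dist_le dist_nonneg]
      intro σ
      exact ContinuousMap.dist_apply_le_dist (f := ψ (x, t)) (g := constSymm x₀) ⟨τ * σ, hmul σ⟩
    have := hball ((x, t * τ), ζ) (by
      rw [Metric.mem_ball, Prod.dist_eq]
      exact max_lt hbb hζcl) hζsol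
    simp only at this
    rw [this, hζ]
    simp [e1]
  -- As `ψ (x, t)` runs through the orbit at speed `t`, its value at parameter 1 is the flow at time
  -- `t`.
  refine ⟨fun a ↦ ψ a e1, ?_⟩
  filter_upwards [Metric.ball_mem_nhds (x₀, (0 : ℝ)) (half_pos hρ)] with ⟨x, t⟩ hz
  rw [Metric.mem_ball, Prod.dist_eq, max_lt_iff] at hz
  have hx : dist x x₀ < ρ := by have := hz.1; simp only at this; linarith
  have ht : |t| < ρ / 2 := by simpa using hz.2
  have hev : ContDiff ℝ ∞ fun ξ : C(SymmIcc, E) ↦ ξ e1 :=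
    (ContinuousMap.evalCLM ℝ e1 : C(SymmIcc, E) →L[ℝ] E).contDiff
  have hxt := hρ' _ (hmem hx (ht.trans (half_lt_self hρ)))
  have hδ : |ρ / 2| < ρ := by rw [abs_of_pos (half_pos hρ)]; exact half_lt_self hρ
  obtain ⟨⟨-, hsol⟩, -⟩ := (hρ' _ (hmem hx hδ)).1
  rw [flowEq_eq_zero_iff] at hsol
  have habs := abs_lt.1 ht
  -- By rescaling, the flow of `x` at all times `|s| < ρ / 2` is read off the single curve `ψ (x, ρ
  -- / 2)`, so the fundamental theorem of calculus gives its time derivative.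
  have key : ∀ s : ℝ, |s| < ρ / 2 →
      ψ (x, s) e1 = x + (ρ / 2) • ∫ r in (0 : ℝ)..(s / (ρ / 2)), V (ψ (x, ρ / 2) (projSymm r)) := by
    intro s hs
    have hm : s / (ρ / 2) ∈ Icc (-1 : ℝ) 1 := by
      rw [mem_Icc, ← abs_le, abs_div, abs_of_pos (half_pos hρ)]
      exact (div_le_one (half_pos hρ)).2 hs.le
    have := hscale hx hδ ⟨_, hm⟩
    rw [hsol] at this
    rw [← this]
    simp only
    rw [mul_div_cancel₀ _ (half_pos hρ).ne']
  refine ⟨hev.contDiffAt.comp _ hxt.1.1.1, ?_, ?_⟩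
  · have := key 0 (by simpa using half_pos hρ)
    simpa using this
  · have hm : t / (ρ / 2) ∈ Icc (-1 : ℝ) 1 := by
      rw [mem_Icc, ← abs_le, abs_div, abs_of_pos (half_pos hρ)]
      exact (div_le_one (half_pos hρ)).2 ht.le
    have hc : Continuous fun r : ℝ ↦ V (ψ (x, ρ / 2) (projSymm r)) := by fun_prop
    have h1 : HasDerivAt (fun u : ℝ ↦ ∫ r in (0 : ℝ)..u, V (ψ (x, ρ / 2) (projSymm r)))
        (V (ψ (x, ρ / 2) (projSymm (t / (ρ / 2))))) (t / (ρ / 2)) :=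
      (hc.integral_hasStrictDerivAt 0 _).hasDerivAt
    have h2 := (h1.scomp t ((hasDerivAt_id t).div_const (ρ / 2))).const_smul (ρ / 2) |>.const_add x
    have h3 : ψ (x, t) e1 = ψ (x, ρ / 2) (projSymm (t / (ρ / 2))) := by
      have := hscale hx hδ ⟨_, hm⟩
      rw [show projSymm (t / (ρ / 2)) = ⟨_, hm⟩ from projSymm_coe ⟨_, hm⟩, ← this]
      simp only
      rw [mul_div_cancel₀ _ (half_pos hρ).ne']
    have h4 : HasDerivAt (fun s ↦ ψ (x, s) e1) ((ρ / 2) • (1 / (ρ / 2)) •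
        V (ψ (x, ρ / 2) (projSymm (t / (ρ / 2))))) t := by
      refine h2.congr_of_eventuallyEq ?_
      filter_upwards [(continuous_abs.tendsto t).eventually (gt_mem_nhds ht)] with s hs
      exact key s hs
    rw [smul_smul, mul_one_div_cancel (half_pos hρ).ne', one_smul] at h4
    change HasDerivAt (fun s ↦ ψ (x, s) e1) (v (ψ (x, t) e1)) t
    rw [h3]
    exact h4

end Flow

/-! ### Transfer of flows to manifolds -/

section Chart

variable {m : ℕ} {N : Type*} [TopologicalSpace N] [ChartedSpace (Euc m) N] [IsManifold (𝓡 m) ∞ N]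

lemma hasMFDerivAt_extChartAt_symm_comp {p : N} {c : ℝ → Euc m} {t : ℝ}
    (hct : c t ∈ (extChartAt (𝓡 m) p).target)
    {V : TangentSpace (𝓡 m) ((extChartAt (𝓡 m) p).symm (c t))}
    (hc : HasDerivAt c (mfderiv (𝓡 m) 𝓘(ℝ, Euc m) (extChartAt (𝓡 m) p)
      ((extChartAt (𝓡 m) p).symm (c t)) V) t) :
    HasMFDerivAt 𝓘(ℝ, ℝ) (𝓡 m) (fun s ↦ (extChartAt (𝓡 m) p).symm (c s)) t
      ((1 : ℝ →L[ℝ] ℝ).smulRight V) := by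
  have h1 : HasMFDerivAt 𝓘(ℝ, Euc m) (𝓡 m) (extChartAt (𝓡 m) p).symm (c t)
      (mfderivWithin 𝓘(ℝ, Euc m) (𝓡 m) (extChartAt (𝓡 m) p).symm (range (𝓡 m)) (c t)) := by
    have := (mdifferentiableWithinAt_extChartAt_symm (I := 𝓡 m) hct).hasMFDerivWithinAt
    rw [ModelWithCorners.range_eq_univ] at this
    rw [ModelWithCorners.range_eq_univ]
    exact hasMFDerivWithinAt_univ.1 this
  have h2 := h1.comp t hc.hasFDerivAt.hasMFDerivAt
  have h3 := mfderivWithin_extChartAt_symm_comp_mfderiv_extChartAt (I := 𝓡 m) hct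
  have h4 := congrArg (fun L ↦ L V) h3
  refine h2.congr_mfderiv (ContinuousLinearMap.ext_ring ?_)
  change mfderivWithin 𝓘(ℝ, Euc m) (𝓡 m) (extChartAt (𝓡 m) p).symm (range (𝓡 m)) (c t)
    ((1 : ℝ) • (mfderiv (𝓡 m) 𝓘(ℝ, Euc m) (extChartAt (𝓡 m) p)
      ((extChartAt (𝓡 m) p).symm (c t)) V)) = (1 : ℝ) • V
  rw [one_smul, one_smul]
  exact h4

end Chart

section Extension

variable {E : Type*} [NormedAddCommGroup E] [NormedSpace ℝ E] [FiniteDimensional ℝ E]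
  {H : Type*} [TopologicalSpace H] {I : ModelWithCorners ℝ E H}
  {M : Type*} [TopologicalSpace M] [ChartedSpace H M] [IsManifold I ∞ M] [T2Space M]
  [SigmaCompactSpace M] [LocallyCompactSpace M]
  {F : Type*} [NormedAddCommGroup F] [NormedSpace ℝ F]

/-- A function which is smooth near a point agrees near this point with a smooth function. -/
lemma exists_contMDiff_eventuallyEq {f : M → F} {p : M}
    (hf : ∀ᶠ x in 𝓝 p, ContMDiffAt I 𝓘(ℝ, F) ∞ f x) :
    ∃ f' : M → F, ContMDiff I 𝓘(ℝ, F) ∞ f' ∧ f' =ᶠ[𝓝 p] f := by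
  classical
  obtain ⟨U, hU, hUo, hpU⟩ := eventually_nhds_iff.1 hf
  obtain ⟨K, hK, hpK, hKU⟩ := exists_compact_subset hUo hpU
  -- The value is prescribed only on the compact neighbourhood `K`; local candidates `f` on `U` and
  -- `0` off `K` are glued by a partition of unity.
  obtain ⟨f', hf'⟩ := exists_contMDiffMap_forall_mem_convex_of_local (n := ⊤) I
    (t := fun x ↦ if x ∈ K then {f x} else univ)
    (fun x ↦ by
      split_ifs
      · exact convex_singleton _
      · exact convex_univ)
    (fun x ↦ by
      by_cases hx : x ∈ U
      · refine ⟨U, hUo.mem_nhds hx, f, fun y hy ↦ (hU y hy).contMDiffWithinAt, fun y _ ↦ ?_⟩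
        split_ifs <;> simp
      · refine ⟨Kᶜ, hK.isClosed.isOpen_compl.mem_nhds fun h ↦ hx (hKU h), 0,
          contMDiffOn_const, fun y hy ↦ ?_⟩
        rw [if_neg hy]; trivial)
  refine ⟨f', f'.contMDiff, ?_⟩
  filter_upwards [mem_interior_iff_mem_nhds.1 hpK] with x hx
  have := hf' x
  rwa [if_pos hx] at this

end Extension

section FlowBox

variable {m : ℕ} {N : Type*} [TopologicalSpace N] [ChartedSpace (Euc m) N] [IsManifold (𝓡 m) ∞ N]

/-- The flow of a smooth vector field `X` exists locally and is smooth; so are the integrals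
`∫ F` of a smooth function along the flow lines. -/
theorem exists_flowBox {X : VField m N} (hX : SmoothVField X) {F : N → ℝ}
    (hF : ContMDiff (𝓡 m) 𝓘(ℝ, ℝ) ∞ F) (p : N) :
    ∃ (Φ : N × ℝ → N) (J : N × ℝ → ℝ), ∀ᶠ z in 𝓝 (p, (0 : ℝ)),
      ContMDiffAt ((𝓡 m).prod 𝓘(ℝ, ℝ)) (𝓡 m) ∞ Φ z ∧
      ContMDiffAt ((𝓡 m).prod 𝓘(ℝ, ℝ)) 𝓘(ℝ, ℝ) ∞ J z ∧ Φ (z.1, 0) = z.1 ∧ J (z.1, 0) = 0 ∧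
      HasMFDerivAt 𝓘(ℝ, ℝ) (𝓡 m) (fun s ↦ Φ (z.1, s)) z.2
        ((1 : ℝ →L[ℝ] ℝ).smulRight (X (Φ z))) ∧
      HasDerivAt (fun s ↦ J (z.1, s)) (F (Φ z)) z.2 := by
  set χ := extChartAt (𝓡 m) p with hχ
  set e := trivializationAt (Euc m) (TangentSpace (𝓡 m)) p with he
  have hbase : e.baseSet = χ.source := by
    rw [hχ, extChartAt_source]; exact TangentBundle.trivializationAt_baseSet p
  have hopen : IsOpen χ.target := isOpen_extChartAt_target p
  have hmt : χ p ∈ χ.target := mem_extChartAt_target p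
  set a : Euc m → Euc m := fun z ↦ (e ⟨χ.symm z, X (χ.symm z)⟩).2 with ha
  have hsymm : ContMDiffOn 𝓘(ℝ, Euc m) (𝓡 m) ∞ χ.symm χ.target := contMDiffOn_extChartAt_symm p
  have haS : ContMDiffOn 𝓘(ℝ, Euc m) 𝓘(ℝ, Euc m) ∞ a χ.target := by
    have h1 := (Bundle.Trivialization.contMDiffOn_section_baseSet_iff (IB := 𝓡 m) (n := ∞) (s := X) e).1
      hX.contMDiffOn
    exact h1.comp hsymm fun z hz ↦ by
      rw [mem_preimage, hbase]; exact χ.map_target hz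
  have hFS : ContMDiffOn 𝓘(ℝ, Euc m) 𝓘(ℝ, ℝ) ∞ (fun z ↦ F (χ.symm z)) χ.target :=
    hF.comp_contMDiffOn hsymm
  have haX : ∀ z ∈ χ.target, a z = mfderiv (𝓡 m) 𝓘(ℝ, Euc m) χ (χ.symm z) (X (χ.symm z)) := by
    intro z hz
    have hx : χ.symm z ∈ (chartAt (Euc m) p).source := by
      rw [← extChartAt_source (I := 𝓡 m)]; exact χ.map_target hz
    have hb : χ.symm z ∈ e.baseSet := by rw [hbase]; exact χ.map_target hz
    have h1 := congrArg (fun L ↦ L (X (χ.symm z)))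
      (TangentBundle.continuousLinearMapAt_trivializationAt (I := 𝓡 m) hx)
    exact (Bundle.Trivialization.continuousLinearMapAt_apply_of_mem ℝ e hb _).symm.trans h1
  -- The field is augmented by a real coordinate with velocity `F`. The last component of its flow
  -- started at height 0 is the integral of `F`, so `J` is smooth along with `Φ`.
  obtain ⟨v, hv, hvw⟩ := exists_contMDiff_eventuallyEq (I := 𝓘(ℝ, Euc m × ℝ))
    (f := fun z : Euc m × ℝ ↦ (a z.1, F (χ.symm z.1))) (p := (χ p, (0 : ℝ))) (by
      have : ∀ᶠ z in 𝓝 (χ p, (0 : ℝ)), z.1 ∈ χ.target :=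
        continuousAt_fst.eventually (hopen.mem_nhds hmt)
      filter_upwards [this] with z hz
      refine ContDiffAt.contMDiffAt (ContDiffAt.prodMk ?_ ?_)
      · exact ((haS z.1 hz).contMDiffAt (hopen.mem_nhds hz)).contDiffAt.comp z contDiffAt_fst
      · exact ((hFS z.1 hz).contMDiffAt (hopen.mem_nhds hz)).contDiffAt.comp z contDiffAt_fst)
  obtain ⟨α, hα⟩ := exists_smooth_flow hv.contDiff (χ p, (0 : ℝ))
  set ι : N × ℝ → (Euc m × ℝ) × ℝ := fun z ↦ ((χ z.1, 0), z.2) with hι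
  have hιs : ∀ z : N × ℝ, z.1 ∈ χ.source →
      ContMDiffAt ((𝓡 m).prod 𝓘(ℝ, ℝ)) 𝓘(ℝ, (Euc m × ℝ) × ℝ) ∞ ι z := by
    intro z hz
    have h1 : ContMDiffAt (𝓡 m) 𝓘(ℝ, Euc m) ∞ χ z.1 :=
      contMDiffAt_extChartAt' (by rwa [hχ, extChartAt_source] at hz)
    exact ((h1.comp z contMDiffAt_fst).prodMk_space contMDiffAt_const).prodMk_space contMDiffAt_snd
  have hps : p ∈ χ.source := mem_extChartAt_source p
  have hιc : ContinuousAt ι (p, 0) := (hιs (p, 0) hps).continuousAt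
  have hαc : ContinuousAt (fun z ↦ α (ι z)) (p, 0) :=
    (hα.self_of_nhds.1.continuousAt).comp (f := ι) (x := (p, (0 : ℝ))) hιc
  have hα0 : α (ι (p, 0)) = (χ p, 0) := hα.self_of_nhds.2.1
  refine ⟨fun z ↦ χ.symm (α (ι z)).1, fun z ↦ (α (ι z)).2, ?_⟩
  have e1 : ∀ᶠ z in 𝓝 (p, (0 : ℝ)), z.1 ∈ χ.source :=
    continuousAt_fst.eventually ((isOpen_extChartAt_source p).mem_nhds hps)
  have e2 := hιc.eventually hα
  have e3 : ∀ᶠ z in 𝓝 (p, (0 : ℝ)), v (α (ι z)) =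
      (a (α (ι z)).1, F (χ.symm (α (ι z)).1)) := by
    refine hαc.eventually (p := fun y ↦ v y = (a y.1, F (χ.symm y.1))) ?_
    change ∀ᶠ y in 𝓝 (α (ι (p, 0))), _
    rw [hα0]; exact hvw
  have e4 : ∀ᶠ z in 𝓝 (p, (0 : ℝ)), (α (ι z)).1 ∈ χ.target := by
    refine hαc.eventually (p := fun y ↦ y.1 ∈ χ.target) ?_
    change ∀ᶠ y in 𝓝 (α (ι (p, 0))), _
    rw [hα0]; exact continuousAt_fst.eventually (hopen.mem_nhds hmt)
  filter_upwards [e1, e2, e3, e4] with z h1 h2 h3 h4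
  obtain ⟨h2a, h2b, h2c⟩ := h2
  have hαι : ContMDiffAt ((𝓡 m).prod 𝓘(ℝ, ℝ)) 𝓘(ℝ, Euc m × ℝ) ∞ (fun z ↦ α (ι z)) z :=
    h2a.contMDiffAt.comp z (hιs z h1)
  refine ⟨?_, ?_, ?_, ?_, ?_, ?_⟩
  · exact ((hsymm _ h4).contMDiffAt (hopen.mem_nhds h4)).comp z
      ((contDiff_fst.contDiffAt.contMDiffAt (n := ∞)).comp z hαι)
  · exact (contDiff_snd.contDiffAt.contMDiffAt (n := ∞)).comp z hαι
  · change χ.symm (α ((χ z.1, 0), 0)).1 = z.1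
    have : α ((χ z.1, 0), 0) = (χ z.1, 0) := h2b
    rw [this]; exact χ.left_inv h1
  · change (α ((χ z.1, 0), 0)).2 = 0
    have : α ((χ z.1, 0), 0) = (χ z.1, 0) := h2b
    rw [this]
  · have h5 : HasDerivAt (fun s ↦ (α ((χ z.1, 0), s)).1) (v (α (ι z))).1 z.2 :=
      h2c.fst
    rw [h3] at h5
    refine hasMFDerivAt_extChartAt_symm_comp h4 ?_
    exact (haX _ h4) ▸ h5
  · have h5 : HasDerivAt (fun s ↦ (α ((χ z.1, 0), s)).2) (v (α (ι z))).2 z.2 :=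
      h2c.snd
    rw [h3] at h5
    exact h5

end FlowBox

/-! ### Integral curves: uniqueness, gluing, crossings of a level set -/

section Curves

variable {m : ℕ} {N : Type*} [TopologicalSpace N] [ChartedSpace (Euc m) N] [IsManifold (𝓡 m) ∞ N]

/-- `γ` is an integral curve of `X` on the open interval from `c` to `d`. -/
def IsFlowLine (X : VField m N) (γ : ℝ → N) (c d : ℝ) : Prop :=
  ∀ t ∈ Ioo c d, HasMFDerivAt 𝓘(ℝ, ℝ) (𝓡 m) γ t ((1 : ℝ →L[ℝ] ℝ).smulRight (X (γ t)))

variable {X : VField m N} {γ γ₁ γ₂ : ℝ → N} {c d c₁ d₁ c₂ d₂ : ℝ}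

lemma IsFlowLine.isMIntegralCurveOn (h : IsFlowLine X γ c d) : IsMIntegralCurveOn γ X (Ioo c d) :=
  fun t ht ↦ (h t ht).hasMFDerivWithinAt

lemma IsFlowLine.mono (h : IsFlowLine X γ c d) (hc : c ≤ c₁) (hd : d₁ ≤ d) :
    IsFlowLine X γ c₁ d₁ :=
  fun t ht ↦ h t ⟨hc.trans_lt ht.1, ht.2.trans_le hd⟩

lemma IsFlowLine.comp_add (h : IsFlowLine X γ c d) (r : ℝ) :
    IsFlowLine X (fun t ↦ γ (t + r)) (c - r) (d - r) := by
  intro t ht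
  have h1 := h.isMIntegralCurveOn.comp_add r t (by
    constructor
    · linarith [ht.1]
    · linarith [ht.2])
  refine h1.hasMFDerivAt ?_
  refine Filter.mem_of_superset (Ioo_mem_nhds ht.1 ht.2) fun t ht ↦ ⟨?_, ?_⟩
  · linarith [ht.1]
  · linarith [ht.2]

lemma SmoothVField.contMDiff_one (hX : SmoothVField X) :
    ContMDiff (𝓡 m) (𝓡 m).tangent 1 (fun x ↦ (⟨x, X x⟩ : TangentBundle (𝓡 m) N)) :=
  ContMDiff.of_le hX (by norm_num)

lemma IsFlowLine.eqOn [T2Space N] (hX : SmoothVField X) (h₁ : IsFlowLine X γ₁ c₁ d₁)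
    (h₂ : IsFlowLine X γ₂ c₂ d₂) {t₀ : ℝ} (ht₁ : t₀ ∈ Ioo c₁ d₁) (ht₂ : t₀ ∈ Ioo c₂ d₂)
    (h : γ₁ t₀ = γ₂ t₀) : EqOn γ₁ γ₂ (Ioo c₁ d₁ ∩ Ioo c₂ d₂) := by
  rw [Ioo_inter_Ioo]
  refine isMIntegralCurveOn_Ioo_eqOn_of_contMDiff_boundaryless (t₀ := t₀) ?_ hX.contMDiff_one
    (h₁.mono le_sup_left inf_le_left).isMIntegralCurveOn
    (h₂.mono le_sup_right inf_le_right).isMIntegralCurveOn h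
  rw [← Ioo_inter_Ioo]; exact ⟨ht₁, ht₂⟩

/-- Two integral curves which agree at a point are parts of a common integral curve. -/
lemma IsFlowLine.exists_union [T2Space N] (hX : SmoothVField X) (h₁ : IsFlowLine X γ₁ c₁ d₁)
    (h₂ : IsFlowLine X γ₂ c₂ d₂) {t₀ : ℝ} (ht₁ : t₀ ∈ Ioo c₁ d₁) (ht₂ : t₀ ∈ Ioo c₂ d₂)
    (h : γ₁ t₀ = γ₂ t₀) :
    ∃ γ, IsFlowLine X γ (min c₁ c₂) (max d₁ d₂) ∧ EqOn γ γ₁ (Ioo c₁ d₁) ∧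
      EqOn γ γ₂ (Ioo c₂ d₂) := by
  classical
  set γ : ℝ → N := fun t ↦ if t ∈ Ioo c₁ d₁ then γ₁ t else γ₂ t with hγ
  have e1 : EqOn γ γ₁ (Ioo c₁ d₁) := fun t ht ↦ if_pos ht
  have e2 : EqOn γ γ₂ (Ioo c₂ d₂) := by
    intro t ht
    by_cases h1 : t ∈ Ioo c₁ d₁
    · rw [e1 h1]; exact h₁.eqOn hX h₂ ht₁ ht₂ h ⟨h1, ht⟩
    · exact if_neg h1
  refine ⟨γ, fun t ht ↦ ?_, e1, e2⟩
  have : t ∈ Ioo c₁ d₁ ∨ t ∈ Ioo c₂ d₂ := by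
    have := ht.1; have := ht.2
    simp only [mem_Ioo, min_lt_iff, lt_max_iff] at *
    by_contra! hcon
    rcases le_total t t₀ with h | h <;> grind
  rcases this with h | h
  · rw [e1 h]
    exact (h₁ t h).congr_of_eventuallyEq (e1.eventuallyEq_of_mem (Ioo_mem_nhds h.1 h.2))
  · rw [e2 h]
    exact (h₂ t h).congr_of_eventuallyEq (e2.eventuallyEq_of_mem (Ioo_mem_nhds h.1 h.2))

/-- A smooth vector field has integral curves with any initial value. -/
lemma exists_isFlowLine (hX : SmoothVField X) (x : N) (t₀ : ℝ) :
    ∃ (γ : ℝ → N) (ε : ℝ), 0 < ε ∧ γ t₀ = x ∧ IsFlowLine X γ (t₀ - ε) (t₀ + ε) := by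
  obtain ⟨γ, h, hγ⟩ := exists_isMIntegralCurveAt_of_contMDiffAt_boundaryless (I := 𝓡 m) (v := X) t₀
    (hX.contMDiff_one.contMDiffAt (x := x))
  obtain ⟨ε, hε, hb⟩ := Metric.eventually_nhds_iff_ball.1 hγ
  refine ⟨γ, ε, hε, h, fun t ht ↦ hb t ?_⟩
  rwa [Real.ball_eq_Ioo]

/-- An integral curve on a closed interval extends to an open interval. -/
lemma exists_isFlowLine_of_isMIntegralCurveOn_Icc (hX : SmoothVField X) {a b : ℝ} (hab : a ≤ b)
    (hγ : IsMIntegralCurveOn (I := 𝓡 m) γ X (Icc a b)) :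
    ∃ (γ' : ℝ → N) (ε : ℝ), 0 < ε ∧ EqOn γ' γ (Icc a b) ∧ IsFlowLine X γ' (a - ε) (b + ε) := by
  rcases hab.eq_or_lt with rfl | hlt
  · obtain ⟨σ, ε, hε, h, hσ⟩ := exists_isFlowLine hX (γ a) a
    exact ⟨σ, ε, hε, by simp [h], hσ⟩
  obtain ⟨σ, ε₁, hε₁, h₁, hσ⟩ := exists_isFlowLine hX (γ a) a
  obtain ⟨τ, ε₂, hε₂, h₂, hτ⟩ := exists_isFlowLine hX (γ b) b
  set γ' : ℝ → N := fun t ↦ if t < a then σ t else if t ≤ b then γ t else τ t with hγ'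
  have ea : EqOn γ' σ (Iic a) := by
    intro t ht
    rcases (mem_Iic.1 ht).lt_or_eq with h | rfl
    · simp [hγ', h]
    · simp [hγ', h₁, hab]
  have eb : EqOn γ' τ (Ici b) := by
    intro t ht
    rcases (mem_Ici.1 ht).lt_or_eq with h | rfl
    · simp [hγ', h.not_ge, (hlt.trans h).le.not_gt]
    · simp [hγ', h₂, hab.not_gt]
  have em : EqOn γ' γ (Icc a b) := by
    intro t ht
    simp [hγ', ht.2, ht.1.not_gt]
  refine ⟨γ', min ε₁ ε₂, lt_min hε₁ hε₂, em, fun t ht ↦ ?_⟩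
  have hta : a - ε₁ < t := by linarith [ht.1, min_le_left ε₁ ε₂]
  have htb : t < b + ε₂ := by linarith [ht.2, min_le_right ε₁ ε₂]
  have key : ∀ {η : ℝ → N} {s : Set ℝ}, EqOn γ' η s → t ∈ s →
      HasMFDerivWithinAt 𝓘(ℝ, ℝ) (𝓡 m) η s t ((1 : ℝ →L[ℝ] ℝ).smulRight (X (η t))) →
      HasMFDerivWithinAt 𝓘(ℝ, ℝ) (𝓡 m) γ' s t ((1 : ℝ →L[ℝ] ℝ).smulRight (X (γ' t))) := by
    intro η s h hs hd
    rw [h hs]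
    exact hd.congr_mono h (h hs) subset_rfl
  have hL : t ≤ a → HasMFDerivWithinAt 𝓘(ℝ, ℝ) (𝓡 m) γ' (Iic a) t
      ((1 : ℝ →L[ℝ] ℝ).smulRight (X (γ' t))) := fun h ↦
    key ea h (hσ t ⟨hta, by linarith⟩).hasMFDerivWithinAt
  have hR : b ≤ t → HasMFDerivWithinAt 𝓘(ℝ, ℝ) (𝓡 m) γ' (Ici b) t
      ((1 : ℝ →L[ℝ] ℝ).smulRight (X (γ' t))) := fun h ↦
    key eb h (hτ t ⟨by linarith, htb⟩).hasMFDerivWithinAt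
  have hM : a ≤ t → t ≤ b → HasMFDerivWithinAt 𝓘(ℝ, ℝ) (𝓡 m) γ' (Icc a b) t
      ((1 : ℝ →L[ℝ] ℝ).smulRight (X (γ' t))) := fun h h' ↦
    key em ⟨h, h'⟩ (hγ t ⟨h, h'⟩)
  rcases lt_trichotomy t a with h | rfl | h
  · exact (hL h.le).hasMFDerivAt (Iic_mem_nhds h)
  · refine ((hL le_rfl).union (hM le_rfl hab)).hasMFDerivAt ?_
    rw [Iic_union_Icc_eq_Iic hab]; exact Iic_mem_nhds hlt
  rcases lt_trichotomy t b with h' | rfl | h'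
  · exact (hM h.le h'.le).hasMFDerivAt (Icc_mem_nhds h h')
  · refine ((hM hab le_rfl).union (hR le_rfl)).hasMFDerivAt ?_
    rw [Icc_union_Ici_eq_Ici hab]; exact Ici_mem_nhds hlt
  · exact (hR h'.le).hasMFDerivAt (Ici_mem_nhds h')

lemma hasDerivAt_comp_of_hasMFDerivAt {h : N → ℝ} {t : ℝ} {V : TangentSpace (𝓡 m) (γ t)}
    (hh : MDifferentiableAt (𝓡 m) 𝓘(ℝ, ℝ) h (γ t))
    (hγ : HasMFDerivAt 𝓘(ℝ, ℝ) (𝓡 m) γ t ((1 : ℝ →L[ℝ] ℝ).smulRight V)) :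
    HasDerivAt (fun r ↦ h (γ r)) (dirDeriv h (γ t) V) t := by
  rw [hasDerivAt_iff_hasFDerivAt]
  have h1 : HasFDerivAt (fun r ↦ h (γ r)) _ t := (hh.hasMFDerivAt.comp t hγ).hasFDerivAt
  refine h1.congr_fderiv (ContinuousLinearMap.ext_ring ?_)
  change (mfderiv (𝓡 m) 𝓘(ℝ, ℝ) h (γ t)) ((1 : ℝ) • V) =
    (1 : ℝ) • (mfderiv (𝓡 m) 𝓘(ℝ, ℝ) h (γ t)) V
  rw [one_smul, one_smul]

lemma IsFlowLine.continuousOn (h : IsFlowLine X γ c d) : ContinuousOn γ (Ioo c d) :=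
  fun t ht ↦ (h t ht).continuousAt.continuousWithinAt

lemma IsFlowLine.hasDerivAt (h : IsFlowLine X γ c d) {k : N → ℝ}
    (hk : ContMDiff (𝓡 m) 𝓘(ℝ, ℝ) ∞ k) {t : ℝ} (ht : t ∈ Ioo c d) :
    HasDerivAt (fun r ↦ k (γ r)) (dirDeriv k (γ t) (X (γ t))) t :=
  hasDerivAt_comp_of_hasMFDerivAt (hk.mdifferentiable (by simp) _) (h t ht)

/-- A function increasing at each of its zeros stays nonnegative to the right of `a`. A zero at `b >
a` would, by its positive derivative, force negative values just to the left of `b`. -/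
lemma not_lt_of_deriv_pos_of_eq_zero {k k' : ℝ → ℝ} {a b : ℝ}
    (hk : ∀ t ∈ Icc a b, HasDerivAt k (k' t) t) (hpos : ∀ t ∈ Icc a b, k t = 0 → 0 < k' t)
    (ha : k a = 0) (hb : k b = 0) : ¬ a < b := by
  intro hab
  have h1 := image_le_of_deriv_right_lt_deriv_boundary' (f := fun t ↦ - k t) (f' := fun t ↦ - k' t)
    (B := fun _ ↦ 0) (B' := fun _ ↦ 0) (a := a) (b := b)
    (fun t ht ↦ (hk t ht).continuousAt.continuousWithinAt.neg)
    (fun t ht ↦ (hk t ⟨ht.1, ht.2.le⟩).neg.hasDerivWithinAt) (by simp [ha]) continuousOn_const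
    (fun t _ ↦ hasDerivWithinAt_const ..) (fun t ht h ↦ by
      have := hpos t ⟨ht.1, ht.2.le⟩ (by simpa using h)
      simpa using this)
  have hbm : b ∈ Icc a b := ⟨hab.le, le_rfl⟩
  have h2 := eventually_nhdsWithin_sign_eq_of_deriv_pos (f := k) (x₀ := b)
    (by rw [(hk b hbm).deriv]; exact hpos b hbm hb) hb
  obtain ⟨t, h3, h4⟩ := ((h2.filter_mono nhdsWithin_le_nhds).and
    (Ioo_mem_nhdsLT hab)).exists
  have h5 := h1 ⟨h4.1.le, h4.2.le⟩
  have h6 : k t < 0 := by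
    rw [sign_neg (sub_neg.2 h4.2)] at h3
    exact sign_eq_neg_one_iff.1 h3
  linarith

/-- A function which increases along `X` at its zeros has at most one zero on an integral curve. -/
lemma IsFlowLine.eq_of_zero (h : IsFlowLine X γ c d) {s : N → ℝ}
    (hs : ContMDiff (𝓡 m) 𝓘(ℝ, ℝ) ∞ s) (hpos : ∀ x, s x = 0 → 0 < dirDeriv s x (X x))
    {a b : ℝ} (ha : a ∈ Ioo c d) (hb : b ∈ Ioo c d) (hsa : s (γ a) = 0) (hsb : s (γ b) = 0) :
    a = b := by
  have key : ∀ {a b : ℝ}, a ∈ Ioo c d → b ∈ Ioo c d → s (γ a) = 0 → s (γ b) = 0 → ¬ a < b := by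
    intro a b ha hb hsa hsb
    exact not_lt_of_deriv_pos_of_eq_zero (k := fun t ↦ s (γ t))
      (fun t ht ↦ h.hasDerivAt hs ⟨ha.1.trans_le ht.1, ht.2.trans_lt hb.2⟩)
      (fun t _ h0 ↦ hpos _ h0) hsa hsb
  exact le_antisymm (not_lt.1 (key hb ha hsb hsa)) (not_lt.1 (key ha hb hsa hsb))

end Curves

/-! ### Flow boxes and hitting times -/

section FlowEquation

variable {m : ℕ} {N : Type*} [TopologicalSpace N] [ChartedSpace (Euc m) N] [IsManifold (𝓡 m) ∞ N]

/-- `Φ` is the flow of `X` on `U × (-ε, ε)`, and `J` the integral of `F` along it. -/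
structure IsFlowBox (X : VField m N) (F : N → ℝ) (Φ : N × ℝ → N) (J : N × ℝ → ℝ) (U : Set N)
    (ε : ℝ) : Prop where
  isOpen : IsOpen U
  pos : 0 < ε
  contMDiffAt_flow : ∀ y ∈ U, ∀ t ∈ Ioo (-ε) ε,
    ContMDiffAt ((𝓡 m).prod 𝓘(ℝ, ℝ)) (𝓡 m) ∞ Φ (y, t)
  contMDiffAt_int : ∀ y ∈ U, ∀ t ∈ Ioo (-ε) ε,
    ContMDiffAt ((𝓡 m).prod 𝓘(ℝ, ℝ)) 𝓘(ℝ, ℝ) ∞ J (y, t)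
  flow_zero : ∀ y ∈ U, Φ (y, 0) = y
  int_zero : ∀ y ∈ U, J (y, 0) = 0
  isFlowLine : ∀ y ∈ U, IsFlowLine X (fun t ↦ Φ (y, t)) (-ε) ε
  hasDerivAt_int : ∀ y ∈ U, ∀ t ∈ Ioo (-ε) ε, HasDerivAt (fun r ↦ J (y, r)) (F (Φ (y, t))) t

variable {X : VField m N} {F : N → ℝ}

lemma exists_isFlowBox (hX : SmoothVField X) (hF : ContMDiff (𝓡 m) 𝓘(ℝ, ℝ) ∞ F) (p : N) :
    ∃ Φ J U ε, p ∈ U ∧ IsFlowBox X F Φ J U ε := by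
  obtain ⟨Φ, J, h⟩ := exists_flowBox hX hF p
  rw [nhds_prod_eq] at h
  obtain ⟨P, hP, Q, hQ, hPQ⟩ := Filter.eventually_prod_iff.1 h
  obtain ⟨U, hU, hUo, hpU⟩ := eventually_nhds_iff.1 hP
  obtain ⟨ε, hε, hb⟩ := Metric.eventually_nhds_iff_ball.1 hQ
  rw [Real.ball_eq_Ioo, zero_sub, zero_add] at hb
  have key := fun y (hy : y ∈ U) t (ht : t ∈ Ioo (-ε) ε) ↦ hPQ (hU y hy) (hb t ht)
  have h0 : (0 : ℝ) ∈ Ioo (-ε) ε := by simpa using hε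
  exact ⟨Φ, J, U, ε, hpU, hUo, hε, fun y hy t ht ↦ (key y hy t ht).1,
    fun y hy t ht ↦ (key y hy t ht).2.1, fun y hy ↦ (key y hy 0 h0).2.2.1,
    fun y hy ↦ (key y hy 0 h0).2.2.2.1, fun y hy t ht ↦ (key y hy t ht).2.2.2.2.1,
    fun y hy t ht ↦ (key y hy t ht).2.2.2.2.2⟩

namespace IsFlowBox

variable {Φ : N × ℝ → N} {J : N × ℝ → ℝ} {U : Set N} {ε : ℝ} (hB : IsFlowBox X F Φ J U ε)
include hB

lemma zero_mem : (0 : ℝ) ∈ Ioo (-ε) ε := by simpa using hB.pos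

lemma uIcc_subset {t : ℝ} (ht : t ∈ Ioo (-ε) ε) : uIcc 0 t ⊆ Ioo (-ε) ε :=
  ordConnected_Ioo.uIcc_subset hB.zero_mem ht

lemma int_eq (hF : Continuous F) {y : N} (hy : y ∈ U) {t : ℝ} (ht : t ∈ Ioo (-ε) ε) :
    J (y, t) = ∫ r in (0 : ℝ)..t, F (Φ (y, r)) := by
  rw [intervalIntegral.integral_eq_sub_of_hasDerivAt (f := fun r ↦ J (y, r))
    (fun r hr ↦ hB.hasDerivAt_int y hy r (hB.uIcc_subset ht hr)), hB.int_zero y hy, sub_zero]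
  refine ContinuousOn.intervalIntegrable ?_
  exact hF.comp_continuousOn ((hB.isFlowLine y hy).continuousOn.mono (hB.uIcc_subset ht))

variable [T2Space N]

lemma flow_eq (hX : SmoothVField X) {γ : ℝ → N} {c d : ℝ}
    (hγ : IsFlowLine X γ c d) (h0 : (0 : ℝ) ∈ Ioo c d) (hy : γ 0 ∈ U) :
    EqOn γ (fun t ↦ Φ (γ 0, t)) (Ioo c d ∩ Ioo (-ε) ε) :=
  hγ.eqOn hX (hB.isFlowLine _ hy) h0 hB.zero_mem (hB.flow_zero _ hy).symm

lemma flow_add (hX : SmoothVField X) {y : N} (hy : y ∈ U) {t r : ℝ} (ht : t ∈ Ioo (-ε) ε)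
    (hyt : Φ (y, t) ∈ U) (hr : r ∈ Ioo (-ε) ε) (htr : r + t ∈ Ioo (-ε) ε) :
    Φ (Φ (y, t), r) = Φ (y, r + t) := by
  have h := hB.flow_eq hX ((hB.isFlowLine y hy).comp_add t) ⟨by linarith [ht.1], by linarith [ht.2]⟩
    (by simpa using hyt) ⟨⟨by linarith [htr.1], by linarith [htr.2]⟩, hr⟩
  simpa using h.symm

lemma int_add (hX : SmoothVField X) (hF : Continuous F) {y : N} (hy : y ∈ U) {t r : ℝ}
    (ht : t ∈ Ioo (-ε) ε) (hyt : Φ (y, t) ∈ U) (hr : r ∈ Ioo (-ε) ε) (htr : r + t ∈ Ioo (-ε) ε) :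
    J (Φ (y, t), r) = J (y, r + t) - J (y, t) := by
  rw [hB.int_eq hF hyt hr, hB.int_eq hF hy ht, hB.int_eq hF hy htr]
  have h1 : ∫ ρ in (0 : ℝ)..r, F (Φ (Φ (y, t), ρ)) = ∫ ρ in (0 : ℝ)..r, F (Φ (y, ρ + t)) := by
    refine intervalIntegral.integral_congr fun ρ hρ ↦ ?_
    have h2 := hB.uIcc_subset hr hρ
    change F (Φ (Φ (y, t), ρ)) = F (Φ (y, ρ + t))
    rw [hB.flow_add hX hy ht hyt h2]
    have h3 : ρ + t ∈ uIcc (0 + t) (r + t) := by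
      rw [← image_add_const_uIcc]; exact ⟨ρ, hρ, rfl⟩
    rw [zero_add] at h3
    exact ordConnected_Ioo.uIcc_subset ht htr h3
  have hi : ∀ {t}, t ∈ Ioo (-ε) ε →
      IntervalIntegrable (fun ρ ↦ F (Φ (y, ρ))) MeasureTheory.volume 0 t := fun ht ↦
    (hF.comp_continuousOn
      ((hB.isFlowLine y hy).continuousOn.mono (hB.uIcc_subset ht))).intervalIntegrable
  rw [h1, intervalIntegral.integral_comp_add_right (fun ρ ↦ F (Φ (y, ρ))), zero_add,
    ← intervalIntegral.integral_interval_sub_left (hi htr) (hi ht)]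

/-- The time `τ` at which the flow reaches a transversal hypersurface `s = 0` is smooth. -/
lemma exists_hittingTime {p : N} (hp : p ∈ U) {s : N → ℝ}
    (hs : ∀ᶠ y in 𝓝 p, ContMDiffAt (𝓡 m) 𝓘(ℝ, ℝ) ∞ s y) (hsp : s p = 0)
    (hd : dirDeriv s p (X p) ≠ 0) :
    ∃ τ : N → ℝ, τ p = 0 ∧
      (∀ᶠ y in 𝓝 p, ContMDiffAt (𝓡 m) 𝓘(ℝ, ℝ) ∞ τ y ∧ s (Φ (y, τ y)) = 0) ∧
      ∀ᶠ z in 𝓝 (p, (0 : ℝ)), s (Φ z) = 0 → τ z.1 = z.2 := by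
  set χ := extChartAt (𝓡 m) p with hχ
  have hsymm : ContMDiffOn 𝓘(ℝ, Euc m) (𝓡 m) ∞ χ.symm χ.target := contMDiffOn_extChartAt_symm p
  have hmt : χ p ∈ χ.target := mem_extChartAt_target p
  have hopen : IsOpen χ.target := isOpen_extChartAt_target p
  set κ : Euc m × ℝ → N × ℝ := fun z ↦ (χ.symm z.1, z.2) with hκ
  have hκp : κ (χ p, 0) = (p, 0) := by
    simp only [hκ, hχ, extChartAt_to_inv]
  have hκs : ∀ z : Euc m × ℝ, z.1 ∈ χ.target →
      ContMDiffAt 𝓘(ℝ, Euc m × ℝ) ((𝓡 m).prod 𝓘(ℝ, ℝ)) ∞ κ z := by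
    intro z hz
    exact (((hsymm _ hz).contMDiffAt (hopen.mem_nhds hz)).comp z
      (contDiffAt_fst.contMDiffAt (n := ∞))).prodMk (contDiffAt_snd.contMDiffAt (n := ∞))
  have hκc : ContinuousAt κ (χ p, 0) := (hκs _ hmt).continuousAt
  have hΦc : ContinuousAt Φ (p, 0) := (hB.contMDiffAt_flow p hp 0 hB.zero_mem).continuousAt
  have hΦp : Φ (p, 0) = p := hB.flow_zero p hp
  have hev : ∀ᶠ z in 𝓝 (p, (0 : ℝ)), ContMDiffAt ((𝓡 m).prod 𝓘(ℝ, ℝ)) 𝓘(ℝ, ℝ) ∞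
      (fun z ↦ s (Φ z)) z := by
    have h1 : ∀ᶠ z in 𝓝 (p, (0 : ℝ)), z.1 ∈ U ∧ z.2 ∈ Ioo (-ε) ε :=
      (continuousAt_fst.eventually (hB.isOpen.mem_nhds hp)).and
        (continuousAt_snd.eventually (Ioo_mem_nhds hB.zero_mem.1 hB.zero_mem.2))
    have h2 : ∀ᶠ z in 𝓝 (p, (0 : ℝ)), ContMDiffAt (𝓡 m) 𝓘(ℝ, ℝ) ∞ s (Φ z) :=
      hΦc.eventually (by rwa [hΦp])
    filter_upwards [h1, h2] with z h1 h2
    exact h2.comp z (hB.contMDiffAt_flow z.1 h1.1 z.2 h1.2)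
  have hG : ∀ᶠ z in 𝓝 (χ p, (0 : ℝ)), ContDiffAt ℝ ∞ (fun z ↦ s (Φ (κ z))) z := by
    have h1 : ∀ᶠ z in 𝓝 (χ p, (0 : ℝ)), z.1 ∈ χ.target :=
      continuousAt_fst.eventually (hopen.mem_nhds hmt)
    have h2 := hκc.eventually (by rw [hκp]; exact hev)
    filter_upwards [h1, h2] with z h1 h2
    exact (ContMDiffAt.comp z h2 (hκs z h1)).contDiffAt
  -- The time derivative of `s (Φ (p, t))` at `0` is `X s`, nonzero by transversality, so the
  -- equation `s (Φ (y, τ)) = 0` can be solved for `τ`.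
  have hder : (fderiv ℝ (fun z ↦ s (Φ (κ z))) (χ p, 0) ∘L .inr ℝ (Euc m) ℝ) 1 =
      dirDeriv s p (X p) := by
    have h1 := ((hG.self_of_nhds.differentiableAt (by simp)).hasFDerivAt.comp (0 : ℝ)
      (hasFDerivAt_prodMk_right (𝕜 := ℝ) (χ p) (0 : ℝ))).hasDerivAt
    have h2 := hasDerivAt_comp_of_hasMFDerivAt (h := s) (γ := fun t ↦ Φ (p, t)) (t := 0)
      (V := X (Φ (p, 0))) (by
        simp only [hΦp]
        exact hs.self_of_nhds.mdifferentiableAt (by simp)) (hB.isFlowLine p hp 0 hB.zero_mem)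
    have h3 := h1.unique (by
      convert! h2 using 1
      ext t
      simp [hκ, hχ])
    rw [h3, hΦp]
  obtain ⟨ψ, hψ0, hψ1, hψ2⟩ := exists_smooth_implicitFunction hG (by
    refine ContinuousLinearMap.IsInvertible.of_inverse
      (g := (dirDeriv s p (X p))⁻¹ • ContinuousLinearMap.id ℝ ℝ) ?_ ?_
    · ext
      simp only [ContinuousLinearMap.comp_smul, ContinuousLinearMap.comp_id,
        _root_.smul_apply, hder]
      simp [hd]
    · ext
      simp only [ContinuousLinearMap.smul_comp, ContinuousLinearMap.id_comp,
        _root_.smul_apply, hder]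
      simp [hd])
  have hG0 : s (Φ (κ (χ p, 0))) = 0 := by rw [hκp, hΦp, hsp]
  have hχc : ContinuousAt χ p := continuousAt_extChartAt p
  have hsrc : ∀ᶠ y in 𝓝 p, y ∈ χ.source := extChartAt_source_mem_nhds p
  refine ⟨fun y ↦ ψ (χ y), hψ0, ?_, ?_⟩
  · filter_upwards [hχc.eventually hψ1, hsrc] with y h1 h2
    refine ⟨h1.1.contMDiffAt.comp y (contMDiffAt_extChartAt' ?_), ?_⟩
    · rwa [hχ, extChartAt_source] at h2
    · have h3 := h1.2
      rw [hG0] at h3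
      simpa [hκ, χ.left_inv h2] using h3
  · have hc : ContinuousAt (fun z : N × ℝ ↦ (χ z.1, z.2)) (p, 0) :=
      (hχc.comp (x := (p, (0 : ℝ))) continuousAt_fst).prodMk continuousAt_snd
    filter_upwards [hc.eventually hψ2, continuousAt_fst.eventually hsrc] with z h1 h2 h3
    refine h1 ?_
    simp only [hκ, χ.left_inv h2]
    rw [h3]
    exact hG0.symm

end IsFlowBox

end FlowEquation

lemma _root_.ContinuousAt.eventually_of_eq {A B : Type*} [TopologicalSpace A] [TopologicalSpace B]
    {f : A → B} {a : A} {b : B} (hf : ContinuousAt f a) (hb : f a = b) {P : B → Prop}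
    (h : ∀ᶠ y in 𝓝 b, P y) : ∀ᶠ x in 𝓝 a, P (f x) :=
  hf.eventually (hb ▸ h)

/-! ### Solving `X h = F` locally and globally -/

section FlowEquationSolutions

variable {m : ℕ} {N : Type*} [TopologicalSpace N] [ChartedSpace (Euc m) N] [IsManifold (𝓡 m) ∞ N]
  [T2Space N] {X : VField m N} {F : N → ℝ}

/-- If `h` satisfies `h (Φ (y, t)) = h y + J (y, t)` near `t = 0`, then `X h = F` at `y`. -/
lemma IsFlowBox.dirDeriv_eq {Φ : N × ℝ → N} {J : N × ℝ → ℝ} {U : Set N} {ε : ℝ}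
    (hB : IsFlowBox X F Φ J U ε) {y : N} (hy : y ∈ U) {h : N → ℝ}
    (hh : MDifferentiableAt (𝓡 m) 𝓘(ℝ, ℝ) h y)
    (hJ : ∀ᶠ t in 𝓝 (0 : ℝ), h (Φ (y, t)) = h y + J (y, t)) : dirDeriv h y (X y) = F y := by
  have h0 := hB.flow_zero y hy
  have h1 := hasDerivAt_comp_of_hasMFDerivAt (h := h) (γ := fun t ↦ Φ (y, t)) (t := 0)
      (V := X (Φ (y, 0))) (by simpa only [h0] using hh) (hB.isFlowLine y hy 0 hB.zero_mem)
  have h2 : HasDerivAt (fun t ↦ h (Φ (y, t))) (F (Φ (y, 0))) 0 :=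
    ((hB.hasDerivAt_int y hy 0 hB.zero_mem).const_add (h y)).congr_of_eventuallyEq hJ
  have h3 := h1.unique h2
  rwa [h0] at h3

/-- Near a point where `X ≠ 0` one can solve `X h = F`. -/
theorem exists_local_solution (hX : SmoothVField X) (hF : ContMDiff (𝓡 m) 𝓘(ℝ, ℝ) ∞ F) {p : N}
    {s : N → ℝ} (hs : ∀ᶠ y in 𝓝 p, ContMDiffAt (𝓡 m) 𝓘(ℝ, ℝ) ∞ s y) (hsp : s p = 0)
    (hd : dirDeriv s p (X p) ≠ 0) :
    ∃ h : N → ℝ, ∀ᶠ y in 𝓝 p, ContMDiffAt (𝓡 m) 𝓘(ℝ, ℝ) ∞ h y ∧ dirDeriv h y (X y) = F y := by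
  obtain ⟨Φ, J, U, ε, hpU, hB⟩ := exists_isFlowBox hX hF p
  obtain ⟨τ, hτp, hτ, hτ'⟩ := hB.exists_hittingTime hpU hs hsp hd
  have hFc := hF.continuous
  have hτc : ContinuousAt τ p := hτ.self_of_nhds.1.continuousAt
  have e1 : ∀ᶠ y in 𝓝 p, y ∈ U := hB.isOpen.mem_nhds hpU
  have e2 : ∀ᶠ y in 𝓝 p, τ y ∈ Ioo (-ε) ε :=
    hτc.eventually (by rw [hτp]; exact Ioo_mem_nhds hB.zero_mem.1 hB.zero_mem.2)
  have e3 : ∀ᶠ y in 𝓝 p, ∀ᶠ z in 𝓝 (y, τ y), s (Φ z) = 0 → τ z.1 = z.2 := by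
    have : ContinuousAt (fun y ↦ (y, τ y)) p := continuousAt_id.prodMk hτc
    exact this.eventually_of_eq (by rw [hτp]) hτ'.eventually_nhds
  -- The solution vanishing on `s = 0`: minus the integral of `F` along the flow from `y` to the
  -- transversal.
  refine ⟨fun y ↦ - J (y, τ y), ?_⟩
  filter_upwards [e1, e2, e3, hτ] with y h1 h2 h3 h4
  have hsm : ContMDiffAt (𝓡 m) 𝓘(ℝ, ℝ) ∞ (fun y ↦ - J (y, τ y)) y := by
    have h5 : ContMDiffAt (𝓡 m) 𝓘(ℝ, ℝ) ∞ (fun y ↦ J (y, τ y)) y :=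
      (hB.contMDiffAt_int y h1 (τ y) h2).comp y (contMDiffAt_id.prodMk h4.1)
    exact h5.neg
  refine ⟨hsm, hB.dirDeriv_eq h1 (hsm.mdifferentiableAt (by simp)) ?_⟩
  have hΦy : ContinuousAt (fun t ↦ Φ (y, t)) 0 :=
    (hB.isFlowLine y h1 0 hB.zero_mem).continuousAt
  have hΦ0 := hB.flow_zero y h1
  have f1 : ∀ᶠ t in 𝓝 (0 : ℝ), t ∈ Ioo (-ε) ε := Ioo_mem_nhds hB.zero_mem.1 hB.zero_mem.2
  have f2 : ∀ᶠ t in 𝓝 (0 : ℝ), Φ (y, t) ∈ U :=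
    hΦy.eventually_of_eq hΦ0 (hB.isOpen.mem_nhds h1)
  have hc : ContinuousAt (fun t : ℝ ↦ τ y - t) 0 := by fun_prop
  have f3 : ∀ᶠ t in 𝓝 (0 : ℝ), τ y - t ∈ Ioo (-ε) ε :=
    hc.eventually_of_eq (sub_zero _) (Ioo_mem_nhds h2.1 h2.2)
  -- Flowing for time `t` shortens the hitting time by `t`, by uniqueness of the hitting time near
  -- `(y, τ y)`.
  have f4 : ∀ᶠ t in 𝓝 (0 : ℝ), s (Φ (Φ (y, t), τ y - t)) = 0 → τ (Φ (y, t)) = τ y - t :=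
    (hΦy.prodMk hc).eventually_of_eq (by rw [hΦ0, sub_zero]) h3
  filter_upwards [f1, f2, f3, f4] with t g1 g2 g3 g4
  have g5 : τ y - t + t = τ y := sub_add_cancel _ _
  have g6 := hB.flow_add hX h1 g1 g2 g3 (by rwa [g5])
  have g7 := hB.int_add hX hFc h1 g1 g2 g3 (by rwa [g5])
  rw [g5] at g6 g7
  rw [g4 (by rw [g6]; exact h4.2), g7]
  ring

/-- An integral curve from `x` to the hypersurface `s = 0`. -/
structure JoinsZero (X : VField m N) (s : N → ℝ) (x : N) (γ : ℝ → N) (c d b : ℝ) : Prop where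
  isFlowLine : IsFlowLine X γ c d
  zero_mem : (0 : ℝ) ∈ Ioo c d
  mem : b ∈ Ioo c d
  eq_left : γ 0 = x
  eq_zero : s (γ b) = 0

/-- Shifts time so that the curve starts at `0`, and enlarges the closed interval to an open one so
that uniqueness of integral curves applies. -/
lemma exists_joinsZero (hX : SmoothVField X) {s : N → ℝ} {x : N} {γ : ℝ → N} {a b : ℝ}
    (ha : γ a = x) (hb : s (γ b) = 0) (hγ : IsMIntegralCurveOn (I := 𝓡 m) γ X (uIcc a b)) :
    ∃ γ' c d b', JoinsZero X s x γ' c d b' := by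
  obtain ⟨γ', ε, hε, he, hγ'⟩ := exists_isFlowLine_of_isMIntegralCurveOn_Icc hX
    (a := min a b) (b := max a b) min_le_max hγ
  have hmin := min_le_left a b
  have hmin' := min_le_right a b
  have hmax := le_max_left a b
  have hmax' := le_max_right a b
  refine ⟨fun t ↦ γ' (t + a), _, _, b - a, hγ'.comp_add a, ⟨by linarith, by linarith⟩,
    ⟨by linarith, by linarith⟩, ?_, ?_⟩
  · simp only [zero_add]
    rw [he ⟨hmin, hmax⟩, ha]
  · simp only [sub_add_cancel]
    rw [he ⟨hmin', hmax'⟩, hb]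

lemma JoinsZero.shift {s : N → ℝ} {x : N} {γ : ℝ → N} {c d b : ℝ}
    (h : JoinsZero X s x γ c d b) {t : ℝ} (ht : t ∈ Ioo c d) :
    JoinsZero X s (γ t) (fun r ↦ γ (r + t)) (c - t) (d - t) (b - t) where
  isFlowLine := h.isFlowLine.comp_add t
  zero_mem := ⟨by linarith [ht.1], by linarith [ht.2]⟩
  mem := ⟨by linarith [h.mem.1], by linarith [h.mem.2]⟩
  eq_left := by simp
  eq_zero := by simpa using h.eq_zero

/-- Both curves are parts of one integral curve, on which `s` has only one zero; hence the crossing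
times agree. This makes the global solution independent of the chosen curves. -/
lemma JoinsZero.integral_eq (hX : SmoothVField X) {s : N → ℝ}
    (hs : ContMDiff (𝓡 m) 𝓘(ℝ, ℝ) ∞ s) (hpos : ∀ x, s x = 0 → 0 < dirDeriv s x (X x))
    {x : N} {γ₁ γ₂ : ℝ → N} {c₁ d₁ b₁ c₂ d₂ b₂ : ℝ}
    (h₁ : JoinsZero X s x γ₁ c₁ d₁ b₁) (h₂ : JoinsZero X s x γ₂ c₂ d₂ b₂) :
    ∫ t in (0 : ℝ)..b₁, F (γ₁ t) = ∫ t in (0 : ℝ)..b₂, F (γ₂ t) := by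
  obtain ⟨γ, hγ, e1, e2⟩ := h₁.isFlowLine.exists_union hX h₂.isFlowLine h₁.zero_mem h₂.zero_mem
    (h₁.eq_left.trans h₂.eq_left.symm)
  have hb : b₁ = b₂ := by
    refine hγ.eq_of_zero hs hpos ?_ ?_ (by rw [e1 h₁.mem, h₁.eq_zero])
      (by rw [e2 h₂.mem, h₂.eq_zero])
    · exact ⟨(min_le_left _ _).trans_lt h₁.mem.1, h₁.mem.2.trans_le (le_max_left _ _)⟩
    · exact ⟨(min_le_right _ _).trans_lt h₂.mem.1, h₂.mem.2.trans_le (le_max_right _ _)⟩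
  subst hb
  refine intervalIntegral.integral_congr fun t ht ↦ ?_
  have g1 := e1 (ordConnected_Ioo.uIcc_subset h₁.zero_mem h₁.mem ht)
  have g2 := e2 (ordConnected_Ioo.uIcc_subset h₂.zero_mem h₂.mem ht)
  simp only [← g1, g2]

/-- If every integral curve of `X` crosses the hypersurface `s = 0` transversally, one can solve
`X h = F` globally. -/
theorem exists_global_solution (hX : SmoothVField X) (hF : ContMDiff (𝓡 m) 𝓘(ℝ, ℝ) ∞ F)
    {s : N → ℝ} (hs : ContMDiff (𝓡 m) 𝓘(ℝ, ℝ) ∞ s)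
    (hpos : ∀ x, s x = 0 → 0 < dirDeriv s x (X x))
    (hjoin : ∀ x, ∃ γ c d b, JoinsZero X s x γ c d b) :
    ∃ h : N → ℝ, ContMDiff (𝓡 m) 𝓘(ℝ, ℝ) ∞ h ∧ ∀ x, dirDeriv h x (X x) = F x := by
  choose γ c d b hD using hjoin
  -- As in the local case, `F` is integrated from `x` to the section, now along an arbitrarily
  -- chosen curve. Smoothness in `x` is therefore not yet visible.
  set h : N → ℝ := fun x ↦ - ∫ t in (0 : ℝ)..b x, F (γ x t) with hh
  have hFc := hF.continuous
  have key : ∀ {x γ' c' d' b'}, JoinsZero X s x γ' c' d' b' →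
      h x = - ∫ t in (0 : ℝ)..b', F (γ' t) := fun {x _ _ _ _} hD' ↦ by
    rw [hh]; exact congrArg Neg.neg ((hD x).integral_eq hX hs hpos hD')
  have hint : ∀ {γ' : ℝ → N} {c' d' t₁ t₂ : ℝ}, IsFlowLine X γ' c' d' → t₁ ∈ Ioo c' d' →
      t₂ ∈ Ioo c' d' → IntervalIntegrable (fun t ↦ F (γ' t)) MeasureTheory.volume t₁ t₂ :=
    fun hγ h1 h2 ↦ (hFc.comp_continuousOn
      (hγ.continuousOn.mono (ordConnected_Ioo.uIcc_subset h1 h2))).intervalIntegrable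
  -- The curve chosen at `y`, glued with the flow line and restarted at time `t`, serves as a curve
  -- for `Φ (y, t)`. The two integrals then differ by the piece from `0` to `t`.
  have hflow : ∀ {Φ J U ε}, IsFlowBox X F Φ J U ε → ∀ y ∈ U, ∀ t ∈ Ioo (-ε) ε,
      h (Φ (y, t)) = h y + J (y, t) := by
    intro Φ J U ε hB y hy t ht
    obtain ⟨η, hη, e1, e2⟩ := (hD y).isFlowLine.exists_union hX (hB.isFlowLine y hy)
      (hD y).zero_mem hB.zero_mem ((hD y).eq_left.trans (hB.flow_zero y hy).symm)
    have hsub1 : Ioo (c y) (d y) ⊆ Ioo (min (c y) (-ε)) (max (d y) ε) :=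
      Ioo_subset_Ioo (min_le_left _ _) (le_max_left _ _)
    have hsub2 : Ioo (-ε) ε ⊆ Ioo (min (c y) (-ε)) (max (d y) ε) :=
      Ioo_subset_Ioo (min_le_right _ _) (le_max_right _ _)
    have hE : JoinsZero X s y η _ _ (b y) := ⟨hη, hsub1 (hD y).zero_mem, hsub1 (hD y).mem,
      by rw [e1 (hD y).zero_mem, (hD y).eq_left], by rw [e1 (hD y).mem, (hD y).eq_zero]⟩
    have hE' := hE.shift (hsub2 ht)
    have h1 := key hE
    have h2 := key hE'
    rw [e2 ht] at h2
    rw [h2, h1, hB.int_eq hFc hy ht]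
    have h3 : ∫ r in (0 : ℝ)..t, F (Φ (y, r)) = ∫ r in (0 : ℝ)..t, F (η r) := by
      refine intervalIntegral.integral_congr fun r hr ↦ ?_
      simp only [e2 (hB.uIcc_subset ht hr)]
    rw [h3, intervalIntegral.integral_comp_add_right (fun r ↦ F (η r)), zero_add, sub_add_cancel,
      ← intervalIntegral.integral_add_adjacent_intervals (hint hη hE.zero_mem (hsub2 ht))
        (hint hη (hsub2 ht) hE.mem)]
    ring
  have hpropagate : ∀ {Φ J U ε}, IsFlowBox X F Φ J U ε → ∀ y ∈ U, ∀ t ∈ Ioo (-ε) ε,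
      ContMDiffAt (𝓡 m) 𝓘(ℝ, ℝ) ∞ h (Φ (y, t)) → ContMDiffAt (𝓡 m) 𝓘(ℝ, ℝ) ∞ h y := by
    intro Φ J U ε hB y hy t ht hsm
    have hpr : ContMDiffAt (𝓡 m) ((𝓡 m).prod 𝓘(ℝ, ℝ)) ∞ (fun y ↦ (y, t)) y :=
      contMDiffAt_id.prodMk contMDiffAt_const
    have h1 : ContMDiffAt (𝓡 m) 𝓘(ℝ, ℝ) ∞ (fun y ↦ h (Φ (y, t)) - J (y, t)) y :=
      (ContMDiffAt.comp y hsm ((hB.contMDiffAt_flow y hy t ht).comp y hpr)).sub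
        ((hB.contMDiffAt_int y hy t ht).comp y hpr)
    refine h1.congr_of_eventuallyEq ?_
    filter_upwards [hB.isOpen.mem_nhds hy] with z hz
    rw [hflow hB z hz t ht]; ring
  -- Near the section the flow line up to the smooth hitting time may be used, so `h` coincides with
  -- the local formula.
  have hzero : ∀ x, s x = 0 → ContMDiffAt (𝓡 m) 𝓘(ℝ, ℝ) ∞ h x := by
    intro p hp
    obtain ⟨Φ, J, U, ε, hpU, hB⟩ := exists_isFlowBox hX hF p
    obtain ⟨τ, hτp, hτ, -⟩ := hB.exists_hittingTime hpU (.of_forall fun y ↦ hs y) hp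
      (hpos p hp).ne'
    have h4 := hτ.self_of_nhds
    have h2 : ∀ᶠ y in 𝓝 p, τ y ∈ Ioo (-ε) ε :=
      h4.1.continuousAt.eventually (by rw [hτp]; exact Ioo_mem_nhds hB.zero_mem.1 hB.zero_mem.2)
    have h5 : ContMDiffAt (𝓡 m) 𝓘(ℝ, ℝ) ∞ (fun y ↦ - J (y, τ y)) p := by
      have h5 : ContMDiffAt (𝓡 m) 𝓘(ℝ, ℝ) ∞ (fun y ↦ J (y, τ y)) p :=
        (hB.contMDiffAt_int p hpU (τ p) h2.self_of_nhds).comp p (contMDiffAt_id.prodMk h4.1)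
      exact h5.neg
    refine h5.congr_of_eventuallyEq ?_
    filter_upwards [hτ, h2, hB.isOpen.mem_nhds hpU] with y g1 g2 g3
    have hE : JoinsZero X s y (fun t ↦ Φ (y, t)) (-ε) ε (τ y) :=
      ⟨hB.isFlowLine y g3, hB.zero_mem, g2, hB.flow_zero y g3, g1.2⟩
    rw [key hE, hB.int_eq hFc g3 g2]
  have hsm : ∀ x, ContMDiffAt (𝓡 m) 𝓘(ℝ, ℝ) ∞ h x := by
    intro x
    have hγ := (hD x).isFlowLine
    -- By `hpropagate`, smoothness of `h` passes in both directions along short flow segments.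
    -- Connectedness of the interval carries it from the section back to `x`.
    have := isPreconnected_Ioo.induction₂ (s := Ioo (c x) (d x))
      (fun t t' ↦ ContMDiffAt (𝓡 m) 𝓘(ℝ, ℝ) ∞ h (γ x t) ↔ ContMDiffAt (𝓡 m) 𝓘(ℝ, ℝ) ∞ h (γ x t'))
      (fun t₀ ht₀ ↦ by
        obtain ⟨Φ, J, U, ε, hpU, hB⟩ := exists_isFlowBox hX hF (γ x t₀)
        have e1 : ∀ᶠ t in 𝓝 t₀, γ x t ∈ U :=
          (hγ t₀ ht₀).continuousAt.eventually (hB.isOpen.mem_nhds hpU)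
        have e2 : ∀ᶠ t in 𝓝 t₀, t ∈ Ioo (c x) (d x) := Ioo_mem_nhds ht₀.1 ht₀.2
        have e3 : ∀ᶠ t in 𝓝 t₀, t ∈ Ioo (t₀ - ε) (t₀ + ε) :=
          Ioo_mem_nhds (by linarith [hB.pos]) (by linarith [hB.pos])
        filter_upwards [nhdsWithin_le_nhds e1, nhdsWithin_le_nhds e2, nhdsWithin_le_nhds e3]
          with t h1 h2 h3
        have step : ∀ {t₁ t₂ : ℝ}, t₁ ∈ Ioo (c x) (d x) → t₂ ∈ Ioo (c x) (d x) → γ x t₁ ∈ U →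
            t₂ - t₁ ∈ Ioo (-ε) ε → γ x t₂ = Φ (γ x t₁, t₂ - t₁) := by
          intro t₁ t₂ g1 g2 g3 g4
          have := hB.flow_eq hX (hγ.comp_add t₁)
            ⟨by linarith [g1.1], by linarith [g1.2]⟩ (by simpa using g3)
            ⟨⟨by linarith [g2.1], by linarith [g2.2]⟩, g4⟩
          simpa using this
        have i1 : t - t₀ ∈ Ioo (-ε) ε := ⟨by linarith [h3.1], by linarith [h3.2]⟩
        have i2 : t₀ - t ∈ Ioo (-ε) ε := ⟨by linarith [h3.2], by linarith [h3.1]⟩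
        constructor
        · intro hc
          refine hpropagate hB _ h1 _ i2 ?_
          rwa [← step h2 ht₀ h1 i2]
        · intro hc
          refine hpropagate hB _ hpU _ i1 ?_
          rwa [← step ht₀ h2 hpU i1])
      (fun _ _ _ _ _ _ h1 h2 ↦ h1.trans h2) (fun _ _ _ _ h ↦ h.symm) (hD x).zero_mem (hD x).mem
    have := this.2 (hzero _ (hD x).eq_zero)
    rwa [(hD x).eq_left] at this
  refine ⟨h, hsm, fun x ↦ ?_⟩
  obtain ⟨Φ, J, U, ε, hxU, hB⟩ := exists_isFlowBox hX hF x
  refine hB.dirDeriv_eq hxU ((hsm x).mdifferentiableAt (by simp)) ?_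
  filter_upwards [Ioo_mem_nhds hB.zero_mem.1 hB.zero_mem.2] with t ht
  exact hflow hB x hxU t ht

end FlowEquationSolutions

/-! ### Pushforwards, and embedded hypersurfaces: retractions, lifts, extensions -/

section Pushforward

variable {E E' E'' : Type*} [NormedAddCommGroup E] [NormedSpace ℝ E]
  [NormedAddCommGroup E'] [NormedSpace ℝ E'] [NormedAddCommGroup E''] [NormedSpace ℝ E'']
  {H H' H'' : Type*} [TopologicalSpace H] [TopologicalSpace H'] [TopologicalSpace H'']
  {I : ModelWithCorners ℝ E H} {I' : ModelWithCorners ℝ E' H'} {I'' : ModelWithCorners ℝ E'' H''}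
  {A B C : Type*} [TopologicalSpace A] [TopologicalSpace B] [TopologicalSpace C]
  [ChartedSpace H A] [ChartedSpace H' B] [ChartedSpace H'' C]
  [IsManifold I' ∞ B] [IsManifold I'' ∞ C]

/-- The image of a vector field along a map under a further differential is smooth. -/
lemma contMDiffAt_mfderiv_apply {f : A → B} {V : ∀ x, TangentSpace I' (f x)} {x₀ : A}
    (hV : ContMDiffAt I I'.tangent ∞ (fun x ↦ (⟨f x, V x⟩ : TangentBundle I' B)) x₀)
    {r : B → C} (hr : ∀ᶠ y in 𝓝 (f x₀), ContMDiffAt I' I'' ∞ r y) :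
    ContMDiffAt I I''.tangent ∞
      (fun x ↦ (⟨r (f x), mfderiv I' I'' r (f x) (V x)⟩ : TangentBundle I'' C)) x₀ := by
  obtain ⟨U, hU, hUo, hxU⟩ := eventually_nhds_iff.1 hr
  have h1 : ContMDiffOn I' I'' ∞ r U := fun y hy ↦ (hU y hy).contMDiffWithinAt
  have h2 := h1.contMDiffOn_tangentMapWithin (m := ∞) (by simp) hUo.uniqueMDiffOn
  have hf : ContinuousAt f x₀ :=
    (FiberBundle.continuous_proj E' (TangentSpace I')).continuousAt.comp hV.continuousAt
  have hopen : IsOpen (Bundle.TotalSpace.proj ⁻¹' U : Set (TangentBundle I' B)) :=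
    hUo.preimage (FiberBundle.continuous_proj E' (TangentSpace I'))
  have h3 := (h2.contMDiffAt (x := (⟨f x₀, V x₀⟩ : TangentBundle I' B))
    (hopen.mem_nhds hxU)).comp x₀ hV
  refine h3.congr_of_eventuallyEq ?_
  filter_upwards [hf.eventually (hUo.mem_nhds hxU)] with x hx
  simp only [Function.comp_apply, tangentMapWithin]
  rw [mfderivWithin_of_isOpen hUo hx]

lemma contMDiffAt_mvfderiv_apply {f : A → B} {V : ∀ x, TangentSpace I' (f x)} {x₀ : A}
    (hV : ContMDiffAt I I'.tangent ∞ (fun x ↦ (⟨f x, V x⟩ : TangentBundle I' B)) x₀)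
    {h : B → ℝ} (hh : ∀ᶠ y in 𝓝 (f x₀), ContMDiffAt I' 𝓘(ℝ, ℝ) ∞ h y) :
    ContMDiffAt I 𝓘(ℝ, ℝ) ∞ (fun x ↦ mvfderiv I' h (f x) (V x)) x₀ :=
  (contMDiff_snd_tangentBundle_modelSpace ℝ 𝓘(ℝ, ℝ)).contMDiffAt.comp x₀
    (contMDiffAt_mfderiv_apply hV hh)

end Pushforward

section Immersion

variable {m : ℕ} {M : Type*} [TopologicalSpace M] [ChartedSpace (Euc (m + 1)) M]
  [IsManifold (𝓡 (m + 1)) ∞ M]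
  {N : Type*} [TopologicalSpace N] [ChartedSpace (Euc m) N] [IsManifold (𝓡 m) ∞ N]

variable (m) in
/-- `r` is a smooth left inverse of `φ` near `p`. -/
structure IsLocalRetraction (φ : N → M) (r : M → N) (p : N) : Prop where
  smooth : ∀ᶠ y in 𝓝 (φ p), ContMDiffAt (𝓡 (m + 1)) (𝓡 m) ∞ r y
  left_inv : ∀ᶠ q in 𝓝 p, r (φ q) = q

variable {φ : N → M} {r : M → N} {p : N}

/-- In charts adapted to the immersion `φ` is `v ↦ (v, 0)`, and projection to the first factor
inverts it. Such an `r` turns statements along `φ` into statements on open sets of `M`. -/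
lemma exists_isLocalRetraction (hφ : Manifold.IsSmoothEmbedding (𝓡 m) (𝓡 (m + 1)) ∞ φ) (p : N) :
    ∃ r, IsLocalRetraction m φ r p := by
  have h := hφ.isImmersion.isImmersionAt p
  set d := h.domChart.extend (𝓡 m) with hd
  set c := h.codChart.extend (𝓡 (m + 1)) with hc
  have hdt : d.target = (𝓡 m) '' h.domChart.target := by
    rw [hd, OpenPartialHomeomorph.extend_target, ModelWithCorners.image_eq]
  have hdo : IsOpen d.target := h.domChart.isOpen_extend_target
  have hds : ContMDiffOn 𝓘(ℝ, Euc m) (𝓡 m) ∞ d.symm d.target := by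
    rw [hdt]; exact contMDiffOn_extend_symm h.domChart_mem_maximalAtlas
  have hcs : ContMDiffOn (𝓡 (m + 1)) 𝓘(ℝ, Euc (m + 1)) ∞ c h.codChart.source :=
    h.codChart.contMDiffOn_extend h.codChart_mem_maximalAtlas
  have hkey : ∀ q ∈ h.domChart.source, c (φ q) = h.equiv (d q, 0) := by
    intro q hq
    have hq' : q ∈ d.source := by rwa [hd, OpenPartialHomeomorph.extend_source]
    have h1 := h.writtenInCharts (d.map_source hq')
    simp only [Function.comp_apply] at h1
    rwa [← hd, d.left_inv hq'] at h1
  have hps := h.mem_domChart_source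
  set ϖ : M → Euc m := fun y ↦ (h.equiv.symm (c y)).1 with hϖ
  have hϖφ : ∀ q ∈ h.domChart.source, ϖ (φ q) = d q := by
    intro q hq
    simp only [hϖ, hkey q hq, ContinuousLinearEquiv.symm_apply_apply]
  have hϖs : ∀ y ∈ h.codChart.source, ContMDiffAt (𝓡 (m + 1)) 𝓘(ℝ, Euc m) ∞ ϖ y := by
    intro y hy
    have h1 := (hcs y hy).contMDiffAt (h.codChart.open_source.mem_nhds hy)
    have h2 : ContDiff ℝ ∞ (fun w : Euc (m + 1) ↦ (h.equiv.symm w).1) :=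
      contDiff_fst.comp h.equiv.symm.contDiff
    exact (h2.contMDiff.contMDiffAt).comp y h1
  refine ⟨fun y ↦ d.symm (ϖ y), ⟨?_, ?_⟩⟩
  · have hφp := h.mem_codChart_source
    have e1 : ∀ᶠ y in 𝓝 (φ p), y ∈ h.codChart.source := h.codChart.open_source.mem_nhds hφp
    have e2 : ∀ᶠ y in 𝓝 (φ p), ϖ y ∈ d.target :=
      (hϖs _ hφp).continuousAt.eventually_of_eq (hϖφ p hps) (hdo.mem_nhds (d.map_source
        (by rwa [hd, OpenPartialHomeomorph.extend_source])))
    filter_upwards [e1, e2] with y h1 h2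
    exact ((hds _ h2).contMDiffAt (hdo.mem_nhds h2)).comp y (hϖs y h1)
  · filter_upwards [h.domChart.open_source.mem_nhds hps] with q hq
    rw [hϖφ q hq]
    exact d.left_inv (by rwa [hd, OpenPartialHomeomorph.extend_source])

lemma IsLocalRetraction.eventually (h : IsLocalRetraction m φ r p) (hφ : ContinuousAt φ p) :
    ∀ᶠ q in 𝓝 p, IsLocalRetraction m φ r q := by
  filter_upwards [hφ.eventually h.smooth.eventually_nhds, h.left_inv.eventually_nhds] with q h1 h2
  exact ⟨h1, h2⟩

lemma IsLocalRetraction.mfderiv_dmap (h : IsLocalRetraction m φ r p)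
    (hφ : ContMDiff (𝓡 m) (𝓡 (m + 1)) ∞ φ) (v : TangentSpace (𝓡 m) p) :
    mfderiv (𝓡 (m + 1)) (𝓡 m) r (φ p) (dmap φ p v) = v := by
  have h1 : MDifferentiableAt (𝓡 (m + 1)) (𝓡 m) r (φ p) :=
    h.smooth.self_of_nhds.mdifferentiableAt (by simp)
  have h2 : MDifferentiableAt (𝓡 m) (𝓡 (m + 1)) φ p := hφ.mdifferentiable (by simp) p
  have h3 := mfderiv_comp_apply p h1 h2 v
  rw [dmap, ← h3]
  have h4 : r ∘ φ =ᶠ[𝓝 p] id := h.left_inv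
  rw [h4.mfderiv_eq, mfderiv_id]
  rfl

lemma dmap_injective (hφ : Manifold.IsSmoothEmbedding (𝓡 m) (𝓡 (m + 1)) ∞ φ) (p : N) :
    Function.Injective (dmap (m := m) φ p) := by
  obtain ⟨r, hr⟩ := exists_isLocalRetraction hφ p
  exact Function.LeftInverse.injective (g := mfderiv (𝓡 (m + 1)) (𝓡 m) r (φ p))
    (hr.mfderiv_dmap hφ.contMDiff)

lemma dirDeriv_comp_dmap (hφ : ContMDiff (𝓡 m) (𝓡 (m + 1)) ∞ φ) {h : M → ℝ}
    (hh : MDifferentiableAt (𝓡 (m + 1)) 𝓘(ℝ, ℝ) h (φ p)) (v : TangentSpace (𝓡 m) p) :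
    dirDeriv (fun q ↦ h (φ q)) p v = dirDeriv h (φ p) (dmap φ p v) := by
  have h2 : MDifferentiableAt (𝓡 m) (𝓡 (m + 1)) φ p := hφ.mdifferentiable (by simp) p
  exact congrArg (fun L : ℝ ↦ L) (mfderiv_comp_apply p hh h2 v)

lemma dirDeriv_const {d : ℕ} {A : Type*} [TopologicalSpace A] [ChartedSpace (Euc d) A]
    [IsManifold (𝓡 d) ∞ A] (c : ℝ) (x : A) (v : TangentSpace (𝓡 d) x) :
    dirDeriv (fun _ : A ↦ c) x v = 0 := by
  simp [dirDeriv, mvfderiv]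

/-- For an embedding of codimension one into `{u = 0}`, the tangent space is the kernel of `du`. -/
lemma exists_dmap_eq (hφ : Manifold.IsSmoothEmbedding (𝓡 m) (𝓡 (m + 1)) ∞ φ) {u : M → ℝ}
    (hu : ContMDiff (𝓡 (m + 1)) 𝓘(ℝ, ℝ) ∞ u) (huφ : ∀ q, u (φ q) = 0)
    (hdu : mvfderiv (𝓡 (m + 1)) u (φ p) ≠ 0) {w : TangentSpace (𝓡 (m + 1)) (φ p)}
    (hw : dirDeriv u (φ p) w = 0) : ∃ v, dmap φ p v = w := by
  set L : Euc (m + 1) →ₗ[ℝ] ℝ :=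
    ContinuousLinearMap.toLinearMap (M := Euc (m + 1)) (mvfderiv (𝓡 (m + 1)) u (φ p)) with hL
  set T : Euc m →ₗ[ℝ] Euc (m + 1) :=
    ContinuousLinearMap.toLinearMap (M := Euc m) (M₂ := Euc (m + 1)) (dmap φ p) with hT
  have h1 : LinearMap.range T ≤ LinearMap.ker L := by
    rintro _ ⟨v, rfl⟩
    have := dirDeriv_comp_dmap (p := p) hφ.contMDiff (hu.mdifferentiable (by simp) (φ p)) v
    rw [show (fun q ↦ u (φ q)) = fun _ ↦ (0 : ℝ) from funext huφ] at this
    exact this.symm.trans (dirDeriv_const 0 p v)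
  have h2 : Module.finrank ℝ (LinearMap.range T) = m := by
    have hT : Function.Injective T := dmap_injective hφ p
    rw [LinearMap.finrank_range_of_inj hT]; simp
  have hL0 : L ≠ 0 := fun h ↦ hdu (ContinuousLinearMap.ext fun v ↦ LinearMap.congr_fun h v)
  have h3 : Module.finrank ℝ (LinearMap.ker L) = m := by
    have h4 := LinearMap.finrank_range_add_finrank_ker L
    have h5 : LinearMap.range L = ⊤ := LinearMap.range_eq_top.2 (LinearMap.surjective hL0)
    rw [h5, finrank_top] at h4
    simp at h4
    omega
  -- The image of the differential lies in the kernel of `du`, and both have dimension `m`.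
  have h6 := Submodule.eq_of_le_of_finrank_eq h1 (h2.trans h3.symm)
  have h7 : w ∈ LinearMap.ker L := hw
  rw [← h6] at h7
  exact h7

/-- A smooth vector field tangent to the image of `φ` comes from a smooth vector field. -/
lemma exists_smooth_lift (hφ : Manifold.IsSmoothEmbedding (𝓡 m) (𝓡 (m + 1)) ∞ φ)
    {n : VField (m + 1) M} (hn : SmoothVField n) (htan : ∀ p, ∃ v, dmap φ p v = n (φ p)) :
    ∃ X : VField m N, SmoothVField X ∧ ∀ p, dmap φ p (X p) = n (φ p) := by
  choose X hX using htan
  refine ⟨X, fun p ↦ ?_, hX⟩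
  obtain ⟨r, hr⟩ := exists_isLocalRetraction hφ p
  have h1 : ContMDiffAt (𝓡 m) (𝓡 (m + 1)).tangent ∞
      (fun q ↦ (⟨φ q, n (φ q)⟩ : TangentBundle (𝓡 (m + 1)) M)) p :=
    ContMDiffAt.comp p (hn (φ p)) (hφ.contMDiff p)
  -- Near `p` the lift is the image of `n ∘ φ` under the differential of `r`, which is smooth.
  have h2 := contMDiffAt_mfderiv_apply (I'' := 𝓡 m) h1 hr.smooth
  refine h2.congr_of_eventuallyEq ?_
  filter_upwards [hr.eventually hφ.contMDiff.continuous.continuousAt] with q hq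
  have h3 := hq.mfderiv_dmap hφ.contMDiff (X q)
  rw [hX] at h3
  have h4 := hq.left_inv.self_of_nhds
  have h5 : ∀ q', q' = q → (⟨q, X q⟩ : TangentBundle (𝓡 m) N) = ⟨q', (X q : Euc m)⟩ := by
    rintro _ rfl; rfl
  rw [h3]
  exact h5 _ h4

/-- An integral curve of `n` in the image of `φ` comes from an integral curve. -/
lemma exists_lift_integralCurve (hφ : Manifold.IsSmoothEmbedding (𝓡 m) (𝓡 (m + 1)) ∞ φ)
    {n : VField (m + 1) M} {X : VField m N} (hX : ∀ p, dmap φ p (X p) = n (φ p)) {γ : ℝ → M}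
    {s : Set ℝ} (hγ : IsMIntegralCurveOn (I := 𝓡 (m + 1)) γ n s) (hs : ∀ t ∈ s, γ t ∈ range φ)
    (p₀ : N) :
    ∃ η : ℝ → N, (∀ t ∈ s, φ (η t) = γ t) ∧ IsMIntegralCurveOn (I := 𝓡 m) η X s := by
  classical
  set η : ℝ → N := fun t ↦ if h : t ∈ s then (hs t h).choose else p₀ with hη
  have hφη : ∀ t ∈ s, φ (η t) = γ t := fun t ht ↦ by
    simp only [hη, dif_pos ht]; exact (hs t ht).choose_spec
  refine ⟨η, hφη, fun t ht ↦ ?_⟩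
  obtain ⟨r, hr⟩ := exists_isLocalRetraction hφ (η t)
  -- The pointwise lift is continuous because `φ` is a topological embedding; hence `η = r ∘ γ`
  -- locally, and the chain rule applies.
  have hc : ContinuousWithinAt η s t := by
    rw [hφ.isEmbedding.isInducing.continuousWithinAt_iff]
    exact (hγ t ht).continuousWithinAt.congr (fun t' ht' ↦ hφη t' ht') (hφη t ht)
  have h1 : MDifferentiableAt (𝓡 (m + 1)) (𝓡 m) r (γ t) := by
    rw [← hφη t ht]
    exact hr.smooth.self_of_nhds.mdifferentiableAt (by simp)
  have h2 := h1.hasMFDerivAt.comp_hasMFDerivWithinAt t (hγ t ht)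
  have h3 : η =ᶠ[𝓝[s] t] r ∘ γ := by
    filter_upwards [hc.eventually hr.left_inv, self_mem_nhdsWithin] with t' h4 h5
    rw [Function.comp_apply, ← hφη t' h5, h4]
  have h4 := h2.congr_of_eventuallyEq h3 (h3.self_of_nhdsWithin ht)
  refine h4.congr_mfderiv (ContinuousLinearMap.ext_ring ?_)
  change mfderiv (𝓡 (m + 1)) (𝓡 m) r (γ t) ((1 : ℝ) • n (γ t)) = (1 : ℝ) • X (η t)
  rw [one_smul, one_smul]
  have h5 := hr.mfderiv_dmap hφ.contMDiff (X (η t))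
  rw [hX, hφη t ht] at h5
  exact h5

/-- A smooth function on a closed embedded submanifold extends to a smooth function. -/
lemma exists_smooth_extension [T2Space M] [SigmaCompactSpace M]
    (hφ : Manifold.IsSmoothEmbedding (𝓡 m) (𝓡 (m + 1)) ∞ φ)
    (hcl : IsClosed (range φ)) {h : N → ℝ} (hh : ContMDiff (𝓡 m) 𝓘(ℝ, ℝ) ∞ h) :
    ∃ h' : M → ℝ, ContMDiff (𝓡 (m + 1)) 𝓘(ℝ, ℝ) ∞ h' ∧ ∀ p, h' (φ p) = h p := by
  obtain ⟨h', hh'⟩ := exists_contMDiffMap_forall_mem_convex_of_local (n := ⊤) (𝓡 (m + 1))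
    (M := M) (F := ℝ) (t := fun x ↦ {y | ∀ p, φ p = x → y = h p})
    (fun x ↦ by
      by_cases hx : ∃ p, φ p = x
      · obtain ⟨p, rfl⟩ := hx
        convert! convex_singleton (𝕜 := ℝ) (h p) using 1
        ext y
        constructor
        · intro hy; exact hy p rfl
        · rintro rfl q hq; rw [hφ.isEmbedding.injective hq]
      · convert! convex_univ (𝕜 := ℝ) (E := ℝ) using 1
        ext y
        simp only [mem_univ, iff_true]
        intro p hp; exact absurd ⟨p, hp⟩ hx)
    (fun x ↦ by
      by_cases hx : ∃ p, φ p = x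
      · obtain ⟨p, rfl⟩ := hx
        obtain ⟨r, hr⟩ := exists_isLocalRetraction hφ p
        -- Since `φ` is an embedding, points of its image near `φ p` come only from points near `p`,
        -- where `r` is a left inverse. So `h ∘ r` is a correct local extension.
        have h1 : ∀ᶠ y in 𝓝 (φ p), ∀ q, φ q = y → r y = q := by
          have h2 := hr.left_inv
          rw [hφ.isEmbedding.isInducing.nhds_eq_comap, Filter.eventually_comap] at h2
          filter_upwards [h2] with y hy q hq
          rw [← hq, hy q hq]
        obtain ⟨U, hU, hUo, hpU⟩ := eventually_nhds_iff.1 (hr.smooth.and h1)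
        refine ⟨U, hUo.mem_nhds hpU, fun y ↦ h (r y), fun y hy ↦ ?_, fun y hy q hq ↦ ?_⟩
        · exact ((hh (r y)).comp y (hU y hy).1).contMDiffWithinAt
        · exact congrArg h ((hU y hy).2 q hq)
      · refine ⟨(range φ)ᶜ, hcl.isOpen_compl.mem_nhds (by simpa using hx), fun _ ↦ 0,
          contMDiffOn_const, fun y hy q hq ↦ absurd ⟨q, hq⟩ hy⟩)
  exact ⟨h', h'.contMDiff, fun p ↦ hh' (φ p) p rfl⟩

end Immersion

/-! ### Smoothness criteria for vector fields and endomorphism fields -/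

section VectorFields

variable {d : ℕ} {M : Type*} [TopologicalSpace M] [ChartedSpace (Euc d) M]
  [IsManifold (𝓡 d) ∞ M]

/-- Smoothness of a vector field at a point. -/
abbrev SmoothVFieldAt (X : VField d M) (x : M) : Prop :=
  ContMDiffAt (𝓡 d) ((𝓡 d).prod 𝓘(ℝ, Euc d)) ∞
    (fun x => Bundle.TotalSpace.mk' (Euc d) (E := fun x : M => TangentSpace (𝓡 d) x) x (X x)) x

/-- Differentiability of a vector field at a point. -/
abbrev DiffVFieldAt (X : VField d M) (x : M) : Prop :=
  MDifferentiableAt (𝓡 d) ((𝓡 d).prod 𝓘(ℝ, Euc d))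
    (fun x => Bundle.TotalSpace.mk' (Euc d) (E := fun x : M => TangentSpace (𝓡 d) x) x (X x)) x

/-- Smoothness of a vector field in a neighbourhood of a point. -/
def SmoothVFieldNear (X : VField d M) (x : M) : Prop := ∀ᶠ y in 𝓝 x, SmoothVFieldAt X y

variable {X Y Z : VField d M} {x x₀ : M}

lemma SmoothVFieldAt.diff (h : SmoothVFieldAt X x) : DiffVFieldAt X x :=
  h.mdifferentiableAt (by simp)

lemma SmoothVField.smoothAt (h : SmoothVField X) (x : M) : SmoothVFieldAt X x := h x

lemma SmoothVField.diffAt (h : SmoothVField X) (x : M) : DiffVFieldAt X x := (h.smoothAt x).diff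

lemma SmoothVField.near (h : SmoothVField X) (x : M) : SmoothVFieldNear X x := .of_forall h

lemma SmoothVFieldNear.self (h : SmoothVFieldNear X x) : SmoothVFieldAt X x := h.self_of_nhds

lemma SmoothVFieldNear.eventually (h : SmoothVFieldNear X x) :
    ∀ᶠ y in 𝓝 x, SmoothVFieldNear X y := h.eventually_nhds

/-- The vector field which is constant in the trivialization at `x₀`. -/
def constField (x₀ : M) (c : Euc d) : VField d M :=
  fun x ↦ (trivializationAt (Euc d) (TangentSpace (𝓡 d)) x₀).symmL ℝ x c

lemma smoothVFieldAt_constField (c : Euc d)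
    (hx : x ∈ (trivializationAt (Euc d) (TangentSpace (𝓡 d)) x₀).baseSet) :
    SmoothVFieldAt (constField (M := M) x₀ c) x := by
  rw [SmoothVFieldAt, Bundle.Trivialization.contMDiffAt_section_iff _ hx]
  refine (contMDiffAt_const (c := c)).congr_of_eventuallyEq ?_
  filter_upwards [(trivializationAt (Euc d) (TangentSpace (𝓡 d)) x₀).open_baseSet.mem_nhds hx]
    with y hy
  have h := Bundle.Trivialization.continuousLinearMapAt_symmL (R := ℝ) _ hy c
  rw [Bundle.Trivialization.continuousLinearMapAt_apply_of_mem ℝ _ hy] at h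
  exact h

lemma smoothVFieldNear_constField (x₀ : M) (c : Euc d) :
    SmoothVFieldNear (constField (M := M) x₀ c) x₀ := by
  filter_upwards [(trivializationAt (Euc d) (TangentSpace (𝓡 d)) x₀).open_baseSet.mem_nhds
    (FiberBundle.mem_baseSet_trivializationAt' x₀)] with y hy
  exact smoothVFieldAt_constField c hy

lemma exists_constField_eq (v : TangentSpace (𝓡 d) x₀) : ∃ c, constField (M := M) x₀ c x₀ = v :=
  ⟨(trivializationAt (Euc d) (TangentSpace (𝓡 d)) x₀).continuousLinearMapAt ℝ x₀ v, by
    rw [constField]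
    exact Bundle.Trivialization.symmL_continuousLinearMapAt _
      (FiberBundle.mem_baseSet_trivializationAt' x₀) v⟩

/-- Every tangent vector is a value of a smooth vector field. -/
lemma exists_smoothVField_eq [T2Space M] [SigmaCompactSpace M] (x₀ : M)
    (v : TangentSpace (𝓡 d) x₀) : ∃ X : VField d M, SmoothVField X ∧ X x₀ = v := by
  classical
  obtain ⟨c, hc⟩ := exists_constField_eq v
  obtain ⟨X, hX⟩ := exists_contMDiffSection_forall_mem_convex_of_local (n := ⊤) (𝓡 d)
    (F_fiber := Euc d) (fun x : M ↦ TangentSpace (𝓡 d) x)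
    (fun x ↦ if x = x₀ then {constField x₀ c x} else univ)
    (fun x ↦ by
      split_ifs
      · exact convex_singleton _
      · exact convex_univ)
    (fun x ↦ by
      by_cases hx : x = x₀
      · subst hx
        obtain ⟨U, hU, hUo, hxU⟩ := eventually_nhds_iff.1 (smoothVFieldNear_constField x c)
        refine ⟨U, hUo.mem_nhds hxU, constField x c, fun y hy ↦ (hU y hy).contMDiffWithinAt,
          fun y _ ↦ ?_⟩
        split_ifs <;> simp
      · refine ⟨{x₀}ᶜ, isOpen_compl_singleton.mem_nhds hx, fun _ ↦ 0, ?_, fun y hy ↦ ?_⟩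
        · exact (Bundle.contMDiff_zeroSection ℝ (fun x : M ↦ TangentSpace (𝓡 d) x)).contMDiffOn
        · rw [if_neg (show y ≠ x₀ from hy)]; trivial)
  refine ⟨X, X.contMDiff, ?_⟩
  have := hX x₀
  rw [if_pos rfl, mem_singleton_iff] at this
  rw [this, hc]

variable {g : TwoTensor d M}

lemma SmoothTwoTensor.smoothAt_apply (hg : SmoothTwoTensor g) (hX : SmoothVFieldAt X x)
    (hY : SmoothVFieldAt Y x) :
    ContMDiffAt (𝓡 d) 𝓘(ℝ, ℝ) ∞ (fun y ↦ g y (X y) (Y y)) x := by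
  have h := ContMDiffAt.clm_bundle_apply₂ (F₁ := Euc d) (F₂ := Euc d) (F₃ := ℝ)
    (E₃ := fun _ : M ↦ ℝ) (b := fun x : M ↦ x) (hg x) hX hY
  exact (Bundle.contMDiffAt_section _).1 h

lemma SmoothTwoTensor.diffAt_apply (hg : SmoothTwoTensor g) (hX : DiffVFieldAt X x)
    (hY : DiffVFieldAt Y x) :
    MDifferentiableAt (𝓡 d) 𝓘(ℝ, ℝ) (fun y ↦ g y (X y) (Y y)) x := by
  have h := MDifferentiableAt.clm_bundle_apply₂ (F₁ := Euc d) (F₂ := Euc d) (F₃ := ℝ)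
    (E₃ := fun _ : M ↦ ℝ) (b := fun x : M ↦ x) ((hg x).mdifferentiableAt (by simp)) hX hY
  exact (mdifferentiableAt_section _ _).1 h

lemma SmoothOneForm.diffAt_apply {W : OneForm d M} (hW : SmoothOneForm W)
    (hX : DiffVFieldAt X x) : MDifferentiableAt (𝓡 d) 𝓘(ℝ, ℝ) (fun y ↦ W y (X y)) x := by
  have h := MDifferentiableAt.clm_bundle_apply (F₁ := Euc d) (F₂ := ℝ)
    (E₂ := fun _ : M ↦ ℝ) (b := fun x : M ↦ x) ((hW x).mdifferentiableAt (by simp)) hX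
  exact (mdifferentiableAt_section _ _).1 h

lemma SmoothTwoTensor.smoothOneForm (hg : SmoothTwoTensor g) (hX : SmoothVField X) :
    SmoothOneForm (fun y ↦ g y (X y)) := fun x ↦
  ContMDiffAt.clm_bundle_apply (F₁ := Euc d) (F₂ := Euc d →L[ℝ] ℝ)
    (E₂ := fun x : M ↦ TangentSpace (𝓡 d) x →L[ℝ] ℝ) (b := fun x : M ↦ x) (hg x) (hX x)

lemma SmoothVFieldNear.mlieBracket (hX : SmoothVFieldNear X x) (hY : SmoothVFieldNear Y x) :
    SmoothVFieldNear (VectorField.mlieBracket (𝓡 d) X Y) x := by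
  have : IsManifold (𝓡 d) ((⊤ : ℕ∞) + 1) M := by
    have : (((⊤ : ℕ∞) : ℕ∞ω) + 1) = ∞ := rfl
    rw [this]; infer_instance
  have : IsManifold (𝓡 d) (minSmoothness ℝ 2) M := by
    rw [minSmoothness_of_isRCLikeNormedField]; infer_instance
  filter_upwards [hX, hY] with y h1 h2
  exact ContMDiffAt.mlieBracket_vectorField (n := ⊤) (m := ⊤) h1 h2 (by simp)

lemma SmoothVFieldNear.smoothAt_dirDeriv (hX : SmoothVFieldNear X x) {h : M → ℝ}
    (hh : ∀ᶠ y in 𝓝 x, ContMDiffAt (𝓡 d) 𝓘(ℝ, ℝ) ∞ h y) :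
    ∀ᶠ y in 𝓝 x, ContMDiffAt (𝓡 d) 𝓘(ℝ, ℝ) ∞ (fun y ↦ dirDeriv h y (X y)) y := by
  filter_upwards [hX, hh.eventually_nhds] with y h1 h2
  exact contMDiffAt_mvfderiv_apply (f := fun y : M ↦ y) h1 h2

end VectorFields

section Coordinates

variable {d : ℕ} {E : Type*} [NormedAddCommGroup E] [NormedSpace ℝ E] {H : Type*}
  [TopologicalSpace H] {I : ModelWithCorners ℝ E H} {A : Type*} [TopologicalSpace A]
  [ChartedSpace H A] {F : Type*} [NormedAddCommGroup F] [NormedSpace ℝ F]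

/-- A map into `ℝᵈ →L F` is smooth if its values on vectors are. -/
lemma contMDiffAt_clm_of_apply {L : A → Euc d →L[ℝ] F} {x : A}
    (h : ∀ c, ContMDiffAt I 𝓘(ℝ, F) ∞ (fun y ↦ L y c) x) :
    ContMDiffAt I 𝓘(ℝ, Euc d →L[ℝ] F) ∞ L x := by
  set b := EuclideanSpace.basisFun (Fin d) ℝ with hb
  have h1 : ∀ y, L y = ∑ i, (ContinuousLinearMap.smulRightL ℝ (Euc d) F
      (EuclideanSpace.proj i)) (L y (b i)) := by
    intro y
    ext v
    have h2 : v = ∑ i, v i • b i := by simpa [hb] using (b.sum_repr v).symm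
    conv_lhs => rw [h2]
    simp
  have h2 : ContMDiffAt I 𝓘(ℝ, Euc d →L[ℝ] F) ∞ (fun y ↦ ∑ i,
      (ContinuousLinearMap.smulRightL ℝ (Euc d) F (EuclideanSpace.proj i)) (L y (b i))) x := by
    refine ContMDiffAt.sum fun i _ ↦ ?_
    exact (ContinuousLinearMap.contMDiff _).contMDiffAt.comp x (h (b i))
  exact h2.congr_of_eventuallyEq (.of_forall h1)

end Coordinates

section Sharp

variable {d : ℕ} {M : Type*} [TopologicalSpace M] [ChartedSpace (Euc d) M]
  [IsManifold (𝓡 d) ∞ M] {g : TwoTensor d M}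

/-- Nondegeneracy of a bilinear form. -/
def Nondegenerate (g : TwoTensor d M) : Prop :=
  ∀ (x : M) (v : TangentSpace (𝓡 d) x), (∀ w, g x v w = 0) → v = 0

lemma isInvertible_of_nondegenerate {B : Euc d →L[ℝ] Euc d →L[ℝ] ℝ}
    (hB : ∀ v, (∀ w, B v w = 0) → v = 0) : B.IsInvertible := by
  have h1 : Function.Injective (B : Euc d →ₗ[ℝ] Euc d →L[ℝ] ℝ) := by
    refine (injective_iff_map_eq_zero _).2 fun v hv ↦ hB v fun w ↦ ?_
    have : B v = 0 := hv
    rw [this]; rfl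
  have h2 : Module.finrank ℝ (Euc d) = Module.finrank ℝ (Euc d →L[ℝ] ℝ) := by
    rw [← (LinearMap.toContinuousLinearMap (𝕜 := ℝ) (E := Euc d) (F' := ℝ)).finrank_eq,
      Module.finrank_linearMap_self]
  exact ⟨(LinearEquiv.ofInjectiveOfFinrankEq _ h1 h2).toContinuousLinearEquiv, rfl⟩

/-- A vector field is smooth if its inner products with constant fields are. -/
lemma smoothVFieldAt_of_apply (hg : SmoothTwoTensor g) (hnd : Nondegenerate g) {V : VField d M}
    {x₀ : M}
    (h : ∀ c, ContMDiffAt (𝓡 d) 𝓘(ℝ, ℝ) ∞ (fun y ↦ g y (V y) (constField x₀ c y)) x₀) :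
    SmoothVFieldAt V x₀ := by
  set e := trivializationAt (Euc d) (TangentSpace (𝓡 d)) x₀ with he
  have hx₀ : x₀ ∈ e.baseSet := FiberBundle.mem_baseSet_trivializationAt' x₀
  set B : M → Euc d →L[ℝ] Euc d →L[ℝ] ℝ := fun x ↦
    ((ContinuousLinearMap.compL ℝ (Euc d) (Euc d) ℝ).flip (e.symmL ℝ x : Euc d →L[ℝ] Euc d)).comp
      ((g x : Euc d →L[ℝ] Euc d →L[ℝ] ℝ).comp (e.symmL ℝ x : Euc d →L[ℝ] Euc d)) with hB
  set β : M → Euc d →L[ℝ] ℝ := fun x ↦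
    (g x (V x) : Euc d →L[ℝ] ℝ).comp (e.symmL ℝ x : Euc d →L[ℝ] Euc d) with hβ
  have hBa : ∀ x c c', B x c c' = g x (constField x₀ c x) (constField x₀ c' x) := fun _ _ _ ↦ rfl
  have hβa : ∀ x c, β x c = g x (V x) (constField x₀ c x) := fun _ _ ↦ rfl
  have hBs : ContMDiffAt (𝓡 d) 𝓘(ℝ, Euc d →L[ℝ] Euc d →L[ℝ] ℝ) ∞ B x₀ :=
    contMDiffAt_clm_of_apply fun c ↦ contMDiffAt_clm_of_apply fun c' ↦
      hg.smoothAt_apply (smoothVFieldAt_constField c hx₀) (smoothVFieldAt_constField c' hx₀)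
  have hβs : ContMDiffAt (𝓡 d) 𝓘(ℝ, Euc d →L[ℝ] ℝ) ∞ β x₀ := contMDiffAt_clm_of_apply h
  have hsurj : ∀ x ∈ e.baseSet, ∀ v : TangentSpace (𝓡 d) x,
      constField x₀ (e.continuousLinearMapAt ℝ x v) x = v := fun x hx v ↦
    Bundle.Trivialization.symmL_continuousLinearMapAt _ hx v
  have hBinv : ∀ x ∈ e.baseSet, (B x).IsInvertible := by
    intro x hx
    refine isInvertible_of_nondegenerate fun c hc ↦ ?_
    have h1 : constField x₀ c x = 0 := hnd x _ fun w ↦ by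
      have := hc (e.continuousLinearMapAt ℝ x w)
      rwa [hBa, hsurj x hx] at this
    have h2 := Bundle.Trivialization.continuousLinearMapAt_symmL (R := ℝ) e hx c
    rw [← h2]
    change e.continuousLinearMapAt ℝ x (constField x₀ c x) = 0
    rw [h1, map_zero]
  rw [SmoothVFieldAt, Bundle.Trivialization.contMDiffAt_section_iff e hx₀]
  obtain ⟨T, hT⟩ := hBinv x₀ hx₀
  -- In the trivialization the components of `V` solve the linear system with Gram matrix `B` and
  -- right-hand side `β`; matrix inversion is smooth.
  have h1 : ContMDiffAt (𝓡 d) 𝓘(ℝ, (Euc d →L[ℝ] ℝ) →L[ℝ] Euc d) ∞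
      (fun x ↦ (B x).inverse) x₀ := by
    have h2 : ContDiffAt ℝ ∞ (ContinuousLinearMap.inverse :
      (Euc d →L[ℝ] Euc d →L[ℝ] ℝ) → _) (B x₀) := hT ▸ contDiffAt_map_inverse T
    exact h2.contMDiffAt.comp x₀ hBs
  refine (h1.clm_apply hβs).congr_of_eventuallyEq ?_
  filter_upwards [e.open_baseSet.mem_nhds hx₀] with x hx
  have h2 : β x = B x (e ⟨x, V x⟩).2 := by
    ext c
    rw [hβa, hBa]
    have h3 := hsurj x hx (V x)
    rw [Bundle.Trivialization.continuousLinearMapAt_apply_of_mem ℝ e hx] at h3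
    rw [h3]
  obtain ⟨T', hT'⟩ := hBinv x hx
  rw [h2, ← hT', ContinuousLinearMap.inverse_equiv]
  exact (T'.symm_apply_apply _).symm

/-- A field of endomorphisms is smooth if its values on smooth vector fields are. -/
lemma contMDiffAt_endomorphism_of_apply
    {A : ∀ x : M, TangentSpace (𝓡 d) x →L[ℝ] TangentSpace (𝓡 d) x} {x₀ : M}
    (h : ∀ X : VField d M, SmoothVFieldNear X x₀ → SmoothVFieldAt (fun x ↦ A x (X x)) x₀) :
    ContMDiffAt (𝓡 d) ((𝓡 d).prod 𝓘(ℝ, Euc d →L[ℝ] Euc d)) ∞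
      (fun x ↦ Bundle.TotalSpace.mk' (Euc d →L[ℝ] Euc d)
        (E := fun x : M ↦ TangentSpace (𝓡 d) x →L[ℝ] TangentSpace (𝓡 d) x) x (A x)) x₀ := by
  rw [contMDiffAt_hom_bundle]
  refine ⟨contMDiffAt_id, contMDiffAt_clm_of_apply fun c ↦ ?_⟩
  set e := trivializationAt (Euc d) (TangentSpace (𝓡 d)) x₀ with he
  have hx₀ : x₀ ∈ e.baseSet := FiberBundle.mem_baseSet_trivializationAt' x₀
  have h1 := h (constField x₀ c) (smoothVFieldNear_constField x₀ c)
  rw [SmoothVFieldAt, Bundle.Trivialization.contMDiffAt_section_iff e hx₀] at h1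
  refine h1.congr_of_eventuallyEq ?_
  filter_upwards [e.open_baseSet.mem_nhds hx₀] with x hx
  change e.continuousLinearMapAt ℝ x (A x (constField x₀ c x)) = _
  rw [Bundle.Trivialization.continuousLinearMapAt_apply_of_mem ℝ e hx]

end Sharp

/-! ### The Koszul formula and existence of the Levi-Civita connection -/

section DirDeriv

variable {d : ℕ} {M : Type*} [TopologicalSpace M] [ChartedSpace (Euc d) M]
  [IsManifold (𝓡 d) ∞ M] {f h : M → ℝ} {x : M}

lemma dirDeriv_add (hf : MDifferentiableAt (𝓡 d) 𝓘(ℝ, ℝ) f x)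
    (hh : MDifferentiableAt (𝓡 d) 𝓘(ℝ, ℝ) h x) (v : TangentSpace (𝓡 d) x) :
    dirDeriv (fun y ↦ f y + h y) x v = dirDeriv f x v + dirDeriv h x v := by
  rw [dirDeriv, mvfderiv_fun_add hf hh]; rfl

lemma dirDeriv_mul (hf : MDifferentiableAt (𝓡 d) 𝓘(ℝ, ℝ) f x)
    (hh : MDifferentiableAt (𝓡 d) 𝓘(ℝ, ℝ) h x) (v : TangentSpace (𝓡 d) x) :
    dirDeriv (fun y ↦ f y * h y) x v = f x * dirDeriv h x v + h x * dirDeriv f x v := by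
  rw [dirDeriv, mvfderiv_fun_mul hf hh]; rfl

end DirDeriv

section Koszul

variable {d : ℕ} {M : Type*} [TopologicalSpace M] [ChartedSpace (Euc d) M]
  [IsManifold (𝓡 d) ∞ M] {g : TwoTensor d M} {X X' Y Y' Z Z' : VField d M} {f : M → ℝ} {x : M}

/-- A smooth pseudo-Riemannian metric, of any signature. -/
structure IsPseudoMetric (g : TwoTensor d M) : Prop where
  smooth : SmoothTwoTensor g
  symm : ∀ (x : M) (v w : TangentSpace (𝓡 d) x), g x v w = g x w v
  nondegenerate : Nondegenerate g

/-- The Koszul expression, which is `g(∇_X Y, Z)` for the Levi-Civita connection. -/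
def koszul (g : TwoTensor d M) (X Y Z : VField d M) (x : M) : ℝ :=
  2⁻¹ * (dirDeriv (fun y ↦ g y (Y y) (Z y)) x (X x) + dirDeriv (fun y ↦ g y (X y) (Z y)) x (Y x)
    - dirDeriv (fun y ↦ g y (X y) (Y y)) x (Z x)
    + g x (VectorField.mlieBracket (𝓡 d) X Y x) (Z x)
    - g x (VectorField.mlieBracket (𝓡 d) X Z x) (Y x)
    - g x (VectorField.mlieBracket (𝓡 d) Y Z x) (X x))

namespace IsPseudoMetric

variable (hg : IsPseudoMetric g)
include hg

lemma dirDeriv_smul_left (hf : MDifferentiableAt (𝓡 d) 𝓘(ℝ, ℝ) f x) (hX : DiffVFieldAt X x)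
    (hY : DiffVFieldAt Y x) (v : TangentSpace (𝓡 d) x) :
    dirDeriv (fun y ↦ g y ((f • X) y) (Y y)) x v
      = f x * dirDeriv (fun y ↦ g y (X y) (Y y)) x v + g x (X x) (Y x) * dirDeriv f x v := by
  rw [← dirDeriv_mul hf (hg.smooth.diffAt_apply hX hY)]
  congr 1; ext y
  change g y (f y • X y) (Y y) = _
  rw [map_smul]; rfl

lemma dirDeriv_smul_right (hf : MDifferentiableAt (𝓡 d) 𝓘(ℝ, ℝ) f x) (hX : DiffVFieldAt X x)
    (hY : DiffVFieldAt Y x) (v : TangentSpace (𝓡 d) x) :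
    dirDeriv (fun y ↦ g y (X y) ((f • Y) y)) x v
      = f x * dirDeriv (fun y ↦ g y (X y) (Y y)) x v + g x (X x) (Y x) * dirDeriv f x v := by
  rw [← dirDeriv_mul hf (hg.smooth.diffAt_apply hX hY)]
  congr 1; ext y
  change g y (X y) (f y • Y y) = _
  rw [map_smul]; rfl

lemma dirDeriv_add_left (hX : DiffVFieldAt X x) (hX' : DiffVFieldAt X' x)
    (hY : DiffVFieldAt Y x) (v : TangentSpace (𝓡 d) x) :
    dirDeriv (fun y ↦ g y ((X + X') y) (Y y)) x v
      = dirDeriv (fun y ↦ g y (X y) (Y y)) x v + dirDeriv (fun y ↦ g y (X' y) (Y y)) x v := by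
  rw [← dirDeriv_add (hg.smooth.diffAt_apply hX hY) (hg.smooth.diffAt_apply hX' hY)]
  congr 1; ext y
  change g y (X y + X' y) (Y y) = _
  rw [map_add]; rfl

lemma dirDeriv_add_right (hX : DiffVFieldAt X x) (hY : DiffVFieldAt Y x)
    (hY' : DiffVFieldAt Y' x) (v : TangentSpace (𝓡 d) x) :
    dirDeriv (fun y ↦ g y (X y) ((Y + Y') y)) x v
      = dirDeriv (fun y ↦ g y (X y) (Y y)) x v + dirDeriv (fun y ↦ g y (X y) (Y' y)) x v := by
  rw [← dirDeriv_add (hg.smooth.diffAt_apply hX hY) (hg.smooth.diffAt_apply hX hY')]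
  congr 1; ext y
  change g y (X y) (Y y + Y' y) = _
  rw [map_add]

lemma dirDeriv_comm (X Y : VField d M) (v : TangentSpace (𝓡 d) x) :
    dirDeriv (fun y ↦ g y (X y) (Y y)) x v = dirDeriv (fun y ↦ g y (Y y) (X y)) x v := by
  congr 1; ext y; rw [hg.symm]

lemma mlieBracket_smul_left_apply (hf : MDifferentiableAt (𝓡 d) 𝓘(ℝ, ℝ) f x)
    (hX : DiffVFieldAt X x) (W : VField d M) :
    g x (VectorField.mlieBracket (𝓡 d) (f • X) W x)
      = - (dirDeriv f x (W x)) • g x (X x) + f x • g x (VectorField.mlieBracket (𝓡 d) X W x) := by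
  rw [VectorField.mlieBracket_smul_left hf hX, map_add, map_smul, map_smul]; rfl

/-- The derivatives of `f` from the metric terms cancel those from the brackets. With
`koszul_smul_right` this makes the Koszul expression tensorial in `X` and `Z`. -/
lemma koszul_smul_left (hf : MDifferentiableAt (𝓡 d) 𝓘(ℝ, ℝ) f x) (hX : DiffVFieldAt X x)
    (hY : DiffVFieldAt Y x) (hZ : DiffVFieldAt Z x) :
    koszul g (f • X) Y Z x = f x * koszul g X Y Z x := by
  have h1 : dirDeriv (fun y ↦ g y (Y y) (Z y)) x ((f • X) x)
      = f x * dirDeriv (fun y ↦ g y (Y y) (Z y)) x (X x) := by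
    rw [dirDeriv, Pi.smul_apply', map_smul]; rfl
  rw [koszul, koszul, h1, hg.dirDeriv_smul_left hf hX hZ, hg.dirDeriv_smul_left hf hX hY,
    hg.mlieBracket_smul_left_apply hf hX, hg.mlieBracket_smul_left_apply hf hX, Pi.smul_apply', map_smul]
  simp only [add_apply, _root_.smul_apply, smul_eq_mul]
  ring

lemma mlieBracket_smul_right_apply (hf : MDifferentiableAt (𝓡 d) 𝓘(ℝ, ℝ) f x)
    (hX : DiffVFieldAt X x) (W : VField d M) :
    g x (VectorField.mlieBracket (𝓡 d) W (f • X) x)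
      = dirDeriv f x (W x) • g x (X x) + f x • g x (VectorField.mlieBracket (𝓡 d) W X x) := by
  rw [VectorField.mlieBracket_smul_right hf hX, map_add, map_smul, map_smul]; rfl

lemma koszul_smul_right (hf : MDifferentiableAt (𝓡 d) 𝓘(ℝ, ℝ) f x) (hX : DiffVFieldAt X x)
    (hY : DiffVFieldAt Y x) (hZ : DiffVFieldAt Z x) :
    koszul g X Y (f • Z) x = f x * koszul g X Y Z x := by
  have h1 : dirDeriv (fun y ↦ g y (X y) (Y y)) x ((f • Z) x)
      = f x * dirDeriv (fun y ↦ g y (X y) (Y y)) x (Z x) := by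
    rw [dirDeriv, Pi.smul_apply', map_smul]; rfl
  rw [koszul, koszul, h1, hg.dirDeriv_smul_right hf hY hZ, hg.dirDeriv_smul_right hf hX hZ,
    hg.mlieBracket_smul_right_apply hf hZ, hg.mlieBracket_smul_right_apply hf hZ,
    Pi.smul_apply', map_smul]
  simp only [add_apply, _root_.smul_apply, smul_eq_mul]
  rw [hg.symm x (Z x) (Y x), hg.symm x (Z x) (X x)]
  ring

/-- In the middle slot the terms in `Z f` cancel while those in `X f` add up, leaving the Leibniz
term of a connection. -/
lemma koszul_smul_middle (hf : MDifferentiableAt (𝓡 d) 𝓘(ℝ, ℝ) f x) (hX : DiffVFieldAt X x)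
    (hY : DiffVFieldAt Y x) (hZ : DiffVFieldAt Z x) :
    koszul g X (f • Y) Z x = f x * koszul g X Y Z x + dirDeriv f x (X x) * g x (Y x) (Z x) := by
  have h1 : dirDeriv (fun y ↦ g y (X y) (Z y)) x ((f • Y) x)
      = f x * dirDeriv (fun y ↦ g y (X y) (Z y)) x (Y x) := by
    rw [dirDeriv, Pi.smul_apply', map_smul]; rfl
  rw [koszul, koszul, h1, hg.dirDeriv_smul_left hf hY hZ, hg.dirDeriv_smul_right hf hX hY,
    hg.mlieBracket_smul_right_apply hf hY, hg.mlieBracket_smul_left_apply hf hY,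
    Pi.smul_apply', map_smul]
  simp only [add_apply, _root_.smul_apply, smul_eq_mul]
  rw [hg.symm x (Y x) (X x)]
  ring

lemma koszul_add_left (hX : DiffVFieldAt X x) (hX' : DiffVFieldAt X' x)
    (hY : DiffVFieldAt Y x) (hZ : DiffVFieldAt Z x) :
    koszul g (X + X') Y Z x = koszul g X Y Z x + koszul g X' Y Z x := by
  have h1 : dirDeriv (fun y ↦ g y (Y y) (Z y)) x ((X + X') x)
      = dirDeriv (fun y ↦ g y (Y y) (Z y)) x (X x)
        + dirDeriv (fun y ↦ g y (Y y) (Z y)) x (X' x) := by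
    rw [dirDeriv, Pi.add_apply, map_add]; rfl
  rw [koszul, koszul, koszul, h1, hg.dirDeriv_add_left hX hX' hZ, hg.dirDeriv_add_left hX hX' hY,
    VectorField.mlieBracket_add_left hX hX', VectorField.mlieBracket_add_left hX hX',
    Pi.add_apply, map_add, map_add, map_add]
  simp only [add_apply]
  ring

lemma koszul_add_right (hX : DiffVFieldAt X x) (hY : DiffVFieldAt Y x)
    (hZ : DiffVFieldAt Z x) (hZ' : DiffVFieldAt Z' x) :
    koszul g X Y (Z + Z') x = koszul g X Y Z x + koszul g X Y Z' x := by
  have h1 : dirDeriv (fun y ↦ g y (X y) (Y y)) x ((Z + Z') x)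
      = dirDeriv (fun y ↦ g y (X y) (Y y)) x (Z x)
        + dirDeriv (fun y ↦ g y (X y) (Y y)) x (Z' x) := by
    rw [dirDeriv, Pi.add_apply, map_add]; rfl
  rw [koszul, koszul, koszul, h1, hg.dirDeriv_add_right hY hZ hZ', hg.dirDeriv_add_right hX hZ hZ',
    VectorField.mlieBracket_add_right hZ hZ', VectorField.mlieBracket_add_right hZ hZ',
    Pi.add_apply, map_add, map_add, map_add]
  simp only [add_apply]
  ring

lemma koszul_add_middle (hX : DiffVFieldAt X x) (hY : DiffVFieldAt Y x)
    (hY' : DiffVFieldAt Y' x) (hZ : DiffVFieldAt Z x) :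
    koszul g X (Y + Y') Z x = koszul g X Y Z x + koszul g X Y' Z x := by
  have h1 : dirDeriv (fun y ↦ g y (X y) (Z y)) x ((Y + Y') x)
      = dirDeriv (fun y ↦ g y (X y) (Z y)) x (Y x)
        + dirDeriv (fun y ↦ g y (X y) (Z y)) x (Y' x) := by
    rw [dirDeriv, Pi.add_apply, map_add]; rfl
  rw [koszul, koszul, koszul, h1, hg.dirDeriv_add_left hY hY' hZ, hg.dirDeriv_add_right hX hY hY',
    VectorField.mlieBracket_add_left hY hY', VectorField.mlieBracket_add_right hY hY',
    Pi.add_apply, map_add, map_add, map_add]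
  simp only [add_apply]
  ring

lemma koszul_torsion (X Y Z : VField d M) (x : M) :
    koszul g X Y Z x - koszul g Y X Z x = g x (VectorField.mlieBracket (𝓡 d) X Y x) (Z x) := by
  rw [koszul, koszul, hg.dirDeriv_comm Y X,
    VectorField.mlieBracket_swap_apply (V := Y) (W := X), map_neg]
  simp only [neg_apply]
  ring

lemma koszul_metric (X Y Z : VField d M) (x : M) :
    koszul g X Y Z x + koszul g X Z Y x = dirDeriv (fun y ↦ g y (Y y) (Z y)) x (X x) := by
  rw [koszul, koszul, hg.dirDeriv_comm Z Y,
    VectorField.mlieBracket_swap_apply (V := Z) (W := Y), map_neg]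
  simp only [neg_apply]
  ring

lemma eq_of_apply_eq {v w : TangentSpace (𝓡 d) x} (h : ∀ z, g x v z = g x w z) : v = w := by
  refine sub_eq_zero.1 (hg.nondegenerate x _ fun z ↦ ?_)
  rw [map_sub]
  exact sub_eq_zero.2 (h z)

lemma eq_of_apply_field_eq {v w : TangentSpace (𝓡 d) x}
    (h : ∀ Z : VField d M, SmoothVFieldNear Z x → g x v (Z x) = g x w (Z x)) : v = w := by
  refine hg.eq_of_apply_eq fun z ↦ ?_
  obtain ⟨c, rfl⟩ := exists_constField_eq z
  exact h _ (smoothVFieldNear_constField x c)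

/-- The operator defined by the Koszul formula. -/
theorem exists_koszul : ∃ A : CovOp d M, ∀ (X Y Z : VField d M) (x : M), DiffVFieldAt X x →
    DiffVFieldAt Y x → DiffVFieldAt Z x → g x (A Y x (X x)) (Z x) = koszul g X Y Z x := by
  classical
  have key : ∀ (Y : VField d M) (x : M), ∃ B : TangentSpace (𝓡 d) x →L[ℝ] TangentSpace (𝓡 d) x,
      ∀ X Z, DiffVFieldAt X x → DiffVFieldAt Y x → DiffVFieldAt Z x →
        g x (B (X x)) (Z x) = koszul g X Y Z x := by
    intro Y x
    by_cases hY : DiffVFieldAt Y x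
    · have h₁ : ∀ Z : VField d M, DiffVFieldAt Z x →
          TensorialAt (𝓡 d) (Euc d) (fun X : VField d M ↦ koszul g X Y Z x) x := fun Z hZ ↦
        { smul := fun hf hX ↦ hg.koszul_smul_left hf hX hY hZ
          add := fun hX hX' ↦ hg.koszul_add_left hX hX' hY hZ }
      have h₂ : ∀ X : VField d M, DiffVFieldAt X x →
          TensorialAt (𝓡 d) (Euc d) (fun Z : VField d M ↦ koszul g X Y Z x) x := fun X hX ↦
        { smul := fun hf hZ ↦ hg.koszul_smul_right hf hX hY hZ
          add := fun hZ hZ' ↦ hg.koszul_add_right hX hY hZ hZ' }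
      -- Tensoriality gives a bilinear form on the tangent space at `x`; raising its second index
      -- with `g` gives the endomorphism `X ↦ ∇_X Y`.
      set K := TensorialAt.mkHom₂ (fun X Z : VField d M ↦ koszul g X Y Z x) x h₁ h₂ with hK
      obtain ⟨T, hT⟩ := isInvertible_of_nondegenerate (B := g x) (hg.nondegenerate x)
      have hT' : ∀ L : Euc d →L[ℝ] ℝ, (g x : Euc d →L[ℝ] Euc d →L[ℝ] ℝ) (T.symm L) = L := by
        intro L
        rw [← hT]
        exact T.apply_symm_apply L
      refine ⟨(T.symm : (Euc d →L[ℝ] ℝ) →L[ℝ] Euc d).comp (K : Euc d →L[ℝ] Euc d →L[ℝ] ℝ),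
        fun X Z hX _ hZ ↦ ?_⟩
      rw [← TensorialAt.mkHom₂_apply (Φ := fun X Z : VField d M ↦ koszul g X Y Z x) h₁ h₂ hX hZ]
      exact congrArg (fun L : Euc d →L[ℝ] ℝ ↦ L (Z x))
        (hT' ((K : Euc d →L[ℝ] Euc d →L[ℝ] ℝ) (X x)))
    -- A field `Y` not differentiable at `x` gets the default derivative zero.
    · exact ⟨0, fun X Z _ h _ ↦ absurd h hY⟩
  choose A hA using key
  exact ⟨A, fun X Y Z x hX hY hZ ↦ hA Y x X Z hX hY hZ⟩

/-- The Levi-Civita connection exists. -/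
theorem exists_leviCivita : ∃ cov : CovariantDerivative (𝓡 d) (Euc d)
    (fun x : M ↦ TangentSpace (𝓡 d) x), ∀ (X Y Z : VField d M) (x : M), DiffVFieldAt X x →
    DiffVFieldAt Y x → DiffVFieldAt Z x → g x (cov Y x (X x)) (Z x) = koszul g X Y Z x := by
  obtain ⟨A, hA⟩ := hg.exists_koszul
  have hext : ∀ {x : M} {L L' : TangentSpace (𝓡 d) x →L[ℝ] TangentSpace (𝓡 d) x},
      (∀ X Z : VField d M, DiffVFieldAt X x → DiffVFieldAt Z x →
        g x (L (X x)) (Z x) = g x (L' (X x)) (Z x)) → L = L' := by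
    intro x L L' h
    ext1 v
    obtain ⟨c, rfl⟩ := exists_constField_eq v
    have hc := (smoothVFieldNear_constField x c).self.diff
    exact hg.eq_of_apply_field_eq fun Z hZ ↦ h _ _ hc hZ.self.diff
  refine ⟨⟨A, ?_, ?_⟩, hA⟩
  · intro Y Y' x hY hY' _
    refine hext fun X Z hX hZ ↦ ?_
    have hYY : DiffVFieldAt (Y + Y') x := mdifferentiableAt_add_section hY hY'
    rw [hA X _ Z x hX hYY hZ, hg.koszul_add_middle hX hY hY' hZ, ← hA X _ Z x hX hY hZ,
      ← hA X _ Z x hX hY' hZ, ← add_apply, ← map_add]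
    rfl
  · intro Y f x hY hf _
    refine hext fun X Z hX hZ ↦ ?_
    have hfY : DiffVFieldAt (f • Y) x := hf.smul_section hY
    rw [hA X _ Z x hX hfY hZ, hg.koszul_smul_middle hf hX hY hZ, ← hA X _ Z x hX hY hZ]
    change _ = g x (f x • A Y x (X x) + dirDeriv f x (X x) • Y x) (Z x)
    rw [map_add, map_smul, map_smul]
    rfl

end IsPseudoMetric

end Koszul

/-! ### The Lie bracket as a commutator of derivations -/

section Bracket

variable {d : ℕ} {M : Type*} [TopologicalSpace M] [ChartedSpace (Euc d) M]
  [IsManifold (𝓡 d) ∞ M] {X Y : VField d M} {u h : M → ℝ} {x : M}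

/-- The coordinate expression of a vector field in the chart at `x`. -/
def coordField (x : M) (X : VField d M) : Euc d → Euc d :=
  VectorField.mpullbackWithin 𝓘(ℝ, Euc d) (𝓡 d) (extChartAt (𝓡 d) x).symm X (range (𝓡 d))

lemma DiffVFieldAt.differentiableAt_coordField (hX : DiffVFieldAt X x) :
    DifferentiableAt ℝ (coordField x X) (extChartAt (𝓡 d) x x) := by
  have h := MDifferentiableWithinAt.differentiableWithinAt_mpullbackWithin_vectorField
    (s := univ) (mdifferentiableWithinAt_univ.2 hX)
  rw [preimage_univ, univ_inter, ModelWithCorners.range_eq_univ] at h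
  have h' := h.differentiableAt Filter.univ_mem
  rw [← ModelWithCorners.range_eq_univ (𝓡 d)] at h'
  exact h'

lemma fderiv_comp_symm_coordField {z : Euc d} (hz : z ∈ (extChartAt (𝓡 d) x).target) {y : M}
    (hy : (extChartAt (𝓡 d) x).symm z = y) (hh : MDifferentiableAt (𝓡 d) 𝓘(ℝ, ℝ) h y)
    (X : VField d M) :
    fderiv ℝ (h ∘ (extChartAt (𝓡 d) x).symm) z (coordField x X z) = dirDeriv h y (X y) := by
  subst hy
  have h1 : HasMFDerivAt 𝓘(ℝ, Euc d) (𝓡 d) (extChartAt (𝓡 d) x).symm z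
      (mfderivWithin 𝓘(ℝ, Euc d) (𝓡 d) (extChartAt (𝓡 d) x).symm (range (𝓡 d)) z) := by
    have := (mdifferentiableWithinAt_extChartAt_symm (I := 𝓡 d) hz).hasMFDerivWithinAt
    rw [ModelWithCorners.range_eq_univ] at this
    rw [ModelWithCorners.range_eq_univ]
    exact hasMFDerivWithinAt_univ.1 this
  have h2 : ∀ v, fderiv ℝ (h ∘ (extChartAt (𝓡 d) x).symm) z v =
      mfderiv (𝓡 d) 𝓘(ℝ, ℝ) h ((extChartAt (𝓡 d) x).symm z)
        (mfderivWithin 𝓘(ℝ, Euc d) (𝓡 d) (extChartAt (𝓡 d) x).symm (range (𝓡 d)) z v) := by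
    intro v
    rw [← mfderiv_eq_fderiv, (hh.hasMFDerivAt.comp z h1).mfderiv]
    rfl
  refine (h2 _).trans ?_
  obtain ⟨T, hT⟩ := isInvertible_mfderivWithin_extChartAt_symm (I := 𝓡 d) hz
  have h3 : mfderivWithin 𝓘(ℝ, Euc d) (𝓡 d) (extChartAt (𝓡 d) x).symm (range (𝓡 d)) z
      (coordField x X z) = X ((extChartAt (𝓡 d) x).symm z) := by
    rw [coordField, VectorField.mpullbackWithin_apply, ← hT, ContinuousLinearMap.inverse_equiv]
    exact T.apply_symm_apply _
  exact congrArg (mfderiv (𝓡 d) 𝓘(ℝ, ℝ) h ((extChartAt (𝓡 d) x).symm z)) h3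

/-- The manifold bracket is the chart bracket carried back by the inverse differential of the chart,
which cancels against the chart differential inside `du`. -/
lemma dirDeriv_mlieBracket_eq_fderiv (hu : MDifferentiableAt (𝓡 d) 𝓘(ℝ, ℝ) u x)
    (X Y : VField d M) :
    dirDeriv u x (VectorField.mlieBracket (𝓡 d) X Y x) =
      fderiv ℝ (u ∘ (extChartAt (𝓡 d) x).symm) (extChartAt (𝓡 d) x x)
        (VectorField.lieBracket ℝ (coordField x X) (coordField x Y) (extChartAt (𝓡 d) x x)) := by
  set χ := extChartAt (𝓡 d) x with hχ
  have hx : x ∈ χ.source := mem_extChartAt_source x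
  have hz : χ x ∈ χ.target := mem_extChartAt_target x
  have h1 : HasMFDerivAt (𝓡 d) 𝓘(ℝ, Euc d) χ x (mfderiv (𝓡 d) 𝓘(ℝ, Euc d) χ x) :=
    (mdifferentiableAt_extChartAt (mem_chart_source _ x)).hasMFDerivAt
  have h2 : HasMFDerivAt 𝓘(ℝ, Euc d) (𝓡 d) χ.symm (χ x)
      (mfderivWithin 𝓘(ℝ, Euc d) (𝓡 d) χ.symm (range (𝓡 d)) (χ x)) := by
    have := (mdifferentiableWithinAt_extChartAt_symm (I := 𝓡 d) hz).hasMFDerivWithinAt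
    rw [ModelWithCorners.range_eq_univ] at this
    rw [ModelWithCorners.range_eq_univ]
    exact hasMFDerivWithinAt_univ.1 this
  have hinv : χ.symm (χ x) = x := χ.left_inv hx
  have hu' : MDifferentiableAt 𝓘(ℝ, Euc d) 𝓘(ℝ, ℝ) (u ∘ χ.symm) (χ x) :=
    MDifferentiableAt.comp (χ x) (by rw [hinv]; exact hu) h2.mdifferentiableAt
  have h3 : HasMFDerivAt (𝓡 d) 𝓘(ℝ, ℝ) u x
      ((mfderiv 𝓘(ℝ, Euc d) 𝓘(ℝ, ℝ) (u ∘ χ.symm) (χ x)).comp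
        (mfderiv (𝓡 d) 𝓘(ℝ, Euc d) χ x)) := by
    refine (hu'.hasMFDerivAt.comp x h1).congr_of_eventuallyEq ?_
    filter_upwards [extChartAt_source_mem_nhds (I := 𝓡 d) x] with y hy
    exact congrArg u (χ.left_inv hy).symm
  obtain ⟨T, hT⟩ := isInvertible_mfderiv_extChartAt (I := 𝓡 d) hx
  have hwithin : ∀ (V W : Euc d → Euc d) (z : Euc d),
      VectorField.lieBracketWithin ℝ V W (range (𝓡 d)) z = VectorField.lieBracket ℝ V W z := by
    intro V W z
    rw [ModelWithCorners.range_eq_univ, VectorField.lieBracketWithin_univ]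
  have h4 : VectorField.mlieBracket (𝓡 d) X Y x = T.symm
      (VectorField.lieBracket ℝ (coordField x X) (coordField x Y) (χ x)) := by
    rw [← VectorField.mlieBracketWithin_univ, VectorField.mlieBracketWithin_apply, ← hχ, ← hT,
      ContinuousLinearMap.inverse_equiv, preimage_univ, univ_inter]
    exact congrArg T.symm (hwithin _ _ _)
  have h5 : ∀ w, dirDeriv u x (T.symm w) = fderiv ℝ (u ∘ χ.symm) (χ x) w := by
    intro w
    change mfderiv (𝓡 d) 𝓘(ℝ, ℝ) u x (T.symm w) = _
    rw [h3.mfderiv, ← hT, ← mfderiv_eq_fderiv]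
    change mfderiv 𝓘(ℝ, Euc d) 𝓘(ℝ, ℝ) (u ∘ χ.symm) (χ x) (T (T.symm w)) = _
    rw [T.apply_symm_apply]
    rfl
  rw [h4]
  exact h5 _

/-- `[X, Y] u = X (Y u) - Y (X u)`. -/
theorem dirDeriv_mlieBracket (hu : ∀ᶠ y in 𝓝 x, ContMDiffAt (𝓡 d) 𝓘(ℝ, ℝ) ∞ u y)
    (hX : DiffVFieldAt X x) (hY : DiffVFieldAt Y x)
    (hXu : MDifferentiableAt (𝓡 d) 𝓘(ℝ, ℝ) (fun y ↦ dirDeriv u y (X y)) x)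
    (hYu : MDifferentiableAt (𝓡 d) 𝓘(ℝ, ℝ) (fun y ↦ dirDeriv u y (Y y)) x) :
    dirDeriv u x (VectorField.mlieBracket (𝓡 d) X Y x) =
      dirDeriv (fun y ↦ dirDeriv u y (Y y)) x (X x)
        - dirDeriv (fun y ↦ dirDeriv u y (X y)) x (Y x) := by
  set χ := extChartAt (𝓡 d) x with hχ
  have hz : χ x ∈ χ.target := mem_extChartAt_target x
  have hinv : χ.symm (χ x) = x := χ.left_inv (mem_extChartAt_source x)
  have htarget : χ.target ∈ 𝓝 (χ x) := extChartAt_target_mem_nhds (I := 𝓡 d) x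
  have hc : ContinuousAt χ.symm (χ x) := continuousAt_extChartAt_symm x
  set u' := u ∘ χ.symm with hu'
  have husmooth : ContDiffAt ℝ ∞ u' (χ x) := by
    have h1 : ContMDiffAt 𝓘(ℝ, Euc d) (𝓡 d) ∞ χ.symm (χ x) := by
      have := contMDiffWithinAt_extChartAt_symm_range (I := 𝓡 d) (n := ∞) x hz
      rw [ModelWithCorners.range_eq_univ] at this
      exact contMDiffWithinAt_univ.1 this
    have h2 : ContMDiffAt (𝓡 d) 𝓘(ℝ, ℝ) ∞ u (χ.symm (χ x)) := by
      rw [hinv]; exact hu.self_of_nhds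
    exact (h2.comp (χ x) h1).contDiffAt
  -- The second derivatives of `u` cancel in the commutator by symmetry, leaving the bracket of the
  -- coordinate fields.
  have hsymm : IsSymmSndFDerivAt ℝ u' (χ x) :=
    husmooth.isSymmSndFDerivAt (by rw [minSmoothness_of_isRCLikeNormedField]; exact WithTop.coe_le_coe.2 le_top)
  have hdu' : DifferentiableAt ℝ (fderiv ℝ u') (χ x) :=
    (husmooth.fderiv_right (m := 1) (WithTop.coe_le_coe.2 le_top)).differentiableAt one_ne_zero
  have key : ∀ {X Y : VField d M}, DiffVFieldAt Y x →
      MDifferentiableAt (𝓡 d) 𝓘(ℝ, ℝ) (fun y ↦ dirDeriv u y (Y y)) x →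
      dirDeriv (fun y ↦ dirDeriv u y (Y y)) x (X x) =
        fderiv ℝ (fderiv ℝ u') (χ x) (coordField x X (χ x)) (coordField x Y (χ x))
          + fderiv ℝ u' (χ x) (fderiv ℝ (coordField x Y) (χ x) (coordField x X (χ x))) := by
    intro X Y hY hYu
    rw [← fderiv_comp_symm_coordField hz hinv hYu]
    have h1 : (fun y ↦ dirDeriv u y (Y y)) ∘ χ.symm
        =ᶠ[𝓝 (χ x)] fun z ↦ fderiv ℝ u' z (coordField x Y z) := by
      filter_upwards [htarget, hc.eventually_of_eq hinv hu] with z hz1 hz2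
      exact (fderiv_comp_symm_coordField hz1 rfl (hz2.mdifferentiableAt (by simp)) Y).symm
    rw [h1.fderiv_eq, fderiv_clm_apply hdu' hY.differentiableAt_coordField]
    simp [add_comm]
  rw [key hY hYu, key hX hXu, dirDeriv_mlieBracket_eq_fderiv (hu.self_of_nhds.mdifferentiableAt (by simp)),
    VectorField.lieBracket, map_sub, hsymm.eq]
  ring

end Bracket

/-! ### Properties of an operator satisfying the Koszul formula -/

section LeviCivita

variable {d : ℕ} {M : Type*} [TopologicalSpace M] [ChartedSpace (Euc d) M]
  [IsManifold (𝓡 d) ∞ M] {g : TwoTensor d M} {A : CovOp d M} {X Y Z : VField d M} {x : M}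

/-- The operator `A` satisfies the Koszul formula for `g`. -/
def SatisfiesKoszul (A : CovOp d M) (g : TwoTensor d M) : Prop :=
  ∀ (X Y Z : VField d M) (x : M), DiffVFieldAt X x → DiffVFieldAt Y x → DiffVFieldAt Z x →
    g x (A Y x (X x)) (Z x) = koszul g X Y Z x

namespace SatisfiesKoszul

variable (hA : SatisfiesKoszul A g) (hg : IsPseudoMetric g)
include hA hg

lemma torsion_free (hX : DiffVFieldAt X x) (hY : DiffVFieldAt Y x) :
    A Y x (X x) - A X x (Y x) = VectorField.mlieBracket (𝓡 d) X Y x := by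
  refine hg.eq_of_apply_field_eq fun Z hZ ↦ ?_
  rw [map_sub, sub_apply, hA X Y Z x hX hY hZ.self.diff, hA Y X Z x hY hX hZ.self.diff,
    hg.koszul_torsion]

lemma metric (v : TangentSpace (𝓡 d) x) (hY : DiffVFieldAt Y x) (hZ : DiffVFieldAt Z x) :
    dirDeriv (fun y ↦ g y (Y y) (Z y)) x v = g x (A Y x v) (Z x) + g x (Y x) (A Z x v) := by
  obtain ⟨c, rfl⟩ := exists_constField_eq v
  have hX := (smoothVFieldNear_constField x c).self.diff
  rw [← hg.koszul_metric, hA _ Y Z x hX hY hZ, hg.symm x (Y x), hA _ Z Y x hX hZ hY]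

/-- The Koszul formula expresses the inner products of `∇_X Y` with locally constant fields by
smooth functions, and nondegeneracy recovers the field from these. -/
lemma smoothVFieldNear (hX : SmoothVFieldNear X x) (hY : SmoothVFieldNear Y x) :
    SmoothVFieldNear (fun y ↦ A Y y (X y)) x := by
  have key : ∀ {x}, SmoothVFieldNear X x → SmoothVFieldNear Y x →
      SmoothVFieldAt (fun y ↦ A Y y (X y)) x := by
    intro x hX hY
    refine smoothVFieldAt_of_apply hg.smooth hg.nondegenerate fun c ↦ ?_
    have hZ := smoothVFieldNear_constField (M := M) x c
    set Z := constField (M := M) x c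
    have hs : ∀ {X Y : VField d M}, SmoothVFieldNear X x → SmoothVFieldNear Y x →
        ∀ᶠ y in 𝓝 x, ContMDiffAt (𝓡 d) 𝓘(ℝ, ℝ) ∞ (fun y ↦ g y (X y) (Y y)) y := by
      intro X Y hX hY
      filter_upwards [hX, hY] with y h1 h2 using hg.smooth.smoothAt_apply h1 h2
    have hK : ContMDiffAt (𝓡 d) 𝓘(ℝ, ℝ) ∞ (fun y ↦ koszul g X Y Z y) x := by
      refine contMDiffAt_const.mul (((((?_ : ContMDiffAt _ _ _ _ _).add ?_).sub ?_).add ?_).sub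
        ?_ |>.sub ?_)
      · exact (hX.smoothAt_dirDeriv (hs hY hZ)).self_of_nhds
      · exact (hY.smoothAt_dirDeriv (hs hX hZ)).self_of_nhds
      · exact (hZ.smoothAt_dirDeriv (hs hX hY)).self_of_nhds
      · exact hg.smooth.smoothAt_apply (hX.mlieBracket hY).self hZ.self
      · exact hg.smooth.smoothAt_apply (hX.mlieBracket hZ).self hY.self
      · exact hg.smooth.smoothAt_apply (hY.mlieBracket hZ).self hX.self
    refine hK.congr_of_eventuallyEq ?_
    filter_upwards [hX, hY, hZ] with y h1 h2 h3 using hA X Y Z y h1.diff h2.diff h3.diff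
  filter_upwards [hX.eventually, hY.eventually] with y h1 h2 using key h1 h2

end SatisfiesKoszul

lemma SatisfiesKoszul.isLeviCivita {cov : CovariantDerivative (𝓡 d) (Euc d)
    (fun x : M ↦ TangentSpace (𝓡 d) x)} (hA : SatisfiesKoszul cov g) (hg : IsPseudoMetric g) :
    IsLeviCivita cov g where
  torsion_free _ _ hX hY x := hA.torsion_free hg (hX.diffAt x) (hY.diffAt x)
  metric _ _ _ _ hY hZ x := hA.metric hg _ (hY.diffAt x) (hZ.diffAt x)

end LeviCivita

/-! ### Extending vector fields off the hypersurface -/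

section Extension

variable {m : ℕ} {M : Type*} [TopologicalSpace M] [ChartedSpace (Euc (m + 1)) M]
  [IsManifold (𝓡 (m + 1)) ∞ M]
  {N : Type*} [TopologicalSpace N] [ChartedSpace (Euc m) N] [IsManifold (𝓡 m) ∞ N]
  {φ : N → M} {p : N} {Y Y₂ : VField m N} {Z Z₂ : VField (m + 1) M}

/-- Near `p`, the vector field `Z` extends the image of `Y` under the differential of `φ`. -/
structure IsExtension (φ : N → M) (Y : VField m N) (Z : VField (m + 1) M) (p : N) : Prop where
  diff : DiffVFieldAt Z (φ p)
  eq_dmap : ∀ᶠ q in 𝓝 p, Z (φ q) = dmap φ q (Y q)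

lemma IsExtension.apply_eq (h : IsExtension φ Y Z p) : Z (φ p) = dmap φ p (Y p) :=
  h.eq_dmap.self_of_nhds

lemma IsExtension.add (h : IsExtension φ Y Z p) (h₂ : IsExtension φ Y₂ Z₂ p) :
    IsExtension φ (Y + Y₂) (Z + Z₂) p where
  diff := mdifferentiableAt_add_section h.diff h₂.diff
  eq_dmap := by
    filter_upwards [h.eq_dmap, h₂.eq_dmap] with q h1 h2
    rw [Pi.add_apply, Pi.add_apply, h1, h2, map_add]

lemma IsExtension.smul {r : M → N} (h : IsExtension φ Y Z p) (hr : IsLocalRetraction m φ r p)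
    {f : N → ℝ} (hf : MDifferentiableAt (𝓡 m) 𝓘(ℝ, ℝ) f p) :
    IsExtension φ (f • Y) ((f ∘ r) • Z) p where
  diff := by
    have h1 : MDifferentiableAt (𝓡 (m + 1)) 𝓘(ℝ, ℝ) (f ∘ r) (φ p) :=
      MDifferentiableAt.comp (φ p) (by rw [hr.left_inv.self_of_nhds]; exact hf)
        (hr.smooth.self_of_nhds.mdifferentiableAt (by simp))
    exact h1.smul_section h.diff
  eq_dmap := by
    filter_upwards [h.eq_dmap, hr.left_inv] with q h1 h2
    rw [Pi.smul_apply', Pi.smul_apply', h1, map_smul, Function.comp_apply, h2]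

/-- The vector field obtained from `Y` by transport along the fibres of `r`, in the trivialization
at `φ p`. -/
def extendField (φ : N → M) (r : M → N) (p : N) (Y : VField m N) : VField (m + 1) M := fun y ↦
  (trivializationAt (Euc (m + 1)) (TangentSpace (𝓡 (m + 1))) (φ p)).symmL ℝ y
    (trivializationAt (Euc (m + 1)) (TangentSpace (𝓡 (m + 1))) (φ p)
      ⟨φ (r y), dmap φ (r y) (Y (r y))⟩).2

section

variable {r : M → N}

lemma extendField_eventuallyEq (hφ : ContMDiff (𝓡 m) (𝓡 (m + 1)) ∞ φ)
    (hr : IsLocalRetraction m φ r p) (Y : VField m N) :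
    ∀ᶠ q in 𝓝 p, extendField φ r p Y (φ q) = dmap φ q (Y q) := by
  set e := trivializationAt (Euc (m + 1)) (TangentSpace (𝓡 (m + 1))) (φ p) with he
  filter_upwards [hr.left_inv, (hφ.continuous.tendsto p).eventually (e.open_baseSet.mem_nhds
    (FiberBundle.mem_baseSet_trivializationAt' (φ p)))] with q h1 h2
  rw [extendField, h1, ← Bundle.Trivialization.continuousLinearMapAt_apply_of_mem ℝ e h2]
  exact Bundle.Trivialization.symmL_continuousLinearMapAt _ h2 _

lemma snd_extendField {y : M}
    (hy : y ∈ (trivializationAt (Euc (m + 1)) (TangentSpace (𝓡 (m + 1))) (φ p)).baseSet) :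
    (trivializationAt (Euc (m + 1)) (TangentSpace (𝓡 (m + 1))) (φ p)
      ⟨y, extendField φ r p Y y⟩).2 =
    (trivializationAt (Euc (m + 1)) (TangentSpace (𝓡 (m + 1))) (φ p)
      ⟨φ (r y), dmap φ (r y) (Y (r y))⟩).2 := by
  have h := Bundle.Trivialization.continuousLinearMapAt_symmL (R := ℝ)
    (trivializationAt (Euc (m + 1)) (TangentSpace (𝓡 (m + 1))) (φ p)) hy
    (trivializationAt (Euc (m + 1)) (TangentSpace (𝓡 (m + 1))) (φ p)
      ⟨φ (r y), dmap φ (r y) (Y (r y))⟩).2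
  rw [Bundle.Trivialization.continuousLinearMapAt_apply_of_mem ℝ _ hy] at h
  exact h

lemma smoothVFieldNear_extendField (hφ : ContMDiff (𝓡 m) (𝓡 (m + 1)) ∞ φ)
    (hr : IsLocalRetraction m φ r p) (hY : SmoothVFieldNear Y p) :
    SmoothVFieldNear (extendField φ r p Y) (φ p) := by
  set e := trivializationAt (Euc (m + 1)) (TangentSpace (𝓡 (m + 1))) (φ p) with he
  have hb : e.baseSet ∈ 𝓝 (φ p) :=
    e.open_baseSet.mem_nhds (FiberBundle.mem_baseSet_trivializationAt' (φ p))
  have hrc : ContinuousAt r (φ p) := hr.smooth.self_of_nhds.continuousAt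
  have hrp : r (φ p) = p := hr.left_inv.self_of_nhds
  have hb' : ∀ᶠ q in 𝓝 p, φ q ∈ e.baseSet := (hφ.continuous.tendsto p).eventually hb
  filter_upwards [hr.smooth, hrc.eventually_of_eq hrp hY, hb, hrc.eventually_of_eq hrp hb']
    with y h1 h2 h3 h4
  rw [SmoothVFieldAt, Bundle.Trivialization.contMDiffAt_section_iff e h3]
  have h5 : ContMDiffAt (𝓡 m) (𝓡 (m + 1)).tangent ∞
      (fun q ↦ (⟨φ q, dmap φ q (Y q)⟩ : TangentBundle (𝓡 (m + 1)) M)) (r y) :=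
    contMDiffAt_mfderiv_apply (f := fun q : N ↦ q) h2 (.of_forall fun q ↦ hφ.contMDiffAt)
  have h6 := (Bundle.Trivialization.contMDiffAt_iff (e := e) (e.mem_source.2 h4)).1 h5
  refine (h6.2.comp y h1).congr_of_eventuallyEq ?_
  filter_upwards [e.open_baseSet.mem_nhds h3] with z hz using snd_extendField hz

/-- The axioms of a covariant derivative on `N` concern fields that are merely differentiable at a
point, so the smooth version is not enough. -/
lemma diffVFieldAt_extendField (hφ : ContMDiff (𝓡 m) (𝓡 (m + 1)) ∞ φ)
    (hr : IsLocalRetraction m φ r p) (hY : DiffVFieldAt Y p) :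
    DiffVFieldAt (extendField φ r p Y) (φ p) := by
  set e := trivializationAt (Euc (m + 1)) (TangentSpace (𝓡 (m + 1))) (φ p) with he
  have hb : φ p ∈ e.baseSet := FiberBundle.mem_baseSet_trivializationAt' (φ p)
  have hrp : r (φ p) = p := hr.left_inv.self_of_nhds
  rw [DiffVFieldAt, Bundle.Trivialization.mdifferentiableAt_section_iff _ e _ hb]
  have h5 : MDifferentiableAt (𝓡 m) (𝓡 (m + 1)).tangent
      (fun q ↦ (⟨φ q, dmap φ q (Y q)⟩ : TangentBundle (𝓡 (m + 1)) M)) p := by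
    have h1 : MDifferentiableAt (𝓡 m).tangent (𝓡 (m + 1)).tangent
        (tangentMap (𝓡 m) (𝓡 (m + 1)) φ) (⟨p, Y p⟩ : TangentBundle (𝓡 m) N) :=
      (hφ.contMDiff_tangentMap (m := ∞) (by simp)).mdifferentiable (by simp) _
    exact MDifferentiableAt.comp p h1 hY
  have h6 := ((Bundle.Trivialization.mdifferentiableAt_totalSpace_iff _ e _
    (e.mem_source.2 hb)).1 h5).2
  have h7 : MDifferentiableAt (𝓡 (m + 1)) 𝓘(ℝ, Euc (m + 1))
      ((fun q ↦ (e ⟨φ q, dmap φ q (Y q)⟩).2) ∘ r) (φ p) :=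
    MDifferentiableAt.comp (φ p) (by rw [hrp]; exact h6)
      (hr.smooth.self_of_nhds.mdifferentiableAt (by simp))
  refine h7.congr_of_eventuallyEq ?_
  filter_upwards [e.open_baseSet.mem_nhds hb] with z hz using snd_extendField hz

end

lemma exists_isExtension (hφ : Manifold.IsSmoothEmbedding (𝓡 m) (𝓡 (m + 1)) ∞ φ)
    (hY : DiffVFieldAt Y p) : ∃ Z, IsExtension φ Y Z p := by
  obtain ⟨r, hr⟩ := exists_isLocalRetraction hφ p
  exact ⟨extendField φ r p Y, diffVFieldAt_extendField hφ.contMDiff hr hY,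
    extendField_eventuallyEq hφ.contMDiff hr Y⟩

lemma exists_smooth_isExtension (hφ : Manifold.IsSmoothEmbedding (𝓡 m) (𝓡 (m + 1)) ∞ φ)
    (hY : SmoothVFieldNear Y p) :
    ∃ Z, SmoothVFieldNear Z (φ p) ∧ ∀ᶠ q in 𝓝 p, IsExtension φ Y Z q := by
  obtain ⟨r, hr⟩ := exists_isLocalRetraction hφ p
  have h1 := smoothVFieldNear_extendField hφ.contMDiff hr hY
  refine ⟨extendField φ r p Y, h1, ?_⟩
  filter_upwards [(hφ.contMDiff.continuous.tendsto p).eventually h1,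
    (extendField_eventuallyEq hφ.contMDiff hr Y).eventually_nhds] with q h2 h3
  exact ⟨h2.diff, h3⟩

end Extension

/-! ### Vanishing Lie derivative makes the hypersurface totally geodesic -/

section TotallyGeodesic

variable {m : ℕ} {M : Type*} [TopologicalSpace M] [ChartedSpace (Euc (m + 1)) M]
  [IsManifold (𝓡 (m + 1)) ∞ M]
  {N : Type*} [TopologicalSpace N] [ChartedSpace (Euc m) N] [IsManifold (𝓡 m) ∞ N]
  {φ : N → M} {p : N} {Y : VField m N} {Z Z₂ : VField (m + 1) M}
  {g : TwoTensor (m + 1) M} {A : CovOp (m + 1) M}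

lemma dirDeriv_dmap_congr (hφ : ContMDiff (𝓡 m) (𝓡 (m + 1)) ∞ φ) {h k : M → ℝ}
    (hh : MDifferentiableAt (𝓡 (m + 1)) 𝓘(ℝ, ℝ) h (φ p))
    (hk : MDifferentiableAt (𝓡 (m + 1)) 𝓘(ℝ, ℝ) k (φ p))
    (heq : ∀ᶠ q in 𝓝 p, h (φ q) = k (φ q)) (v : TangentSpace (𝓡 m) p) :
    dirDeriv h (φ p) (dmap φ p v) = dirDeriv k (φ p) (dmap φ p v) := by
  rw [← dirDeriv_comp_dmap hφ hh, ← dirDeriv_comp_dmap hφ hk]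
  have : (fun q ↦ h (φ q)) =ᶠ[𝓝 p] fun q ↦ k (φ q) := heq
  exact congrArg (fun L : Euc m →L[ℝ] ℝ ↦ L v) this.mfderiv_eq

/-- The derivative of a vector field along the hypersurface depends only on its values there. -/
lemma SatisfiesKoszul.apply_dmap_congr (hA : SatisfiesKoszul A g) (hg : IsPseudoMetric g)
    (hφ : ContMDiff (𝓡 m) (𝓡 (m + 1)) ∞ φ) (hZ : DiffVFieldAt Z (φ p))
    (hZ₂ : DiffVFieldAt Z₂ (φ p)) (heq : ∀ᶠ q in 𝓝 p, Z (φ q) = Z₂ (φ q))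
    (v : TangentSpace (𝓡 m) p) : A Z (φ p) (dmap φ p v) = A Z₂ (φ p) (dmap φ p v) := by
  refine hg.eq_of_apply_field_eq fun T hT ↦ ?_
  have h1 := hA.metric hg (dmap φ p v) hZ hT.self.diff
  have h2 := hA.metric hg (dmap φ p v) hZ₂ hT.self.diff
  have h3 := dirDeriv_dmap_congr hφ (hg.smooth.diffAt_apply hZ hT.self.diff)
    (hg.smooth.diffAt_apply hZ₂ hT.self.diff) (heq.mono fun q hq ↦ by rw [hq]) v
  rw [h1, h2, heq.self_of_nhds] at h3
  exact add_right_cancel h3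

/-- Derivatives of tangent vector fields in tangent directions are tangent. -/
def TotallyGeodesicOn (φ : N → M) (A : CovOp (m + 1) M) (V : Set N) : Prop :=
  ∀ p ∈ V, ∀ (Y : VField m N) (Z : VField (m + 1) M), IsExtension φ Y Z p →
    ∀ v, ∃ w, dmap φ p w = A Z (φ p) (dmap φ p v)

/-- Torsion-freeness rewrites the brackets as derivatives, and metricity cancels the terms in which
`X` and `Y` are differentiated along `ν`. -/
lemma SatisfiesKoszul.lieDeriv_eq {d : ℕ} {M : Type*} [TopologicalSpace M]
    [ChartedSpace (Euc d) M] [IsManifold (𝓡 d) ∞ M] {g : TwoTensor d M} {A : CovOp d M}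
    {ν X Y : VField d M} {x : M} (hA : SatisfiesKoszul A g) (hg : IsPseudoMetric g)
    (hν : DiffVFieldAt ν x) (hX : DiffVFieldAt X x) (hY : DiffVFieldAt Y x) :
    lieDeriv g ν X Y x = g x (A ν x (X x)) (Y x) + g x (A ν x (Y x)) (X x) := by
  rw [lieDeriv, ← hA.torsion_free hg hν hX, ← hA.torsion_free hg hν hY, hA.metric hg _ hX hY,
    map_sub, map_sub, sub_apply, hg.symm x (A ν x (Y x))]
  ring

/-- A field which is `g`-dual to a multiple of a differential has symmetric derivative on the
kernel of that differential. -/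
lemma SatisfiesKoszul.symm_of_gradient {d : ℕ} {M : Type*} [TopologicalSpace M]
    [ChartedSpace (Euc d) M] [IsManifold (𝓡 d) ∞ M] {g : TwoTensor d M} {A : CovOp d M}
    {ν X Y : VField d M} {x : M} (hA : SatisfiesKoszul A g) (hg : IsPseudoMetric g)
    (hν : DiffVFieldAt ν x) (hX : SmoothVField X) (hY : SmoothVField Y) {u Ω : M → ℝ}
    (hu : ContMDiff (𝓡 d) 𝓘(ℝ, ℝ) ∞ u) (hΩ : ContMDiff (𝓡 d) 𝓘(ℝ, ℝ) ∞ Ω)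
    (hνu : ∀ x v, g x (ν x) v = Ω x * dirDeriv u x v)
    (hXu : dirDeriv u x (X x) = 0) (hYu : dirDeriv u x (Y x) = 0) :
    g x (A ν x (X x)) (Y x) = g x (A ν x (Y x)) (X x) := by
  have hd : ∀ {Z : VField d M}, SmoothVField Z →
      MDifferentiableAt (𝓡 d) 𝓘(ℝ, ℝ) (fun y ↦ dirDeriv u y (Z y)) x := fun hZ ↦
    ((hZ.near x).smoothAt_dirDeriv (.of_forall hu)).self_of_nhds.mdifferentiableAt (by simp)
  have hΩd : MDifferentiableAt (𝓡 d) 𝓘(ℝ, ℝ) Ω x := hΩ.mdifferentiable (by simp) x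
  -- Differentiates `g(ν, Y) = Ω Y(u)` along `X`; the term with `X(Ω)` drops out because `Y(u) = 0`
  -- at `x`. What remains is the Hessian of `u`, symmetric by torsion-freeness.
  have key : ∀ {X Y : VField d M}, SmoothVField Y → dirDeriv u x (Y x) = 0 →
      Ω x * dirDeriv (fun y ↦ dirDeriv u y (Y y)) x (X x)
        = g x (A ν x (X x)) (Y x) + Ω x * dirDeriv u x (A Y x (X x)) := by
    intro X Y hY hYu
    have h1 := hA.metric hg (X x) hν (hY.diffAt x)
    have h2 : (fun y ↦ g y (ν y) (Y y)) = fun y ↦ Ω y * dirDeriv u y (Y y) := by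
      ext y; rw [hνu]
    rw [h2, dirDeriv_mul hΩd (hd hY), hYu, hνu] at h1
    linarith
  have h1 := key (X := X) hY hYu
  have h2 := key (X := Y) hX hXu
  have h3 := dirDeriv_mlieBracket (.of_forall hu) (hX.diffAt x) (hY.diffAt x) (hd hX) (hd hY)
  rw [← hA.torsion_free hg (hX.diffAt x) (hY.diffAt x)] at h3
  have h4 : dirDeriv u x (A Y x (X x) - A X x (Y x))
      = dirDeriv u x (A Y x (X x)) - dirDeriv u x (A X x (Y x)) := map_sub (mvfderiv (𝓡 d) u x) _ _
  rw [h4] at h3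
  linear_combination h2 - h1 - Ω x * h3

/-- The geometric core: on tangent vectors `g(∇_X ν, Y)` is symmetric, being built from a multiple
of `du`, and its symmetric part vanishes with the Lie derivative. -/
theorem totallyGeodesicOn_of_lieDeriv [T2Space M] [SigmaCompactSpace M]
    (hA : SatisfiesKoszul A g) (hg : IsPseudoMetric g)
    (hφ : Manifold.IsSmoothEmbedding (𝓡 m) (𝓡 (m + 1)) ∞ φ) {u Ω : M → ℝ}
    (hu : ContMDiff (𝓡 (m + 1)) 𝓘(ℝ, ℝ) ∞ u) (huφ : ∀ q, u (φ q) = 0)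
    (hdu : ∀ q, mvfderiv (𝓡 (m + 1)) u (φ q) ≠ 0)
    (hΩ : ContMDiff (𝓡 (m + 1)) 𝓘(ℝ, ℝ) ∞ Ω) (hΩ0 : ∀ x, Ω x ≠ 0) {ν : VField (m + 1) M}
    (hν : SmoothVField ν) (hνu : ∀ x v, g x (ν x) v = Ω x * dirDeriv u x v) {V : Set N}
    (hLie : PullbackLieEqOn φ g ν 0 V) : TotallyGeodesicOn φ A V := by
  intro p hp Y Z hYZ v
  have hker : ∀ (q : N) (w : TangentSpace (𝓡 m) q), dirDeriv u (φ q) (dmap φ q w) = 0 := by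
    intro q w
    rw [← dirDeriv_comp_dmap hφ.contMDiff (hu.mdifferentiable (by simp) _)]
    have : (fun q ↦ u (φ q)) = fun _ ↦ 0 := funext huφ
    rw [this, dirDeriv_const]
  have hB : g (φ p) (A ν (φ p) (dmap φ p v)) (dmap φ p (Y p)) = 0 := by
    obtain ⟨X₁, hX₁, hX₁v⟩ := exists_smoothVField_eq (φ p) (dmap φ p v)
    obtain ⟨Y₁, hY₁, hY₁v⟩ := exists_smoothVField_eq (φ p) (dmap φ p (Y p))
    have h1 := hLie p hp v (Y p) X₁ Y₁ hX₁ hY₁ hX₁v hY₁v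
    rw [Pi.zero_apply, zero_mul, hA.lieDeriv_eq hg (hν.diffAt _) (hX₁.diffAt _) (hY₁.diffAt _),
      hA.symm_of_gradient hg (hν.diffAt _) hX₁ hY₁ hu hΩ hνu (by rw [hX₁v, hker])
        (by rw [hY₁v, hker])] at h1
    have h2 := hA.symm_of_gradient hg (hν.diffAt _) hX₁ hY₁ hu hΩ hνu (by rw [hX₁v, hker])
        (by rw [hY₁v, hker])
    rw [← hX₁v, ← hY₁v, h2]
    linarith
  -- Tangency means being killed by `du`, equivalently orthogonal to `ν`. This comes from
  -- differentiating `g(Z, ν)`, which is zero along the hypersurface, in a tangent direction.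
  refine exists_dmap_eq hφ hu huφ (hdu p) ?_
  have h1 := hA.metric hg (dmap φ p v) hYZ.diff (hν.diffAt (φ p))
  have h2 : dirDeriv (fun y ↦ g y (Z y) (ν y)) (φ p) (dmap φ p v)
      = dirDeriv (fun _ ↦ (0 : ℝ)) (φ p) (dmap φ p v) := by
    refine dirDeriv_dmap_congr hφ.contMDiff (hg.smooth.diffAt_apply hYZ.diff (hν.diffAt (φ p)))
      mdifferentiableAt_const ?_ v
    filter_upwards [hYZ.eq_dmap] with q hq
    rw [hg.symm, hνu, hq, hker, mul_zero]
  rw [h2, dirDeriv_const, hYZ.apply_eq, hg.symm _ (dmap φ p (Y p)), hB, add_zero, hg.symm,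
    hνu] at h1
  exact (mul_eq_zero.1 h1.symm).resolve_left (hΩ0 _)

end TotallyGeodesic

/-! ### The induced connection: existence, smoothness, uniqueness -/

section Induced

variable {m : ℕ} {M : Type*} [TopologicalSpace M] [ChartedSpace (Euc (m + 1)) M]
  [IsManifold (𝓡 (m + 1)) ∞ M]
  {N : Type*} [TopologicalSpace N] [ChartedSpace (Euc m) N] [IsManifold (𝓡 m) ∞ N]
  {φ : N → M} {p : N} {V : Set N} {g : TwoTensor (m + 1) M} {A : CovOp (m + 1) M}
  {D : CovOp m N}

/-- The operator `D` on the hypersurface is the restriction of the operator `A`. -/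
def IsInducedOn (φ : N → M) (A : CovOp (m + 1) M) (D : CovOp m N) (V : Set N) : Prop :=
  ∀ p ∈ V, ∀ (Y : VField m N) (Z : VField (m + 1) M), DiffVFieldAt Y p → IsExtension φ Y Z p →
    ∀ v, dmap φ p (D Y p v) = A Z (φ p) (dmap φ p v)

/-- The derivative of any extension `Z` is tangent and independent of the extension, so the
differential of a local retraction brings it back to `N` without loss. -/
lemma TotallyGeodesicOn.exists_isInducedOn (hV : TotallyGeodesicOn φ A V)
    (hφ : Manifold.IsSmoothEmbedding (𝓡 m) (𝓡 (m + 1)) ∞ φ) (hA : SatisfiesKoszul A g)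
    (hg : IsPseudoMetric g) : ∃ D, IsInducedOn φ A D V := by
  have key : ∀ (Y : VField m N) (p : N), ∃ L : TangentSpace (𝓡 m) p →L[ℝ] TangentSpace (𝓡 m) p,
      p ∈ V → DiffVFieldAt Y p → ∀ Z : VField (m + 1) M, IsExtension φ Y Z p →
        ∀ v, dmap φ p (L v) = A Z (φ p) (dmap φ p v) := by
    intro Y p
    by_cases hY : DiffVFieldAt Y p
    · obtain ⟨Z, hZ⟩ := exists_isExtension hφ hY
      obtain ⟨r, hr⟩ := exists_isLocalRetraction hφ p
      refine ⟨ContinuousLinearMap.comp (M₁ := Euc m) (M₂ := Euc (m + 1)) (M₃ := Euc m)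
        (mfderiv (𝓡 (m + 1)) (𝓡 m) r (φ p)) ((A Z (φ p)).comp (dmap φ p)), fun hp _ Z₂ hZ₂ v ↦ ?_⟩
      have h1 : A Z (φ p) (dmap φ p v) = A Z₂ (φ p) (dmap φ p v) := by
        refine hA.apply_dmap_congr hg hφ.contMDiff hZ.diff hZ₂.diff ?_ v
        filter_upwards [hZ.eq_dmap, hZ₂.eq_dmap] with q h1 h2
        rw [h1, h2]
      obtain ⟨w, hw⟩ := hV p hp Y Z hZ v
      have h2 : (mfderiv (𝓡 (m + 1)) (𝓡 m) r (φ p) (A Z (φ p) (dmap φ p v)) : Euc m) = w := by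
        rw [← hw]
        exact hr.mfderiv_dmap hφ.contMDiff w
      rw [← h1, ← hw]
      exact congrArg (fun w : Euc m ↦ dmap φ p w) h2
    · exact ⟨0, fun _ h ↦ absurd h hY⟩
  choose D hD using key
  exact ⟨D, fun p hp Y Z hY hZ v ↦ hD Y p hp hY Z hZ v⟩

/-- The axioms are checked in `M` after applying the injective differential of `φ`; a function `f`
on `N` is extended as `f ∘ r`. -/
lemma IsInducedOn.isCovariantDerivativeOn
    {cov : CovariantDerivative (𝓡 (m + 1)) (Euc (m + 1))
      (fun x : M ↦ TangentSpace (𝓡 (m + 1)) x)} (hD : IsInducedOn φ cov D V)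
    (hφ : Manifold.IsSmoothEmbedding (𝓡 m) (𝓡 (m + 1)) ∞ φ) :
    IsCovariantDerivativeOn (Euc m) D V where
  add {Y Y₂ p} hY hY₂ hp := by
    obtain ⟨Z, hZ⟩ := exists_isExtension hφ hY
    obtain ⟨Z₂, hZ₂⟩ := exists_isExtension hφ hY₂
    ext1 v
    refine dmap_injective hφ p ?_
    rw [hD p hp _ _ (mdifferentiableAt_add_section hY hY₂) (hZ.add hZ₂) v,
      cov.isCovariantDerivativeOn.add hZ.diff hZ₂.diff (mem_univ _), add_apply, add_apply, map_add,
      hD p hp Y Z hY hZ v, hD p hp Y₂ Z₂ hY₂ hZ₂ v]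
  leibniz {Y f p} hY hf hp := by
    obtain ⟨Z, hZ⟩ := exists_isExtension hφ hY
    obtain ⟨r, hr⟩ := exists_isLocalRetraction hφ p
    have hrp : r (φ p) = p := hr.left_inv.self_of_nhds
    have hfr : MDifferentiableAt (𝓡 (m + 1)) 𝓘(ℝ, ℝ) (f ∘ r) (φ p) :=
      MDifferentiableAt.comp (φ p) (by rw [hrp]; exact hf)
        (hr.smooth.self_of_nhds.mdifferentiableAt (by simp))
    ext1 v
    refine dmap_injective hφ p ?_
    rw [hD p hp _ _ (hf.smul_section hY) (hZ.smul hr hf) v,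
      cov.isCovariantDerivativeOn.leibniz hZ.diff hfr (mem_univ _)]
    have h1 : dirDeriv (f ∘ r) (φ p) (dmap φ p v) = dirDeriv f p v := by
      rw [← dirDeriv_comp_dmap hφ.contMDiff hfr]
      have : (fun q ↦ (f ∘ r) (φ q)) =ᶠ[𝓝 p] f := by
        filter_upwards [hr.left_inv] with q hq
        rw [Function.comp_apply, hq]
      exact congrArg (fun L : Euc m →L[ℝ] ℝ ↦ L v) this.mfderiv_eq
    change (f ∘ r) (φ p) • cov Z (φ p) (dmap φ p v)
      + dirDeriv (f ∘ r) (φ p) (dmap φ p v) • Z (φ p)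
        = dmap φ p (f p • D Y p v + dirDeriv f p v • Y p)
    rw [h1, map_add, map_smul, map_smul, hD p hp Y Z hY hZ v, hZ.apply_eq, Function.comp_apply, hrp]

lemma IsInducedOn.contMDiffCovariantDerivativeOn (hD : IsInducedOn φ A D V) (hV : IsOpen V)
    (hφ : Manifold.IsSmoothEmbedding (𝓡 m) (𝓡 (m + 1)) ∞ φ) (hA : SatisfiesKoszul A g)
    (hg : IsPseudoMetric g) : ContMDiffCovariantDerivativeOn (Euc m) ∞ D V where
  contMDiff {Y} hY p hp := by
    have hYV : ∀ q ∈ V, SmoothVFieldAt Y q := fun q hq ↦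
      ((hY q hq).contMDiffAt (hV.mem_nhds hq)).of_le le_self_add
    have hYp : SmoothVFieldNear Y p := by
      filter_upwards [hV.mem_nhds hp] with q hq using hYV q hq
    obtain ⟨Z, hZs, hZ⟩ := exists_smooth_isExtension hφ hYp
    obtain ⟨r, hr⟩ := exists_isLocalRetraction hφ p
    refine (contMDiffAt_endomorphism_of_apply fun X hX ↦ ?_).contMDiffWithinAt
    obtain ⟨T, hTs, hT⟩ := exists_smooth_isExtension hφ hX
    have h1 : ContMDiffAt (𝓡 m) (𝓡 (m + 1)).tangent ∞
        (fun q ↦ (⟨φ q, A Z (φ q) (T (φ q))⟩ : TangentBundle (𝓡 (m + 1)) M)) p :=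
      ContMDiffAt.comp p (hA.smoothVFieldNear hg hTs hZs).self (hφ.contMDiff p)
    have h2 := contMDiffAt_mfderiv_apply (I'' := 𝓡 m) h1 hr.smooth
    refine h2.congr_of_eventuallyEq ?_
    filter_upwards [hr.eventually hφ.contMDiff.continuous.continuousAt, hZ, hT, hV.mem_nhds hp]
      with q hq hZq hTq hqV
    have h3 := hq.mfderiv_dmap hφ.contMDiff (D Y q (X q))
    rw [hD q hqV Y Z (hYV q hqV).diff hZq, ← hTq.apply_eq] at h3
    have h4 := hq.left_inv.self_of_nhds
    have h5 : ∀ q', q' = q →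
        (⟨q, D Y q (X q)⟩ : TangentBundle (𝓡 m) N) = ⟨q', (D Y q (X q) : Euc m)⟩ := by
      rintro _ rfl; rfl
    rw [h3]
    exact h5 _ h4

/-- By the Leibniz rule the expression is tensorial in `Y`. This permits replacing a given `Y` by an
extension of a field on the hypersurface. -/
lemma covOneForm_congr {d : ℕ} {M : Type*} [TopologicalSpace M] [ChartedSpace (Euc d) M]
    [IsManifold (𝓡 d) ∞ M] {A : CovOp d M} {W : OneForm d M} {X X₂ Y Y₂ : VField d M} {x : M}
    (hA : IsCovariantDerivativeOn (Euc d) A) (hW : SmoothOneForm W)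
    (hY : DiffVFieldAt Y x) (hY₂ : DiffVFieldAt Y₂ x) (hX : X x = X₂ x) (hYY : Y x = Y₂ x) :
    covOneForm A W X Y x = covOneForm A W X₂ Y₂ x := by
  have h : TensorialAt (𝓡 d) (Euc d) (fun Y : VField d M ↦ covOneForm A W X₂ Y x) x := by
    constructor
    · intro f Y hf hY
      change dirDeriv (fun y ↦ W y ((f • Y) y)) x (X₂ x) - W x (A (f • Y) x (X₂ x)) =
        f x * (dirDeriv (fun y ↦ W y (Y y)) x (X₂ x) - W x (A Y x (X₂ x)))
      have h1 : (fun y ↦ W y ((f • Y) y)) = fun y ↦ f y * W y (Y y) := by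
        ext y; rw [Pi.smul_apply', map_smul]; rfl
      have h2 : A (f • Y) x (X₂ x) = f x • A Y x (X₂ x) + dirDeriv f x (X₂ x) • Y x := by
        rw [hA.leibniz hY hf]; rfl
      rw [h1, h2, dirDeriv_mul hf (hW.diffAt_apply hY), map_add, map_smul, map_smul, smul_eq_mul,
        smul_eq_mul]
      ring
    · intro Y Y' hY hY'
      change dirDeriv (fun y ↦ W y ((Y + Y') y)) x (X₂ x) - W x (A (Y + Y') x (X₂ x)) =
        (dirDeriv (fun y ↦ W y (Y y)) x (X₂ x) - W x (A Y x (X₂ x))) +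
        (dirDeriv (fun y ↦ W y (Y' y)) x (X₂ x) - W x (A Y' x (X₂ x)))
      have h1 : (fun y ↦ W y ((Y + Y') y)) = fun y ↦ W y (Y y) + W y (Y' y) := by
        ext y; rw [Pi.add_apply, map_add]
      rw [h1, hA.add hY hY', dirDeriv_add (hW.diffAt_apply hY) (hW.diffAt_apply hY'), add_apply,
        map_add]
      ring
  have h1 : covOneForm A W X Y x = covOneForm A W X₂ Y x := by
    rw [covOneForm, covOneForm, hX]
  exact h1.trans (h.pointwise hY hY₂ hYY)

/-- The pullback of `∇ W` is the induced derivative of the pullback of `W`. -/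
lemma IsInducedOn.covOneForm_pullbackForm
    {cov : CovariantDerivative (𝓡 (m + 1)) (Euc (m + 1))
      (fun x : M ↦ TangentSpace (𝓡 (m + 1)) x)} (hD : IsInducedOn φ cov D V)
    (hφ : Manifold.IsSmoothEmbedding (𝓡 m) (𝓡 (m + 1)) ∞ φ) (hp : p ∈ V)
    {W : OneForm (m + 1) M} (hW : SmoothOneForm W) {X' Y' : VField m N} {X Y : VField (m + 1) M}
    (hY' : DiffVFieldAt Y' p) (hY : DiffVFieldAt Y (φ p)) (hXX : X (φ p) = dmap φ p (X' p))
    (hYY : Y (φ p) = dmap φ p (Y' p)) :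
    covOneForm D (pullbackForm φ W) X' Y' p = covOneForm cov W X Y (φ p) := by
  obtain ⟨Z, hZ⟩ := exists_isExtension hφ hY'
  rw [covOneForm_congr (X₂ := X) cov.isCovariantDerivativeOn hW hY hZ.diff rfl
    (hYY.trans hZ.apply_eq.symm), covOneForm, covOneForm, hXX, ← hD p hp Y' Z hY' hZ,
    ← dirDeriv_comp_dmap hφ.contMDiff (hW.diffAt_apply hZ.diff)]
  congr 1
  have : (fun q ↦ pullbackForm φ W q (Y' q)) =ᶠ[𝓝 p] fun q ↦ W (φ q) (Z (φ q)) := by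
    filter_upwards [hZ.eq_dmap] with q hq
    rw [hq]; rfl
  exact congrArg (fun L : Euc m →L[ℝ] ℝ ↦ L (X' p)) this.mfderiv_eq

variable {cov : CovariantDerivative (𝓡 (m + 1)) (Euc (m + 1))
      (fun x : M ↦ TangentSpace (𝓡 (m + 1)) x)}

lemma IsInducedOn.isPullbackOn (hD : IsInducedOn φ cov D V)
    (hφ : Manifold.IsSmoothEmbedding (𝓡 m) (𝓡 (m + 1)) ∞ φ) : IsPullbackOn φ cov D V :=
  fun _ hW p hp _ _ _ _ _ hY' _ hY hXX hYY ↦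
    hD.covOneForm_pullbackForm hφ hp hW (hY'.diffAt p) (hY.diffAt (φ p)) hXX hYY

/-- Both sides are `D` applied to the pulled-back forms, so only these matter; openness of `V` is
what lets their equality on `V` be differentiated. -/
lemma IsInducedOn.pullbackWellDefinedOn (hD : IsInducedOn φ cov D V) (hV : IsOpen V)
    (hφ : Manifold.IsSmoothEmbedding (𝓡 m) (𝓡 (m + 1)) ∞ φ) : PullbackWellDefinedOn φ cov V := by
  intro W W' hW hW' hWW p hp v w X Y _ hY hXv hYw
  obtain ⟨c, rfl⟩ := exists_constField_eq v
  obtain ⟨c', rfl⟩ := exists_constField_eq w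
  have hc := (smoothVFieldNear_constField p c').self.diff
  rw [← hD.covOneForm_pullbackForm hφ hp hW hc (hY.diffAt (φ p)) hXv hYw,
    ← hD.covOneForm_pullbackForm hφ hp hW' hc (hY.diffAt (φ p)) hXv hYw, covOneForm, covOneForm,
    hWW p hp]
  congr 1
  have : (fun q ↦ pullbackForm φ W q (constField p c' q)) =ᶠ[𝓝 p]
      fun q ↦ pullbackForm φ W' q (constField p c' q) := by
    filter_upwards [hV.mem_nhds hp] with q hq
    rw [hWW q hq]
  exact congrArg (fun L : Euc m →L[ℝ] ℝ ↦ L (constField p c p)) this.mfderiv_eq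

/-- For `W = g(T, ·)` the term differentiating `W(Y)` is common to both operators, so `D` and `D'`
have the same inner product with every `T`. -/
lemma IsPullbackOn.eq [T2Space M] [SigmaCompactSpace M] [T2Space N] [SigmaCompactSpace N]
    {D' : CovOp m N} (hD : IsPullbackOn φ A D V) (hD' : IsPullbackOn φ A D' V)
    (hφ : Manifold.IsSmoothEmbedding (𝓡 m) (𝓡 (m + 1)) ∞ φ) (hg : IsPseudoMetric g)
    {Y : VField m N} (hY : SmoothVField Y) (hp : p ∈ V) : D' Y p = D Y p := by
  ext1 v
  refine dmap_injective hφ p ?_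
  obtain ⟨X', hX', rfl⟩ := exists_smoothVField_eq p v
  obtain ⟨X, hX, hXv⟩ := exists_smoothVField_eq (φ p) (dmap φ p (X' p))
  obtain ⟨Z, hZ, hZv⟩ := exists_smoothVField_eq (φ p) (dmap φ p (Y p))
  refine hg.eq_of_apply_eq fun t ↦ ?_
  obtain ⟨T, hT, rfl⟩ := exists_smoothVField_eq (φ p) t
  have hW := hg.smooth.smoothOneForm hT
  have h1 := hD _ hW p hp X' Y X Z hX' hY hX hZ hXv hZv
  rw [← hD' _ hW p hp X' Y X Z hX' hY hX hZ hXv hZv, covOneForm, covOneForm] at h1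
  rw [hg.symm, hg.symm _ (dmap φ p (D Y p (X' p)))]
  exact (sub_right_injective h1).symm

end Induced

/-! ### Conformal rescaling -/

section Conformal

variable {d : ℕ} {M : Type*} [TopologicalSpace M] [ChartedSpace (Euc d) M]
  [IsManifold (𝓡 d) ∞ M] {g : TwoTensor d M} {Ω u h : M → ℝ} {n X Y : VField d M} {x : M}

lemma IsPseudoMetric.rescale (hg : IsPseudoMetric g) (hΩ : ContMDiff (𝓡 d) 𝓘(ℝ, ℝ) ∞ Ω)
    (hΩ0 : ∀ x, Ω x ≠ 0) : IsPseudoMetric (rescale Ω g) where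
  smooth := ContMDiff.smul_section (hΩ.pow 2) hg.smooth
  symm x v w := congrArg (fun t ↦ Ω x ^ 2 * t) (hg.symm x v w)
  nondegenerate x v hv := hg.nondegenerate x v fun w ↦ by
    have h : Ω x ^ 2 * g x v w = 0 := hv w
    exact (mul_eq_zero.1 h).resolve_left (pow_ne_zero 2 (hΩ0 x))

lemma smoothVField_of_isGradient (hg : IsPseudoMetric g) (hu : ContMDiff (𝓡 d) 𝓘(ℝ, ℝ) ∞ u)
    (hn : IsGradient g u n) : SmoothVField n := fun x ↦
  smoothVFieldAt_of_apply hg.smooth hg.nondegenerate fun c ↦ by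
    have h : (fun y ↦ g y (n y) (constField x c y)) = fun y ↦ dirDeriv u y (constField x c y) :=
      funext fun y ↦ hn y _
    rw [h]
    exact ((smoothVFieldNear_constField x c).smoothAt_dirDeriv (.of_forall hu)).self_of_nhds

lemma dirDeriv_exp (hh : MDifferentiableAt (𝓡 d) 𝓘(ℝ, ℝ) h x) (v : TangentSpace (𝓡 d) x) :
    dirDeriv (fun y ↦ Real.exp (h y)) x v = Real.exp (h x) * dirDeriv h x v := by
  have h1 := (Real.hasDerivAt_exp (h x)).hasFDerivAt.hasMFDerivAt.comp x hh.hasMFDerivAt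
  have h2 : mvfderiv (𝓡 d) (fun y ↦ Real.exp (h y)) x v
      = dirDeriv h x v * Real.exp (h x) := congrArg (fun L : Euc d →L[ℝ] ℝ ↦ L v) h1.mfderiv
  rw [mul_comm, ← h2]; rfl

/-- The Lie derivative of `Ω² g` along `Ω⁻¹ n`. -/
lemma lieDeriv_rescale (hg : IsPseudoMetric g) (hΩ : ContMDiff (𝓡 d) 𝓘(ℝ, ℝ) ∞ Ω)
    (hΩ0 : ∀ x, Ω x ≠ 0) (hn : DiffVFieldAt n x) (hX : DiffVFieldAt X x) (hY : DiffVFieldAt Y x)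
    (hnX : g x (n x) (X x) = 0) (hnY : g x (n x) (Y x) = 0) :
    lieDeriv (rescale Ω g) (fun x ↦ (Ω x)⁻¹ • n x) X Y x
      = Ω x * lieDeriv g n X Y x + 2 * dirDeriv Ω x (n x) * g x (X x) (Y x) := by
  have hΩd : MDifferentiableAt (𝓡 d) 𝓘(ℝ, ℝ) Ω x := hΩ.mdifferentiable (by simp) x
  have hΩi : MDifferentiableAt (𝓡 d) 𝓘(ℝ, ℝ) (fun x ↦ (Ω x)⁻¹) x :=
    (hΩ.inv₀ hΩ0).mdifferentiable (by simp) x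
  have hbr : ∀ T : VField d M, g x (VectorField.mlieBracket (𝓡 d) (fun x ↦ (Ω x)⁻¹ • n x) T x)
      = - (dirDeriv (fun x ↦ (Ω x)⁻¹) x (T x)) • g x (n x)
        + (Ω x)⁻¹ • g x (VectorField.mlieBracket (𝓡 d) n T x) := fun T ↦
    hg.mlieBracket_smul_left_apply hΩi hn T
  have hr : ∀ v w, rescale Ω g x v w = Ω x * Ω x * g x v w := fun v w ↦ by
    rw [← pow_two]; rfl
  have hfun : (fun y ↦ rescale Ω g y (X y) (Y y)) = fun y ↦ Ω y * (Ω y * g y (X y) (Y y)) := by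
    ext y
    rw [← mul_assoc, ← pow_two]; rfl
  have hgXY := hg.smooth.diffAt_apply hX hY
  have hlin : ∀ k : M → ℝ, dirDeriv k x ((Ω x)⁻¹ • n x) = (Ω x)⁻¹ * dirDeriv k x (n x) :=
    fun k ↦ map_smul (mvfderiv (𝓡 d) k x) _ _
  rw [lieDeriv, lieDeriv, hr, hr, hbr, hg.symm x (X x), hbr, hfun, hlin,
    dirDeriv_mul (h := fun y ↦ Ω y * g y (X y) (Y y)) hΩd (hΩd.mul hgXY), dirDeriv_mul hΩd hgXY, hg.symm x (X x)]
  -- The derivatives of `Ω⁻¹` multiply `g(n, X)` and `g(n, Y)`, which vanish.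
  simp only [add_apply, _root_.smul_apply, smul_eq_mul, hnX, hnY]
  rw [hg.symm x (VectorField.mlieBracket (𝓡 d) n Y x)]
  field_simp [hΩ0 x]
  ring

end Conformal

/-! ### From a solution of `n(h) = -f/2` to the induced derivative -/

section Main

variable {m : ℕ} {M : Type*} [TopologicalSpace M] [ChartedSpace (Euc (m + 1)) M]
  [IsManifold (𝓡 (m + 1)) ∞ M]
  {N : Type*} [TopologicalSpace N] [ChartedSpace (Euc m) N] [IsManifold (𝓡 m) ∞ N]
  {φ : N → M} {V : Set N} {g : TwoTensor (m + 1) M} {u : M → ℝ} {n : VField (m + 1) M}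
  {f : N → ℝ}

lemma IsLorentzMetric.isPseudoMetric (hg : IsLorentzMetric g) : IsPseudoMetric g where
  smooth := hg.smooth
  symm := hg.symm
  nondegenerate x v hv := by
    obtain ⟨e, he⟩ := hg.signature x
    refine e.ext_elem fun j ↦ ?_
    have h1 := hv (e j)
    rw [← e.sum_repr v, map_sum, sum_apply] at h1
    simp only [map_smul, _root_.smul_apply, he, smul_eq_mul, mul_ite, mul_zero] at h1
    rw [Finset.sum_ite_eq' Finset.univ j] at h1
    rw [map_zero]
    by_cases hj : j = 0 <;> simpa [hj] using h1

/-- With `Ω = exp h` the rescaled Lie derivative pulls back to `Ω (f + 2 n(h)) q`, which the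
equation for `h` makes zero on `V`. -/
theorem conformalPullbackOn_of_dirDeriv [T2Space M] [SigmaCompactSpace M] [T2Space N]
    [SigmaCompactSpace N] (hg : IsPseudoMetric g)
    (hu : ContMDiff (𝓡 (m + 1)) 𝓘(ℝ, ℝ) ∞ u) (hn : IsGradient g u n)
    (hφ : Manifold.IsSmoothEmbedding (𝓡 m) (𝓡 (m + 1)) ∞ φ) (huφ : ∀ q, u (φ q) = 0)
    (hdu : ∀ q, mvfderiv (𝓡 (m + 1)) u (φ q) ≠ 0)
    (hLie : PullbackLieEqOn φ g n f Set.univ) (hV : IsOpen V) {h : M → ℝ}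
    (hh : ContMDiff (𝓡 (m + 1)) 𝓘(ℝ, ℝ) ∞ h)
    (hnh : ∀ p ∈ V, dirDeriv h (φ p) (n (φ p)) = - (f p / 2)) :
    ConformalPullbackOn φ g n V := by
  set Ω : M → ℝ := fun x ↦ Real.exp (h x) with hΩdef
  have hΩ : ContMDiff (𝓡 (m + 1)) 𝓘(ℝ, ℝ) ∞ Ω := Real.contDiff_exp.contMDiff.comp hh
  have hΩpos : ∀ x, 0 < Ω x := fun x ↦ Real.exp_pos _
  have hΩ0 : ∀ x, Ω x ≠ 0 := fun x ↦ (hΩpos x).ne'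
  have hns := smoothVField_of_isGradient hg hu hn
  have hker : ∀ (q : N) (w : TangentSpace (𝓡 m) q), dirDeriv u (φ q) (dmap φ q w) = 0 := by
    intro q w
    rw [← dirDeriv_comp_dmap hφ.contMDiff (hu.mdifferentiable (by simp) _)]
    have : (fun q ↦ u (φ q)) = fun _ ↦ 0 := funext huφ
    rw [this, dirDeriv_const]
  have hLie' : PullbackLieEqOn φ (rescale Ω g) (fun x ↦ (Ω x)⁻¹ • n x) 0 V := by
    intro p hp v w X Y hX hY hXv hYw
    rw [lieDeriv_rescale hg hΩ hΩ0 (hns.diffAt _) (hX.diffAt _) (hY.diffAt _)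
      (by rw [hn, hXv, hker]) (by rw [hn, hYw, hker]), hLie p (mem_univ p) v w X Y hX hY hXv hYw,
      hΩdef, dirDeriv_exp (hh.mdifferentiable (by simp) _), hnh p hp, hXv, hYw, Pi.zero_apply,
      pullbackTensor]
    ring
  have hν : SmoothVField (fun x ↦ (Ω x)⁻¹ • n x) := (hΩ.inv₀ hΩ0).smul_section hns
  have hνu : ∀ x v, rescale Ω g x ((Ω x)⁻¹ • n x) v = Ω x * dirDeriv u x v := by
    intro x v
    rw [map_smul, ← hn]
    change (Ω x)⁻¹ * (Ω x ^ 2 * g x (n x) v) = _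
    field_simp [hΩ0 x]
  have hgΩ := hg.rescale hΩ hΩ0
  obtain ⟨cov, hcov⟩ := hgΩ.exists_leviCivita
  have hA : SatisfiesKoszul cov (rescale Ω g) := hcov
  have htg := totallyGeodesicOn_of_lieDeriv hA hgΩ hφ hu huφ hdu hΩ hΩ0 hν hνu hLie'
  obtain ⟨D, hD⟩ := htg.exists_isInducedOn hφ hA hgΩ
  refine ⟨Ω, hΩ, hΩpos, hLie', cov, hA.isLeviCivita hgΩ, hD.pullbackWellDefinedOn hV hφ, D,
    hD.isCovariantDerivativeOn hφ, hD.contMDiffCovariantDerivativeOn hV hφ hA hgΩ,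
    hD.isPullbackOn hφ, fun D' _ hD' Y hY p hp ↦ ?_⟩
  exact (hD.isPullbackOn hφ).eq hD' hφ hgΩ hY hp

/-- A non-zero tangent vector is transverse to a level set of some function. -/
lemma exists_dirDeriv_ne_zero (p : N) {v : TangentSpace (𝓡 m) p} (hv : v ≠ 0) :
    ∃ s : N → ℝ, (∀ᶠ y in 𝓝 p, ContMDiffAt (𝓡 m) 𝓘(ℝ, ℝ) ∞ s y) ∧ s p = 0 ∧
      dirDeriv s p v ≠ 0 := by
  set χ := extChartAt (𝓡 m) p with hχ
  obtain ⟨T, hT⟩ := isInvertible_mfderiv_extChartAt (I := 𝓡 m) (mem_extChartAt_source p)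
  set w : Euc m := mfderiv (𝓡 m) 𝓘(ℝ, Euc m) χ p v with hw
  have hw0 : w ≠ 0 := by
    intro h0
    have h1 : (T v : Euc m) = w := congrArg (fun L : Euc m →L[ℝ] Euc m ↦ L v) hT
    exact hv (T.map_eq_zero_iff.1 (h1.trans h0))
  have hχs : ∀ᶠ y in 𝓝 p, ContMDiffAt (𝓡 m) 𝓘(ℝ, Euc m) ∞ χ y := by
    filter_upwards [chart_source_mem_nhds (Euc m) p] with y hy
      using contMDiffAt_extChartAt' hy
  -- The affine function with gradient `w`, the coordinate expression of `v`; its derivative along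
  -- `v` is `|w|²`.
  set l : Euc m → ℝ := fun z ↦ inner ℝ w (z - χ p) with hl
  have hls : ContDiff ℝ ∞ l := contDiff_const.inner ℝ (contDiff_id.sub contDiff_const)
  refine ⟨fun y ↦ l (χ y), ?_, by simp [hl], ?_⟩
  · filter_upwards [hχs] with y hy using hls.contMDiff.contMDiffAt.comp y hy
  have h1 : HasFDerivAt l (innerSL ℝ w) (χ p) :=
    (innerSL ℝ w).hasFDerivAt.comp (χ p) ((hasFDerivAt_id (χ p)).sub_const (χ p))
  have h2 := h1.hasMFDerivAt.comp p
    (hχs.self_of_nhds.mdifferentiableAt (by simp)).hasMFDerivAt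
  have h3 : dirDeriv (fun y ↦ l (χ y)) p v = inner ℝ w w :=
    congrArg (fun L : Euc m →L[ℝ] ℝ ↦ L v) h2.mfderiv
  rw [h3]
  exact inner_self_ne_zero.2 hw0

end Main

end NullPullback

end

open NullPullback
theorem theorem3 {m : ℕ}
    {M : Type*} [TopologicalSpace M] [T2Space M] [SecondCountableTopology M]
    [ChartedSpace (Euc (m + 1)) M] [IsManifold (𝓡 (m + 1)) ∞ M]
    {N : Type*} [TopologicalSpace N] [ChartedSpace (Euc m) N] [IsManifold (𝓡 m) ∞ N]
    (g : TwoTensor (m + 1) M) (hg : IsLorentzMetric g)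
    (u : M → ℝ) (hu : ContMDiff (𝓡 (m + 1)) 𝓘(ℝ, ℝ) ∞ u)
    (n : VField (m + 1) M) (hn : IsGradient g u n)
    (φ : N → M) (hφ : Manifold.IsSmoothEmbedding (𝓡 m) (𝓡 (m + 1)) ∞ φ)
    (hrange : Set.range φ = {x | u x = 0})
    (hdu : ∀ x, u x = 0 → mvfderiv (𝓡 (m + 1)) u x ≠ 0)
    (hnull : ∀ x, u x = 0 → g x (n x) (n x) = 0)
    (f : N → ℝ) (hf : ContMDiff (𝓡 m) 𝓘(ℝ, ℝ) ∞ f)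
    (hLie : PullbackLieEqOn φ g n f Set.univ) :
    (∀ p : N, ∃ V : Set N, IsOpen V ∧ p ∈ V ∧ ConformalPullbackOn φ g n V) ∧
    (HasCrossSection u n → ConformalPullbackOn φ g n Set.univ) := by
  have hgp := hg.isPseudoMetric
  have : LocallyCompactSpace M := Manifold.locallyCompact_of_finiteDimensional (𝓡 (m + 1))
  have : LocallyCompactSpace N := Manifold.locallyCompact_of_finiteDimensional (𝓡 m)
  have : T2Space N := hφ.isEmbedding.t2Space
  have : SecondCountableTopology N := hφ.isEmbedding.secondCountableTopology
  have hcl : IsClosed (Set.range φ) := by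
    rw [hrange]
    exact isClosed_eq hu.continuous continuous_const
  have huφ : ∀ q, u (φ q) = 0 := fun q ↦ by
    have h : φ q ∈ Set.range φ := Set.mem_range_self q
    rwa [hrange] at h
  have hduφ : ∀ q, mvfderiv (𝓡 (m + 1)) u (φ q) ≠ 0 := fun q ↦ hdu _ (huφ q)
  have hns := smoothVField_of_isGradient hgp hu hn
  -- Nullity enters here: `g(n, n) = 0` reads `du(n) = 0`, so `n` is tangent and restricts to a
  -- field `X` on the hypersurface.
  obtain ⟨X, hX, hXn⟩ := exists_smooth_lift hφ hns fun p ↦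
    exists_dmap_eq hφ hu huφ (hduφ p) (w := n (φ p)) (by rw [← hn]; exact hnull _ (huφ p))
  have hF : ContMDiff (𝓡 m) 𝓘(ℝ, ℝ) ∞ (fun p ↦ - (f p / 2)) := by
    have h : ContDiff ℝ ∞ (fun t : ℝ ↦ - (t / 2)) := by fun_prop
    exact h.contMDiff.comp hf
  -- A solution on the hypersurface extends to `M` because the hypersurface is closed. Only its
  -- derivative along the tangent vector `n` matters, so any extension works.
  have main : ∀ (V : Set N) (h : N → ℝ), IsOpen V → ContMDiff (𝓡 m) 𝓘(ℝ, ℝ) ∞ h →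
      (∀ p ∈ V, dirDeriv h p (X p) = - (f p / 2)) → ConformalPullbackOn φ g n V := by
    intro V h hV hh hXh
    obtain ⟨h', hh', hhφ⟩ := exists_smooth_extension hφ hcl hh
    refine conformalPullbackOn_of_dirDeriv hgp hu hn hφ huφ hduφ hLie hV hh' fun p hp ↦ ?_
    rw [← hXn p, ← dirDeriv_comp_dmap hφ.contMDiff (hh'.mdifferentiable (by simp) _), ← hXh p hp]
    exact congrArg (fun k ↦ dirDeriv k p (X p)) (funext hhφ)
  refine ⟨fun p ↦ ?_, ?_⟩
  -- If `n` vanished at `φ p`, so would its dual form `du`.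
  · have hXp : X p ≠ 0 := by
      intro h0
      refine hduφ p (ContinuousLinearMap.ext fun v ↦ ?_)
      have h1 : dirDeriv u (φ p) v = 0 := by
        rw [← hn, ← hXn p, h0, map_zero, map_zero]; rfl
      exact h1
    obtain ⟨s, hs, hsp, hsX⟩ := exists_dirDeriv_ne_zero p hXp
    obtain ⟨h, hh⟩ := exists_local_solution hX hF hs hsp hsX
    -- The local solution is replaced by a globally smooth function with the same germ at `p`; `V`
    -- is a neighbourhood on which the equation still holds.
    obtain ⟨h', hh', heq⟩ := exists_contMDiff_eventuallyEq (I := 𝓡 m) (hh.mono fun _ h ↦ h.1)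
    have hV : ∀ᶠ q in nhds p, dirDeriv h' q (X q) = - (f q / 2) := by
      filter_upwards [hh, heq.eventuallyEq_nhds] with q h1 h2
      rw [← h1.2]
      exact congrArg (fun L : Euc m →L[ℝ] ℝ ↦ L (X q)) h2.mfderiv_eq
    obtain ⟨V, hV, hVo, hpV⟩ := eventually_nhds_iff.1 hV
    exact ⟨V, hVo, hpV, main V h' hVo hh' hV⟩
  · rintro ⟨s, hs, hpos, hjoin⟩
    have hsφ : ContMDiff (𝓡 m) 𝓘(ℝ, ℝ) ∞ (fun q ↦ s (φ q)) := hs.comp hφ.contMDiff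
    obtain ⟨h, hh, hXh⟩ := exists_global_solution hX hF hsφ
      (fun q hq ↦ by
        rw [dirDeriv_comp_dmap hφ.contMDiff (hs.mdifferentiable (by simp) _), hXn]
        exact hpos _ (huφ q) hq)
      -- The generators in `M` lift to integral curves of `X`, so the cross-section of the
      -- hypersurface is one for `X` and `s ∘ φ`.
      (fun q ↦ by
        obtain ⟨γ, a, b, ha, hb, hγu, hγ⟩ := hjoin (φ q) (huφ q)
        obtain ⟨η, hη, hηX⟩ := exists_lift_integralCurve hφ hXn hγ
          (fun t ht ↦ by rw [hrange]; exact hγu t ht) q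
        refine exists_joinsZero hX (a := a) (b := b) (γ := η) ?_ ?_ hηX
        · exact hφ.isEmbedding.injective ((hη a Set.left_mem_uIcc).trans ha)
        · rw [hη b Set.right_mem_uIcc, hb])
    exact main Set.univ h isOpen_univ hh fun p _ ↦ hXh p
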